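/- **Setting.** Let $1<a<b$ and $y,t\in\mathbb R$. Put $k(z)=\frac i2(z-\frac1z)$, $\lambda(z)=\frac12(z+\frac1z)$, $\theta(z)=\frac i2k(z)\bigl(y-2t\lambda(z)^{-2}\bigr)$. Write $(ip,iq)$ for the open segment of the imaginary axis from $ip$ to $iq$; all segments are oriented upwards, so that the $+$ side is $\mathrm{Re}\,z<0$. Let $\rho\ge 0$ be a smooth function on $[a,b]$ with $\int_a^b\rho=1$. Let $r$ be a real-valued function that is continuous on $[ia,ib]$, locally Hölder continuous and non-vanishing on $(ia,ib)$, and satisfies $r(z^*)=r(z)=r(-1/z)=r(-1/z^*)$. For every $N$ let $z_1,\dots,z_N\in[ia,ib]$ be sampled from $\rho$, i.e. $\int_a^{-iz_j}\rho=j/N$, and let $c_j=\frac{(b-a)r(z_j)}{N\pi}$. Put $\tilde r(z)=(b-a)\,\rho(-iz)\,r(z)$ on $[ia,ib]$, extended to $[\frac ib,\frac ia]$, $[-ib,-ia]$, $[-\frac ia,-\frac ib]$ by the symmetries $\tilde r(z^*)=\tilde r(z)=\tilde r(-1/z)=\tilde r(-1/z^*)$; for the uniform density $\rho=1/(b-a)$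 one has $\tilde r=r$. **Normalization.** A $2\times2$ matrix function $M$ is called normalized if $M=I+O(1/z)$ as $z\to\infty$ and, as $z\to i$, $$M(z)=\begin{pmatrix}\cos\vartheta& i\sin\vartheta\\ i\sin\vartheta&\cos\vartheta\end{pmatrix}\bigl[I+\mu\,(z-i)\bigr]e^{\frac12h\sigma_3}+O((z-i)^2)$$ for some real $\vartheta,h$ and some real off-diagonal matrix $\mu$. (With $m=\tan2\vartheta$, $q=1/\cos2\vartheta$, so that $q^2=m^2+1$, the first factor is $\cos\vartheta\begin{pmatrix}1&\frac{im}{q+1}\\ \frac{im}{q+1}&1\end{pmatrix}$ and $\cos^2\vartheta=\frac{(q+1)^2}{m^2+(q+1)^2}$.) **Reconstruction.** We say that the real numbers $x$ and $u$ are recovered from $M$ if $$u=\lim_{z\to i}\frac1{z-i}\left(1-\frac{(M_{11}(z)+M_{21}(z))(M_{12}(z)+M_{22}(z))}{(M_{11}(i)+M_{21}(i))(M_{12}(i)+M_{22}(i))}\right),\qquad x=y-\ln\frac{M_{12}(i)+M_{22}(i)}{M_{11}(i)+M_{21}(i)},$$ where the denominators do not vanish and the argument of the logarithm is a positive real number.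 **The $N$-soliton problem.** $M^{(0)}_N$ is a normalized $2\times2$ matrix function, analytic off the points $z_j,\,-z_j^*,\,1/z_j^*,\,-1/z_j,\,z_j^*,\,-z_j,\,1/z_j,\,-1/z_j^*$, with $\mathrm{Res}_{z=p}M=\lim_{z\to p}M\begin{pmatrix}0&0\\v_p&0\end{pmatrix}$, where $v_p=c_je^{-2i\theta(p)}$, $c_j^*e^{-2i\theta(p)}$, $-\frac{c_j^*}{z_j^{*2}}e^{-2i\theta(p)}$, $-\frac{c_j}{z_j^2}e^{-2i\theta(p)}$ at $p=z_j,\,-z_j^*,\,1/z_j^*,\,-1/z_j$, and $\mathrm{Res}_{z=p}M=\lim_{z\to p}M\begin{pmatrix}0&v_p\\0&0\end{pmatrix}$, where $v_p=-c_j^*e^{2i\theta(p)}$, $-c_je^{2i\theta(p)}$, $\frac{c_j}{z_j^2}e^{2i\theta(p)}$, $\frac{c_j^*}{z_j^{*2}}e^{2i\theta(p)}$ at $p=z_j^*,\,-z_j,\,1/z_j,\,-1/z_j^*$. The numbers $x_N,u_N$ recovered from it are the (parametric) $N$-soliton data at $(y,t)$. **The two transformations.** Let $\gamma_{1+},\gamma_{2+}$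 be closed curves in the upper half-plane around $[ia,ib]$ and $[\frac ib,\frac ia]$, and $\gamma_{1-},\gamma_{2-}$ closed curves in the lower half-plane around $[-ib,-ia]$ and $[-\frac ia,-\frac ib]$, enclosing pairwise disjoint open regions whose closures do not contain $i$. Let $M^{(1)}_N=M^{(0)}_N$ off these regions, and let $M_N^{(1)}$ be $M_N^{(0)}$ times $$\begin{pmatrix}1&0\\-S_{1+}&1\end{pmatrix},\quad\begin{pmatrix}1&0\\S_{2+}&1\end{pmatrix},\quad\begin{pmatrix}1&S_{1-}\\0&1\end{pmatrix},\quad\begin{pmatrix}1&-S_{2-}\\0&1\end{pmatrix}$$ within $\gamma_{1+},\gamma_{2+},\gamma_{1-},\gamma_{2-}$ respectively, where $$S_{1+}=\sum_{j=1}^N\frac{c_je^{-2i\theta(z_j)}}{z-z_j},\quad S_{2+}=\sum_{j=1}^N\frac{c_jz_j^{-2}e^{-2i\theta(-1/z_j)}}{z+1/z_j},\quad S_{1-}=\sum_{j=1}^N\frac{c_j^*e^{2i\theta(z_j^*)}}{z-z_j^*},\quad S_{2-}=\sum_{j=1}^N\frac{c_jz_j^{-2}e^{2i\theta(1/z_j)}}{z-1/z_j}.$$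 Put $F^\mp_{(p,q)}(z)=\int_{ip}^{iq}\frac{i\tilde r(w)e^{\mp2i\theta(w)}}{\pi(z-w)}\,dw$. **Theorem.** 1. As $N\to\infty$, $S_{1+}\to-F^-_{(a,b)}$, $S_{2+}\to F^-_{(1/b,1/a)}$, $S_{1-}\to-F^+_{(-b,-a)}$, $S_{2-}\to F^+_{(-1/a,-1/b)}$, in each case uniformly on the complement of any open set containing the corresponding closed segment. 2. For every $N$ the $N$-soliton problem has a solution $M_N^{(0)}$. 3. For any such solutions, the functions $M^{(1)}_N$ converge, locally uniformly off the four closed segments $[ia,ib],[\frac ib,\frac ia],[-ib,-ia],[-\frac ia,-\frac ib]$, to a limit $M^{(1)}_\infty$. Let $M^{(3)}$ be $M^{(1)}_\infty$ times $\begin{pmatrix}1&0\\-F^-_{(a,b)}&1\end{pmatrix}$, $\begin{pmatrix}1&0\\-F^-_{(1/b,1/a)}&1\end{pmatrix}$, $\begin{pmatrix}1&F^+_{(-b,-a)}\\0&1\end{pmatrix}$, $\begin{pmatrix}1&F^+_{(-1/a,-1/b)}\\0&1\end{pmatrix}$ within $\gamma_{1+},\gamma_{2+},\gamma_{1-},\gamma_{2-}$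 respectively, and $M^{(3)}=M^{(1)}_\infty$ otherwise. Then $M^{(3)}$ solves the following Riemann–Hilbert problem: it is analytic off the four closed segments, has continuous boundary values $M^{(3)}_\pm$ on the four open segments, is normalized, and satisfies $M^{(3)}_+=M^{(3)}_-V_3$ with $$V_3=\begin{pmatrix}1&0\\-2\tilde r(z)e^{-2i\theta(z)}&1\end{pmatrix}\ \text{on }(ia,ib)\cup(\tfrac ib,\tfrac ia),\qquad V_3=\begin{pmatrix}1&2\tilde r(z)e^{2i\theta(z)}\\0&1\end{pmatrix}\ \text{on }(-ib,-ia)\cup(-\tfrac ia,-\tfrac ib).$$ In particular, for the uniform density the entries are $-2r(z)e^{-2i\theta(z)}$ and $2r(z)e^{2i\theta(z)}$. 4. Real numbers $x_N,u_N$ are recovered from $M^{(0)}_N$ (and equally from $M^{(1)}_N$) for every $N$; they converge as $N\to\infty$ to real numbers $x,u$, and $x,u$ are recovered from $M^{(3)}$ by the reconstruction formulas. -/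

import Mathlib

open Complex Filter Topology MeasureTheory Set
open scoped ContDiff

namespace MCH

noncomputable section

/-- `2 × 2` complex matrices. -/
abbrev Mat2 := Matrix (Fin 2) (Fin 2) ℂ

/-! ### Phase function -/

/-- `k(z) = (i/2)(z - 1/z)`. -/
def kfun (z : ℂ) : ℂ := I / 2 * (z - 1 / z)

/-- `λ(z) = (1/2)(z + 1/z)`. -/
def lamfun (z : ℂ) : ℂ := 1 / 2 * (z + 1 / z)

/-- `θ(y,t;z) = (i/2) k(z) (y - 2 t / λ(z)²)`. -/
def theta (y t : ℝ) (z : ℂ) : ℂ := I / 2 * kfun z * (y - 2 * t / lamfun z ^ 2)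

/-! ### Vertical segments on the imaginary axis -/

/-- The closed segment `[ip, iq]`. -/
def cseg (p q : ℝ) : Set ℂ := {z | z.re = 0 ∧ z.im ∈ Icc p q}

/-- The open segment `(ip, iq)`. -/
def oseg (p q : ℝ) : Set ℂ := {z | z.re = 0 ∧ z.im ∈ Ioo p q}

/-- `∫_{ip}^{iq} g(w) dw` along the segment of the imaginary axis, from `ip` to `iq`. -/
def segInt (p q : ℝ) (g : ℂ → ℂ) : ℂ := ∫ s in p..q, g (s * I) * I

/-- The four closed segments. -/
def closedContour (a b : ℝ) : Set ℂ :=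
  cseg a b ∪ cseg (1 / b) (1 / a) ∪ cseg (-b) (-a) ∪ cseg (-(1 / a)) (-(1 / b))

/-- The four open segments (without endpoints). -/
def openContour (a b : ℝ) : Set ℂ :=
  oseg a b ∪ oseg (1 / b) (1 / a) ∪ oseg (-b) (-a) ∪ oseg (-(1 / a)) (-(1 / b))

/-! ### Normalizations of the Riemann-Hilbert problems -/

/-- `M = I + O(1/z)` as `z → ∞`. -/
def NormalizedAtInfinity (M : ℂ → Mat2) : Prop :=
  ∀ i j, (fun z => M z i j - (1 : Mat2) i j) =O[Bornology.cobounded ℂ] fun z => 1 / z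

/-- `[[cos ϑ, i sin ϑ], [i sin ϑ, cos ϑ]]`. With `m = tan 2ϑ` and `q = 1 / cos 2ϑ` (so that
`q² = m² + 1`) one has `tan ϑ = m / (q + 1)` and `cos² ϑ = (q + 1)² / (m² + (q + 1)²)`, so that
this matrix is `cos ϑ [[1, i m/(q+1)], [i m/(q+1), 1]]`; the angle also makes sense at the
points where `q` and `m` become infinite. -/
def gaugeMatrix (ϑ : ℝ) : Mat2 :=
  !![(Real.cos ϑ : ℂ), I * (Real.sin ϑ : ℂ); I * (Real.sin ϑ : ℂ), (Real.cos ϑ : ℂ)]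

/-- `e^{h σ₃ / 2}`. -/
def expSigma (h : ℝ) : Mat2 := !![(Real.exp (h / 2) : ℂ), 0; 0, (Real.exp (-(h / 2)) : ℂ)]

/-- `M = G (I + μ (z - i)) e^{h σ₃ / 2} + O((z - i)²)` as `z → i`, with a gauge matrix `G`, a real
number `h` and a real off-diagonal matrix `μ`. -/
def NormalizedAtI (M : ℂ → Mat2) : Prop :=
  ∃ ϑ h μ₁ μ₂ : ℝ, ∀ i j,
    (fun z => (M z - gaugeMatrix ϑ * (1 + (z - I) • !![0, (μ₁ : ℂ); (μ₂ : ℂ), 0]) * expSigma h) i j)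
      =O[𝓝 I] fun z => (z - I) ^ 2

/-! ### The `N`-soliton Riemann-Hilbert problem -/

/-- `Res_{z = p} M = lim_{z → p} M(z) A`. -/
def ResidueCondition (M : ℂ → Mat2) (p : ℂ) (A : Mat2) : Prop :=
  ∃ R : Mat2, Tendsto (fun z => (z - p) • M z) (𝓝[≠] p) (𝓝 R) ∧
    Tendsto (fun z => M z * A) (𝓝[≠] p) (𝓝 R)

/-- Lower triangular nilpotent matrix. -/
def lowNil (v : ℂ) : Mat2 := !![0, 0; v, 0]

/-- Upper triangular nilpotent matrix. -/
def upNil (v : ℂ) : Mat2 := !![0, v; 0, 0]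

/-- The discrete spectrum generated by `z_j`, `j = 1, …, N`. -/
def spectrumSet {N : ℕ} (z : Fin N → ℂ) : Set ℂ :=
  {w | ∃ j, w = z j ∨ w = -star (z j) ∨ w = 1 / star (z j) ∨ w = -(1 / z j) ∨
    w = star (z j) ∨ w = -z j ∨ w = 1 / z j ∨ w = -(1 / star (z j))}

/-- The reflectionless Riemann-Hilbert problem with discrete spectrum generated by the `z_j` and
norming constants `c_j`. -/
structure SolvesSolitonRHP {N : ℕ} (z c : Fin N → ℂ) (y t : ℝ) (M : ℂ → Mat2) : Prop where
  analytic : ∀ i j, DifferentiableOn ℂ (fun w => M w i j) (spectrumSet z)ᶜ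
  res₁ : ∀ j, ResidueCondition M (z j) (lowNil (c j * exp (-2 * I * theta y t (z j))))
  res₂ : ∀ j, ResidueCondition M (-star (z j))
    (lowNil (star (c j) * exp (-2 * I * theta y t (-star (z j)))))
  res₃ : ∀ j, ResidueCondition M (1 / star (z j))
    (lowNil (-(star (c j) / star (z j) ^ 2 * exp (-2 * I * theta y t (1 / star (z j))))))
  res₄ : ∀ j, ResidueCondition M (-(1 / z j))
    (lowNil (-(c j / z j ^ 2 * exp (-2 * I * theta y t (-(1 / z j))))))
  res₅ : ∀ j, ResidueCondition M (star (z j))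
    (upNil (-(star (c j) * exp (2 * I * theta y t (star (z j))))))
  res₆ : ∀ j, ResidueCondition M (-z j) (upNil (-(c j * exp (2 * I * theta y t (-z j)))))
  res₇ : ∀ j, ResidueCondition M (1 / z j)
    (upNil (c j / z j ^ 2 * exp (2 * I * theta y t (1 / z j))))
  res₈ : ∀ j, ResidueCondition M (-(1 / star (z j)))
    (upNil (star (c j) / star (z j) ^ 2 * exp (2 * I * theta y t (-(1 / star (z j))))))
  at_infinity : NormalizedAtInfinity M
  at_I : NormalizedAtI M

/-! ### Reconstruction of the solution -/

/-- `(M₁₁ + M₂₁)(M₁₂ + M₂₂)`. -/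
def recProd (M : ℂ → Mat2) (z : ℂ) : ℂ := (M z 0 0 + M z 1 0) * (M z 0 1 + M z 1 1)

/-- `(M₁₂(i) + M₂₂(i)) / (M₁₁(i) + M₂₁(i))`. -/
def recRatio (M : ℂ → Mat2) : ℂ := (M I 0 1 + M I 1 1) / (M I 0 0 + M I 1 0)

/-- The values `x = x(y,t)` and `u = u(x(y,t),t)` are recovered from `M` by
`u = lim_{z → i} (1/(z - i)) (1 - (M₁₁(z)+M₂₁(z))(M₁₂(z)+M₂₂(z)) / ((M₁₁(i)+M₂₁(i))(M₁₂(i)+M₂₂(i))))`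
and `x = y - ln ((M₁₂(i)+M₂₂(i)) / (M₁₁(i)+M₂₁(i)))`; the denominators do not vanish and the
argument of the logarithm is a positive real number. -/
structure Recovers (y : ℝ) (M : ℂ → Mat2) (x u : ℝ) : Prop where
  den_ne : recProd M I ≠ 0
  ratio_im : (recRatio M).im = 0
  ratio_pos : 0 < (recRatio M).re
  x_eq : x = y - Real.log (recRatio M).re
  u_lim : Tendsto (fun z => 1 / (z - I) * (1 - recProd M z / recProd M I)) (𝓝[≠] I) (𝓝 (u : ℂ))

/-! ### Data on the line domain -/

/-- The function `r`, with values on the four segments: real-valued, continuous up to the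
endpoints, locally Hölder continuous and non-vanishing on `(ia, ib)`, and with the symmetry
`r(z*) = r(z) = r(-1/z) = r(-1/z*)`. -/
structure IsWeight (a b : ℝ) (r : ℂ → ℝ) : Prop where
  continuousOn : ContinuousOn r (cseg a b)
  holder : ∀ p q : ℝ, a < p → q < b → ∃ C α : NNReal, 0 < α ∧
    HolderOnWith C α (fun s : ℝ => r (s * I)) (Icc p q)
  ne_zero : ∀ z ∈ oseg a b, r z ≠ 0
  symm_star : ∀ z ∈ cseg a b, r (star z) = r z
  symm_inv : ∀ z ∈ cseg a b, r (-(1 / z)) = r z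
  symm_inv_star : ∀ z ∈ cseg a b, r (-(1 / star z)) = r z

/-- A smooth probability density on `[a, b]`. -/
structure IsSmoothDensity (a b : ℝ) (ρ : ℝ → ℝ) : Prop where
  smooth : ContDiffOn ℝ ∞ ρ (Icc a b)
  nonneg : ∀ s ∈ Icc a b, 0 ≤ ρ s
  integral_eq : ∫ s in a..b, ρ s = 1

/-- The points `z_1, …, z_N` of the segment are sampled from `ρ`:
`∫_a^{-i z_j} ρ = j / N` (the index `j : Fin N` stands for `j + 1`). -/
def IsSampled (a b : ℝ) (ρ : ℝ → ℝ) {N : ℕ} (z : Fin N → ℂ) : Prop :=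
  ∀ j, z j ∈ cseg a b ∧ ∫ s in a..(-I * z j).re, ρ s = ((j : ℕ) + 1 : ℝ) / N

/-- Norming constants `c_j = (b - a) r(z_j) / (N π)`. -/
def norming (a b : ℝ) (r : ℂ → ℝ) {N : ℕ} (z : Fin N → ℂ) (j : Fin N) : ℂ :=
  (((b - a) * r (z j) / (N * Real.pi) : ℝ) : ℂ)

/-- The limiting weight `(b - a) ρ(-iz) r(z)` on `[ia, ib]`, extended to the other three segments
by the symmetries of `r`. For the uniform density `ρ = 1/(b - a)` it is `r` itself. -/
def limitWeight (a b : ℝ) (ρ : ℝ → ℝ) (r : ℂ → ℝ) (z : ℂ) : ℝ :=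
  (b - a) * ρ (max ‖z‖ ‖z‖⁻¹) * r z

/-! ### Encircling curves and the two transformations -/

/-- The regions enclosed by the four curves `γ_{1+}, γ_{2+}` (upper half-plane) and
`γ_{1-}, γ_{2-}` (lower half-plane) around the four segments. Only "within the curve" enters
the transformations, so the enclosed regions are recorded. -/
structure Regions (a b : ℝ) where
  /-- The four regions. -/
  D1p : Set ℂ
  D2p : Set ℂ
  D1m : Set ℂ
  D2m : Set ℂ
  isOpen1p : IsOpen D1p
  isOpen2p : IsOpen D2p
  isOpen1m : IsOpen D1m
  isOpen2m : IsOpen D2m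
  seg1p : cseg a b ⊆ D1p
  seg2p : cseg (1 / b) (1 / a) ⊆ D2p
  seg1m : cseg (-b) (-a) ⊆ D1m
  seg2m : cseg (-(1 / a)) (-(1 / b)) ⊆ D2m
  upper1 : D1p ⊆ {z | 0 < z.im}
  upper2 : D2p ⊆ {z | 0 < z.im}
  lower1 : D1m ⊆ {z | z.im < 0}
  lower2 : D2m ⊆ {z | z.im < 0}
  disjp : Disjoint D1p D2p
  disjm : Disjoint D1m D2m
  I_notMem1 : I ∉ closure D1p
  I_notMem2 : I ∉ closure D2p

/-- `[[1, 0], [v, 1]]`. -/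
def low (v : ℂ) : Mat2 := !![1, 0; v, 1]

/-- `[[1, v], [0, 1]]`. -/
def up (v : ℂ) : Mat2 := !![1, v; 0, 1]

section Sums

variable {N : ℕ} (z c : Fin N → ℂ) (y t : ℝ) (w : ℂ)

/-- `∑_j c_j e^{-2iθ(z_j)} / (w - z_j)`. -/
def sum1p : ℂ := ∑ j, c j * exp (-2 * I * theta y t (z j)) / (w - z j)

/-- `∑_j (c_j / z_j²) e^{-2iθ(-1/z_j)} / (w + 1/z_j)`. -/
def sum2p : ℂ := ∑ j, c j / z j ^ 2 * exp (-2 * I * theta y t (-(1 / z j))) / (w + 1 / z j)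

/-- `∑_j c_j^* e^{2iθ(z_j^*)} / (w - z_j^*)`. -/
def sum1m : ℂ := ∑ j, star (c j) * exp (2 * I * theta y t (star (z j))) / (w - star (z j))

/-- `∑_j (c_j / z_j²) e^{2iθ(1/z_j)} / (w - 1/z_j)`. -/
def sum2m : ℂ := ∑ j, c j / z j ^ 2 * exp (2 * I * theta y t (1 / z j)) / (w - 1 / z j)

end Sums

/-- `∫_{ip}^{iq} i r(w) e^{-2iθ(w)} / (π (z - w)) dw`. -/
def cauchyMinus (p q : ℝ) (r : ℂ → ℝ) (y t : ℝ) (z : ℂ) : ℂ :=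
  segInt p q fun w => I * r w * exp (-2 * I * theta y t w) / (Real.pi * (z - w))

/-- `∫_{ip}^{iq} i r(w) e^{2iθ(w)} / (π (z - w)) dw`. -/
def cauchyPlus (p q : ℝ) (r : ℂ → ℝ) (y t : ℝ) (z : ℂ) : ℂ :=
  segInt p q fun w => I * r w * exp (2 * I * theta y t w) / (Real.pi * (z - w))

open Classical in
/-- `M^{(1)}`: the poles of `M` are removed within the four curves. -/
def removePoles {a b : ℝ} (D : Regions a b) {N : ℕ} (z c : Fin N → ℂ) (y t : ℝ)
    (M : ℂ → Mat2) (w : ℂ) : Mat2 :=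
  if w ∈ D.D1p then M w * low (-sum1p z c y t w)
  else if w ∈ D.D2p then M w * low (sum2p z c y t w)
  else if w ∈ D.D1m then M w * up (sum1m z c y t w)
  else if w ∈ D.D2m then M w * up (-sum2m z c y t w)
  else M w

open Classical in
/-- `M^{(3)}`: the transformation of the limit of `M^{(1)}` within the four curves. -/
def toSegments {a b : ℝ} (D : Regions a b) (r : ℂ → ℝ) (y t : ℝ) (M : ℂ → Mat2) (w : ℂ) : Mat2 :=
  if w ∈ D.D1p then M w * low (-cauchyMinus a b r y t w)
  else if w ∈ D.D2p then M w * low (-cauchyMinus (1 / b) (1 / a) r y t w)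
  else if w ∈ D.D1m then M w * up (cauchyPlus (-b) (-a) r y t w)
  else if w ∈ D.D2m then M w * up (cauchyPlus (-(1 / a)) (-(1 / b)) r y t w)
  else M w

/-! ### The limiting Riemann-Hilbert problem -/

/-- The jump matrix: `[[1, 0], [-2 r e^{-2iθ}, 1]]` on `(ia, ib)` and `(i/b, i/a)`,
`[[1, 2 r e^{2iθ}], [0, 1]]` on `(-ib, -ia)` and `(-i/a, -i/b)`. -/
def jump (r : ℂ → ℝ) (y t : ℝ) (z : ℂ) : Mat2 :=
  if 0 < z.im then low (-(2 * r z * exp (-2 * I * theta y t z)))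
  else up (2 * r z * exp (2 * I * theta y t z))

/-- The Riemann-Hilbert problem on the four segments, all oriented upwards, so that the
`+` side is the left one, `Re z < 0`. -/
structure SolvesLimitRHP (a b : ℝ) (r : ℂ → ℝ) (y t : ℝ) (M : ℂ → Mat2) : Prop where
  analytic : ∀ i j, DifferentiableOn ℂ (fun z => M z i j) (closedContour a b)ᶜ
  jump_cond : ∃ Mp Mm : ℂ → Mat2,
    ContinuousOn Mp (openContour a b) ∧ ContinuousOn Mm (openContour a b) ∧
    ∀ z ∈ openContour a b,
      Tendsto M (𝓝[{w | w.re < 0}] z) (𝓝 (Mp z)) ∧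
      Tendsto M (𝓝[{w | 0 < w.re}] z) (𝓝 (Mm z)) ∧
      Mp z = Mm z * jump r y t z
  at_infinity : NormalizedAtInfinity M
  at_I : NormalizedAtI M

end

end MCH

namespace MCH

/-! ### Riemann sums at the quantiles of a density -/

/-- Riemann sums at the quantiles of a density: the error is controlled by an affine modulus of
continuity. -/
theorem norm_quantile_sum_sub_integral_le {a b : ℝ} (hab : a ≤ b) {ρ : ℝ → ℝ}
    (hρc : ContinuousOn ρ (Icc a b)) (hρ0 : ∀ x ∈ Icc a b, 0 ≤ ρ x) (hρ1 : ∫ x in a..b, ρ x = 1)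
    {N : ℕ} (hN : 0 < N) {s : Fin N → ℝ} (hs : ∀ j, s j ∈ Icc a b)
    (hF : ∀ j, ∫ x in a..s j, ρ x = ((j : ℕ) + 1 : ℝ) / N) {Ψ : ℝ → ℂ}
    (hΨ : ContinuousOn Ψ (Icc a b)) {η K : ℝ} (hK : 0 ≤ K)
    (h : ∀ x ∈ Icc a b, ∀ x' ∈ Icc a b, ‖Ψ x - Ψ x'‖ ≤ η + K * |x - x'|) :
    ‖(∑ j, Ψ (s j)) / N - ∫ x in a..b, (ρ x : ℂ) * Ψ x‖ ≤ η + K * (b - a) / N := by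
  have hN' : (0 : ℝ) < N := by exact_mod_cast hN
  have hint : ∀ {u v : ℝ}, u ∈ Icc a b → v ∈ Icc a b → IntervalIntegrable ρ volume u v := by
    intro u v hu hv
    exact (hρc.mono (uIcc_subset_Icc hu hv)).intervalIntegrable
  have hintC : ∀ {u v : ℝ}, u ∈ Icc a b → v ∈ Icc a b →
      IntervalIntegrable (fun x => (ρ x : ℂ) * Ψ x) volume u v := by
    intro u v hu hv
    exact (((continuous_ofReal.comp_continuousOn hρc).mul hΨ).mono
      (uIcc_subset_Icc hu hv)).intervalIntegrable
  have ha : a ∈ Icc a b := left_mem_Icc.2 hab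
  have hb : b ∈ Icc a b := right_mem_Icc.2 hab
  set T : ℕ → ℝ := fun k => if hk : 0 < k ∧ k ≤ N then s ⟨k - 1, by omega⟩ else a with hT
  have hT0 : T 0 = a := by simp [hT]
  have hTs : ∀ j : Fin N, T (j + 1) = s j := by
    intro j
    have : (j : ℕ) + 1 ≤ N := j.2
    simp [hT, this]
  have hTm : ∀ k, T k ∈ Icc a b := by
    intro k
    simp only [hT]
    split_ifs
    · exact hs _
    · exact ha
  have hTF : ∀ k ≤ N, ∫ x in a..T k, ρ x = (k : ℝ) / N := by
    intro k hk
    rcases Nat.eq_zero_or_pos k with rfl | hk0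
    · simp [hT0]
    · obtain ⟨m, rfl⟩ : ∃ m, k = m + 1 := ⟨k - 1, by omega⟩
      have := hF ⟨m, by omega⟩
      rw [← hTs] at this
      simpa using this
  have hstep : ∀ k < N, ∫ x in T k..T (k + 1), ρ x = 1 / N := by
    intro k hk
    have h1 := hTF k hk.le
    have h2 := hTF (k + 1) hk
    have h3 := intervalIntegral.integral_add_adjacent_intervals (hint ha (hTm k))
      (hint (hTm k) (hTm (k + 1)))
    rw [h1, h2] at h3
    have : ((k + 1 : ℕ) : ℝ) / N = k / N + 1 / N := by push_cast; ring
    linarith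
  have hmono : ∀ k < N, T k ≤ T (k + 1) := by
    intro k hk
    by_contra! hlt
    have h1 := hstep k hk
    have h2 : 0 ≤ ∫ x in T (k + 1)..T k, ρ x :=
      intervalIntegral.integral_nonneg hlt.le fun x hx =>
        hρ0 x ⟨(hTm _).1.trans hx.1, hx.2.trans (hTm _).2⟩
    rw [intervalIntegral.integral_symm] at h1
    have : (0 : ℝ) < 1 / N := by positivity
    linarith
  have hpiece : ∀ k < N, ‖(Ψ (T (k + 1)) / N : ℂ) - ∫ x in T k..T (k + 1), (ρ x : ℂ) * Ψ x‖
      ≤ (η + K * (T (k + 1) - T k)) / N := by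
    intro k hk
    have hbd : ∀ x ∈ Icc (T k) (T (k + 1)),
        ‖Ψ (T (k + 1)) - Ψ x‖ ≤ η + K * (T (k + 1) - T k) := by
      intro x hx
      have hxm : x ∈ Icc a b := ⟨(hTm _).1.trans hx.1, hx.2.trans (hTm _).2⟩
      refine (h _ (hTm _) _ hxm).trans ?_
      rw [abs_of_nonneg (by linarith [hx.2])]
      have : K * (T (k + 1) - x) ≤ K * (T (k + 1) - T k) :=
        mul_le_mul_of_nonneg_left (by linarith [hx.1]) hK
      linarith
    have hρi := hint (hTm k) (hTm (k + 1))
    have e1 : (Ψ (T (k + 1)) / N : ℂ) = ∫ x in T k..T (k + 1), (ρ x : ℂ) * Ψ (T (k + 1)) := by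
      rw [intervalIntegral.integral_mul_const, intervalIntegral.integral_ofReal, hstep k hk]
      push_cast
      ring
    have e2 : (Ψ (T (k + 1)) / N : ℂ) - ∫ x in T k..T (k + 1), (ρ x : ℂ) * Ψ x
        = ∫ x in T k..T (k + 1), (ρ x : ℂ) * (Ψ (T (k + 1)) - Ψ x) := by
      rw [e1, ← intervalIntegral.integral_sub]
      · simp only [mul_sub]
      · exact (((continuous_ofReal.comp_continuousOn hρc).mono
          (uIcc_subset_Icc (hTm k) (hTm (k + 1)))).intervalIntegrable).mul_const _
      · exact hintC (hTm k) (hTm (k + 1))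
    rw [e2]
    calc _ ≤ ∫ x in T k..T (k + 1), ρ x * (η + K * (T (k + 1) - T k)) := by
          refine intervalIntegral.norm_integral_le_of_norm_le (hmono k hk) ?_ (hρi.mul_const _)
          refine ae_of_all _ fun x hx => ?_
          have hx' : x ∈ Icc (T k) (T (k + 1)) := Ioc_subset_Icc_self hx
          have h0 : 0 ≤ ρ x := hρ0 x ⟨(hTm _).1.trans hx'.1, hx'.2.trans (hTm _).2⟩
          rw [norm_mul, Complex.norm_real, Real.norm_of_nonneg h0]
          exact mul_le_mul_of_nonneg_left (hbd x hx') h0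
      _ = _ := by
          rw [intervalIntegral.integral_mul_const, hstep k hk]
          ring
  have hlast : ∫ x in T N..b, (ρ x : ℂ) * Ψ x = 0 := by
    have h0 : ∫ x in T N..b, ρ x = 0 := by
      have h3 := intervalIntegral.integral_add_adjacent_intervals (hint ha (hTm N))
        (hint (hTm N) hb)
      rw [hTF N le_rfl, hρ1, div_self hN'.ne'] at h3
      linarith
    obtain ⟨C, hC⟩ := isCompact_Icc.exists_bound_of_continuousOn hΨ
    have h1 : ‖∫ x in T N..b, (ρ x : ℂ) * Ψ x‖ ≤ ∫ x in T N..b, ρ x * C := by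
      refine intervalIntegral.norm_integral_le_of_norm_le (hTm N).2 ?_
        ((hint (hTm N) hb).mul_const _)
      refine ae_of_all _ fun x hx => ?_
      have hx' : x ∈ Icc a b := ⟨(hTm _).1.trans hx.1.le, hx.2⟩
      rw [norm_mul, Complex.norm_real, Real.norm_of_nonneg (hρ0 x hx')]
      exact mul_le_mul_of_nonneg_left (hC x hx') (hρ0 x hx')
    rw [intervalIntegral.integral_mul_const, h0, zero_mul] at h1
    exact norm_le_zero_iff.1 h1
  have hsplit : ∫ x in a..b, (ρ x : ℂ) * Ψ x
      = ∑ k ∈ Finset.range N, ∫ x in T k..T (k + 1), (ρ x : ℂ) * Ψ x := by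
    rw [intervalIntegral.sum_integral_adjacent_intervals
      fun k _ => hintC (hTm k) (hTm (k + 1)), hT0,
      ← intervalIntegral.integral_add_adjacent_intervals (hintC ha (hTm N)) (hintC (hTm N) hb),
      hlast, add_zero]
  have hsum : (∑ j, Ψ (s j)) / (N : ℂ) = ∑ k ∈ Finset.range N, Ψ (T (k + 1)) / N := by
    rw [Finset.sum_range, Finset.sum_div]
    exact Finset.sum_congr rfl fun j _ => by rw [hTs]
  rw [hsum, hsplit, ← Finset.sum_sub_distrib]
  calc _ ≤ ∑ k ∈ Finset.range N, (η + K * (T (k + 1) - T k)) / N :=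
        norm_sum_le_of_le _ fun k hk => hpiece k (Finset.mem_range.1 hk)
    _ = η + K * (T N - T 0) / N := by
        rw [← Finset.sum_div, Finset.sum_add_distrib, ← Finset.mul_sum, Finset.sum_range_sub]
        simp only [Finset.sum_const, Finset.card_range, nsmul_eq_mul]
        field_simp
    _ ≤ _ := by
        rw [hT0]
        gcongr
        exact (hTm N).2

/-- A continuous function on a compact interval has, for every `η > 0`, an affine modulus of
continuity `η + K |x - x'|`. -/
theorem exists_affine_modulus {a b : ℝ} {f : ℝ → ℂ} (hf : ContinuousOn f (Icc a b)) {η : ℝ}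
    (hη : 0 < η) :
    ∃ K, 0 ≤ K ∧ ∀ x ∈ Icc a b, ∀ x' ∈ Icc a b, ‖f x - f x'‖ ≤ η + K * |x - x'| := by
  obtain ⟨C, hC⟩ := isCompact_Icc.exists_bound_of_continuousOn hf
  have hu := isCompact_Icc.uniformContinuousOn_of_continuous hf
  obtain ⟨δ, hδ, hδ'⟩ := Metric.uniformContinuousOn_iff.1 hu η hη
  refine ⟨2 * |C| / δ, by positivity, fun x hx x' hx' => ?_⟩
  by_cases hd : dist x x' < δ
  · have h1 := (hδ' x hx x' hx' hd).le
    rw [dist_eq_norm] at h1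
    have : 0 ≤ 2 * |C| / δ * |x - x'| := by positivity
    linarith
  · have h1 : ‖f x - f x'‖ ≤ 2 * |C| := by
      have := norm_sub_le (f x) (f x')
      linarith [hC x hx, hC x' hx', le_abs_self C]
    have h2 : 2 * |C| ≤ 2 * |C| / δ * |x - x'| := by
      rw [div_mul_eq_mul_div, le_div_iff₀ hδ]
      have : δ ≤ |x - x'| := by rwa [Real.dist_eq, not_lt] at hd
      gcongr
    linarith

/-- Riemann sums at the quantiles of a density, weighted by a continuous function, converge
uniformly on bounded sets of Lipschitz functions. -/
theorem eventually_quantile_sum_approx {a b : ℝ} (hab : a ≤ b) {ρ : ℝ → ℝ}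
    (hρc : ContinuousOn ρ (Icc a b)) (hρ0 : ∀ x ∈ Icc a b, 0 ≤ ρ x) (hρ1 : ∫ x in a..b, ρ x = 1)
    {s : (N : ℕ) → Fin N → ℝ} (hs : ∀ N j, s N j ∈ Icc a b)
    (hF : ∀ N j, ∫ x in a..s N j, ρ x = ((j : ℕ) + 1 : ℝ) / N) {w : ℝ → ℂ}
    (hw : ContinuousOn w (Icc a b)) (B K : ℝ) {ε : ℝ} (hε : 0 < ε) :
    ∀ᶠ N : ℕ in atTop, ∀ φ : ℝ → ℂ, (∀ x ∈ Icc a b, ‖φ x‖ ≤ B) →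
      (∀ x ∈ Icc a b, ∀ x' ∈ Icc a b, ‖φ x - φ x'‖ ≤ K * |x - x'|) →
      ‖(∑ j, w (s N j) * φ (s N j)) / N - ∫ x in a..b, (ρ x : ℂ) * (w x * φ x)‖ ≤ ε := by
  obtain ⟨C, hC⟩ := isCompact_Icc.exists_bound_of_continuousOn hw
  obtain ⟨K', hK', hm⟩ := exists_affine_modulus hw (η := ε / (2 * (|B| + 1))) (by positivity)
  set K₁ := K' * |B| + |C| * |K| with hK₁
  have hK₁0 : 0 ≤ K₁ := by positivity
  have hlim : Tendsto (fun N : ℕ => K₁ * (b - a) / (N : ℝ)) atTop (𝓝 0) :=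
    tendsto_const_div_atTop_nhds_zero_nat _
  filter_upwards [hlim.eventually_le_const (half_pos hε), eventually_gt_atTop 0] with N hN hN0 φ hB hL
  have hφc : ContinuousOn φ (Icc a b) := by
    have : LipschitzOnWith (Real.toNNReal |K|) φ (Icc a b) := by
      refine LipschitzOnWith.of_dist_le_mul fun x hx y hy => ?_
      rw [dist_eq_norm, Real.dist_eq, Real.coe_toNNReal _ (abs_nonneg K)]
      exact (hL x hx y hy).trans (by gcongr; exact le_abs_self K)
    exact this.continuousOn
  have key := norm_quantile_sum_sub_integral_le hab hρc hρ0 hρ1 hN0 (hs N) (hF N)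
    (Ψ := fun x => w x * φ x) (hw.mul hφc) (η := ε / 2) hK₁0 ?_
  · linarith
  · intro x hx x' hx'
    have e : w x * φ x - w x' * φ x' = (w x - w x') * φ x + w x' * (φ x - φ x') := by ring
    rw [e]
    have h1 : ‖(w x - w x') * φ x‖ ≤ (ε / (2 * (|B| + 1)) + K' * |x - x'|) * |B| := by
      rw [norm_mul]
      exact mul_le_mul (hm x hx x' hx') ((hB x hx).trans (le_abs_self B)) (norm_nonneg _)
        (by positivity)
    have h2 : ‖w x' * (φ x - φ x')‖ ≤ |C| * (|K| * |x - x'|) := by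
      rw [norm_mul]
      refine mul_le_mul ((hC x' hx').trans (le_abs_self C)) ((hL x hx x' hx').trans ?_)
        (norm_nonneg _) (by positivity)
      gcongr
      exact le_abs_self K
    have h3 : ε / (2 * (|B| + 1)) * |B| ≤ ε / 2 := by
      rw [div_mul_eq_mul_div, div_le_div_iff₀ (by positivity) two_pos]
      nlinarith [abs_nonneg B]
    calc _ ≤ _ := norm_add_le _ _
      _ ≤ ε / 2 + K₁ * |x - x'| := by rw [hK₁]; linarith

/-! ### The scalar linear system -/

section System

variable {ι : Type*} [Fintype ι] {v τ : ι → ℝ}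

/-- `∑_l v_l f_l / (x + τ_l)`. -/
noncomputable def carlemanSum (v τ : ι → ℝ) (f : ι → ℂ) (x : ℝ) : ℂ :=
  ∑ l, (v l : ℂ) * f l / ((x + τ l : ℝ) : ℂ)

/-- The weighted `ℓ¹` bound for solutions of the system `f - i K f = φ`: it rests on the symmetry
of the kernel and on the weights having one sign. -/
theorem sum_abs_mul_norm_le (hv : (∀ l, 0 ≤ v l) ∨ ∀ l, v l ≤ 0) {f φ : ι → ℂ}
    (hf : ∀ k, f k = φ k + I * carlemanSum v τ f (τ k)) {B : ℝ} (hB : ∀ k, ‖φ k‖ ≤ B) :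
    ∑ l, |v l| * ‖f l‖ ≤ (∑ l, |v l|) * B := by
  obtain ⟨e, he, hev⟩ : ∃ e : ℝ, e * e = 1 ∧ ∀ l, v l = e * |v l| := by
    rcases hv with hv | hv
    · exact ⟨1, by norm_num, fun l => by rw [abs_of_nonneg (hv l), one_mul]⟩
    · exact ⟨-1, by norm_num, fun l => by rw [abs_of_nonpos (hv l)]; ring⟩
  set S := ∑ l, |v l| * ‖f l‖ with hS
  set Q := ∑ l, |v l| * ‖f l‖ ^ 2 with hQ
  have hS0 : 0 ≤ S := Finset.sum_nonneg fun l _ => by positivity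
  have hV0 : 0 ≤ ∑ l, |v l| := Finset.sum_nonneg fun l _ => abs_nonneg _
  set D : ℂ := ∑ k, ∑ l, ((|v k| : ℝ) : ℂ) * ((|v l| : ℝ) : ℂ) * (star (f k) * f l) /
    ((τ k + τ l : ℝ) : ℂ) with hD
  have hDr : star D = D := by
    rw [hD, star_sum]
    simp_rw [star_sum]
    rw [Finset.sum_comm]
    refine Finset.sum_congr rfl fun k _ => Finset.sum_congr rfl fun l _ => ?_
    simp only [RCLike.star_def, map_div₀, map_mul, conj_ofReal, RingHomCompTriple.comp_apply,
      RingHom.id_apply]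
    rw [add_comm (τ l)]
    ring
  have hDim : D.im = 0 := by
    have := congrArg Complex.im hDr
    simp at this
    linarith
  have hsum : (Q : ℂ) = (∑ k, ((|v k| : ℝ) : ℂ) * (star (f k) * φ k)) + I * (e * D) := by
    rw [hQ, hD, Finset.mul_sum, Finset.mul_sum, ← Finset.sum_add_distrib, ofReal_sum]
    refine Finset.sum_congr rfl fun k _ => ?_
    have h1 : ((‖f k‖ ^ 2 : ℝ) : ℂ) = star (f k) * f k := by
      rw [RCLike.star_def, mul_comm, Complex.mul_conj, Complex.normSq_eq_norm_sq]
    rw [ofReal_mul, h1]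
    nth_rewrite 2 [hf k]
    rw [carlemanSum, mul_add, mul_add]
    congr 1
    rw [Finset.mul_sum, Finset.mul_sum, Finset.mul_sum, Finset.mul_sum, Finset.mul_sum]
    refine Finset.sum_congr rfl fun l _ => ?_
    have hvl : (v l : ℂ) = e * ((|v l| : ℝ) : ℂ) := by exact_mod_cast hev l
    rw [hvl]
    push_cast
    ring
  have hQle : Q ≤ B * S := by
    have h2 := congrArg Complex.re hsum
    have h3 : (I * (e * D)).re = 0 := by simp [hDim]
    rw [add_re, h3, add_zero, ofReal_re] at h2
    rw [h2]
    refine (Complex.re_le_norm _).trans ((norm_sum_le _ _).trans ?_)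
    rw [hS, Finset.mul_sum]
    refine Finset.sum_le_sum fun k _ => ?_
    rw [norm_mul, norm_mul, norm_star, Complex.norm_real, Real.norm_of_nonneg (abs_nonneg _)]
    calc _ ≤ |v k| * (‖f k‖ * B) := by gcongr; exact hB k
      _ = _ := by ring
  have hCS : S ^ 2 ≤ (∑ l, |v l|) * Q := by
    refine Finset.sum_sq_le_sum_mul_sum_of_sq_le_mul _ (fun _ _ => abs_nonneg _)
      (fun _ _ => by positivity) fun l _ => (by ring : _ = _).le
  rcases hS0.eq_or_lt with h0 | h0
  · rw [← h0]
    by_cases hι : Nonempty ι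
    · obtain ⟨k⟩ := hι
      exact mul_nonneg hV0 ((norm_nonneg _).trans (hB k))
    · have : IsEmpty ι := not_nonempty_iff.1 hι
      simp
  · have : S * S ≤ (∑ l, |v l|) * B * S := by nlinarith
    exact le_of_mul_le_mul_right this h0

/-- The sum over a one-signed system is bounded in terms of the total weight. -/
theorem norm_carlemanSum_le {f : ι → ℂ} {d : ℝ} (hd : 0 < d) (hτ : ∀ l, d ≤ τ l) {x : ℝ}
    (hx : d ≤ x) : ‖carlemanSum v τ f x‖ ≤ (∑ l, |v l| * ‖f l‖) / (2 * d) := by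
  rw [carlemanSum, Finset.sum_div]
  refine norm_sum_le_of_le _ fun l _ => ?_
  rw [norm_div, norm_mul, Complex.norm_real, Complex.norm_real, Real.norm_eq_abs]
  have h1 : 2 * d ≤ ‖x + τ l‖ := by
    rw [Real.norm_of_nonneg (by linarith [hτ l])]
    linarith [hτ l]
  gcongr

theorem eq_zero_of_system (hv : (∀ l, 0 ≤ v l) ∨ ∀ l, v l ≤ 0) {d : ℝ} (hd : 0 < d)
    (hτ : ∀ l, d ≤ τ l) {f : ι → ℂ} (hf : ∀ k, f k = I * carlemanSum v τ f (τ k)) : f = 0 := by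
  have h := sum_abs_mul_norm_le hv (f := f) (φ := fun _ => 0) (B := 0)
    (fun k => by rw [zero_add]; exact hf k) (by simp)
  funext k
  rw [hf k, Pi.zero_apply, ← norm_le_zero_iff, norm_mul, norm_I, one_mul]
  refine (norm_carlemanSum_le hd hτ (hτ k)).trans ?_
  rw [mul_zero] at h
  exact div_nonpos_of_nonpos_of_nonneg h (by positivity)

theorem carlemanSum_sub (f g : ι → ℂ) (x : ℝ) :
    carlemanSum v τ (f - g) x = carlemanSum v τ f x - carlemanSum v τ g x := by
  simp only [carlemanSum, ← Finset.sum_sub_distrib, Pi.sub_apply]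
  exact Finset.sum_congr rfl fun l _ => by ring

theorem carlemanSum_const_mul (c : ℂ) (f : ι → ℂ) (x : ℝ) :
    carlemanSum v τ (fun l => c * f l) x = c * carlemanSum v τ f x := by
  simp only [carlemanSum, Finset.mul_sum]
  exact Finset.sum_congr rfl fun l _ => by ring

theorem star_carlemanSum (f : ι → ℂ) (x : ℝ) :
    star (carlemanSum v τ f x) = carlemanSum v τ (fun l => star (f l)) x := by
  simp only [carlemanSum, star_sum, RCLike.star_def, map_div₀, map_mul, conj_ofReal]

theorem system_unique (hv : (∀ l, 0 ≤ v l) ∨ ∀ l, v l ≤ 0) {d : ℝ} (hd : 0 < d)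
    (hτ : ∀ l, d ≤ τ l) {f g φ : ι → ℂ} (hf : ∀ k, f k = φ k + I * carlemanSum v τ f (τ k))
    (hg : ∀ k, g k = φ k + I * carlemanSum v τ g (τ k)) : f = g := by
  refine sub_eq_zero.1 (eq_zero_of_system hv hd hτ fun k => ?_)
  rw [carlemanSum_sub, Pi.sub_apply, hf, hg]
  ring

theorem exists_system_solution (hv : (∀ l, 0 ≤ v l) ∨ ∀ l, v l ≤ 0) {d : ℝ} (hd : 0 < d)
    (hτ : ∀ l, d ≤ τ l) : ∃ g : ι → ℂ, ∀ k, g k = 1 + I * carlemanSum v τ g (τ k) := by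
  let T : (ι → ℂ) →ₗ[ℂ] (ι → ℂ) :=
    { toFun := fun f k => f k - I * carlemanSum v τ f (τ k)
      map_add' := fun f g => by
        funext k
        simp only [carlemanSum, Pi.add_apply, mul_add, add_div, Finset.sum_add_distrib]
        ring
      map_smul' := fun c f => by
        funext k
        have := carlemanSum_const_mul (v := v) (τ := τ) c f (τ k)
        simp only [Pi.smul_apply, smul_eq_mul, RingHom.id_apply]
        change c * f k - I * carlemanSum v τ (fun l => c * f l) (τ k) = _
        rw [this]
        ring }
  have hinj : Function.Injective T := by
    rw [← LinearMap.ker_eq_bot, LinearMap.ker_eq_bot']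
    exact fun f hf => eq_zero_of_system hv hd hτ fun k => sub_eq_zero.1 (congrFun hf k)
  obtain ⟨g, hg⟩ := LinearMap.injective_iff_surjective.1 hinj fun _ => 1
  exact ⟨g, fun k => sub_eq_iff_eq_add.1 (congrFun hg k)⟩

end System

/-! ### Matrices built from one scalar function -/

theorem tendsto_mat2_iff {α : Type*} {l : Filter α} {F : α → Mat2} {R : Mat2} :
    Tendsto F l (𝓝 R) ↔ ∀ i j, Tendsto (fun x => F x i j) l (𝓝 (R i j)) := by
  refine (tendsto_pi_nhds (f := F) (g := R)).trans (forall_congr' fun i => ?_)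
  exact tendsto_pi_nhds (f := fun x => F x i)

/-- `z ↦ conj (G (-conj z))`. -/
noncomputable def reflConj (G : ℂ → ℂ) (z : ℂ) : ℂ := star (G (-star z))

/-- The matrix function with `(1, 1) M = (G(z), G(-z))` and `(1, -1) M = (H(z), -H(-z))`, where
`H` is the reflection of `G`. -/
noncomputable def symMatrix (G : ℂ → ℂ) (z : ℂ) : Mat2 :=
  !![(G z + reflConj G z) / 2, (G (-z) - reflConj G (-z)) / 2;
    (G z - reflConj G z) / 2, (G (-z) + reflConj G (-z)) / 2]

/-! ### The row function of a reflectionless problem -/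

section RowFun

variable {ι : Type*} [Fintype ι] {v τ : ι → ℝ}

/-- `1 + ∑_l v_l g_l / (z - i τ_l)`. -/
noncomputable def rowFun (v τ : ι → ℝ) (g : ι → ℂ) (z : ℂ) : ℂ :=
  1 + ∑ l, (v l : ℂ) * g l / (z - τ l * I)

theorem reflConj_rowFun (g : ι → ℂ) (z : ℂ) :
    reflConj (rowFun v τ g) z = 1 - ∑ l, (v l : ℂ) * star (g l) / (z - τ l * I) := by
  simp only [reflConj, rowFun, star_add, star_one, star_sum]
  rw [sub_eq_add_neg, ← Finset.sum_neg_distrib]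
  refine congrArg _ (Finset.sum_congr rfl fun l _ => ?_)
  simp only [RCLike.star_def, map_div₀, map_mul, conj_ofReal, map_sub, map_neg, conj_I,
    Complex.conj_conj]
  rw [← neg_div_neg_eq, neg_div, ← neg_div]
  ring

theorem rowFun_neg_mul_I (g : ι → ℂ) (x : ℝ) :
    rowFun v τ g (-(x * I)) = 1 + I * carlemanSum v τ g x := by
  rw [rowFun, carlemanSum, Finset.mul_sum]
  congr 1
  refine Finset.sum_congr rfl fun l _ => ?_
  have : (-(x * I) - τ l * I : ℂ) = ((x + τ l : ℝ) : ℂ) * (-I) := by push_cast; ring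
  rw [this, ← div_div, div_eq_mul_inv _ (-I), inv_neg, inv_I]
  ring

theorem differentiableAt_rowFun (g : ι → ℂ) {z : ℂ} (hz : ∀ l, z ≠ τ l * I) :
    DifferentiableAt ℂ (rowFun v τ g) z := by
  unfold rowFun
  refine (differentiableAt_const _).add (DifferentiableAt.fun_sum fun l _ => ?_)
  exact (differentiableAt_const _).div (differentiableAt_id.sub_const _) (sub_ne_zero.2 (hz l))

theorem differentiableAt_reflConj {G : ℂ → ℂ} {z : ℂ} (h : DifferentiableAt ℂ G (-star z)) :
    DifferentiableAt ℂ (reflConj G) z := by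
  have h1 : DifferentiableAt ℂ (fun w => G (-w)) (star z) := by
    have : DifferentiableAt ℂ (fun w : ℂ => -w) (star z) := differentiableAt_id.neg
    exact DifferentiableAt.comp (star z) h this
  have := h1.star_star
  simp only [star_star] at this
  exact this

/-- The jump relations behind `det M = 1`. -/
theorem rowFun_det {g : ι → ℂ} (hg : ∀ k, g k = 1 + I * carlemanSum v τ g (τ k))
    (hτ : ∀ l, 0 < τ l) {z : ℂ} (hz : ∀ l, z ≠ τ l * I) (hz' : ∀ l, z ≠ -(τ l * I)) :
    rowFun v τ g z * reflConj (rowFun v τ g) (-z) + reflConj (rowFun v τ g) z * rowFun v τ g (-z)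
      = 2 := by
  have hh : ∀ k, star (g k) = 1 - I * carlemanSum v τ (fun l => star (g l)) (τ k) := by
    intro k
    have := congrArg star (hg k)
    rw [star_add, star_mul', star_carlemanSum] at this
    rw [this]
    simp
    ring
  rw [reflConj_rowFun, reflConj_rowFun]
  unfold rowFun
  set h : ι → ℂ := fun l => star (g l) with hhdef
  have hneg : ∀ f : ι → ℂ, ∑ l, (v l : ℂ) * f l / (-z - τ l * I)
      = -∑ l, (v l : ℂ) * f l / (z + τ l * I) := by
    intro f
    rw [← Finset.sum_neg_distrib]
    refine Finset.sum_congr rfl fun l _ => ?_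
    rw [← div_neg]
    congr 1
    ring
  have hprod : ∀ f f' : ι → ℂ, (∑ l, (v l : ℂ) * f l / (z - τ l * I)) *
      (∑ m, (v m : ℂ) * f' m / (z + τ m * I))
      = (∑ l, (v l : ℂ) * f l / (z - τ l * I) * (-I * carlemanSum v τ f' (τ l)))
        - ∑ m, (v m : ℂ) * f' m / (z + τ m * I) * (-I * carlemanSum v τ f (τ m)) := by
    intro f f'
    have e1 : ∀ l, (v l : ℂ) * f l / (z - τ l * I) * (-I * carlemanSum v τ f' (τ l))
        = ∑ m, (v l : ℂ) * f l * (v m * f' m) * (-I / ((z - τ l * I) * ((τ l + τ m : ℝ) : ℂ))) := by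
      intro l
      rw [carlemanSum, Finset.mul_sum, Finset.mul_sum]
      refine Finset.sum_congr rfl fun m _ => ?_
      rw [div_mul_eq_div_div]
      ring
    have e2 : ∀ m, (v m : ℂ) * f' m / (z + τ m * I) * (-I * carlemanSum v τ f (τ m))
        = ∑ l, (v l : ℂ) * f l * (v m * f' m) * (-I / ((z + τ m * I) * ((τ l + τ m : ℝ) : ℂ))) := by
      intro m
      rw [carlemanSum, Finset.mul_sum, Finset.mul_sum]
      refine Finset.sum_congr rfl fun l _ => ?_
      rw [div_mul_eq_div_div, add_comm (τ m)]
      ring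
    rw [Finset.sum_congr rfl fun l _ => e1 l, Finset.sum_congr rfl fun m _ => e2 m]
    rw [Finset.sum_comm (s := Finset.univ) (t := Finset.univ)
      (f := fun m l => (v l : ℂ) * f l * (v m * f' m) *
        (-I / ((z + τ m * I) * ((τ l + τ m : ℝ) : ℂ)))), Finset.sum_mul_sum,
      ← Finset.sum_sub_distrib]
    refine Finset.sum_congr rfl fun l _ => ?_
    rw [← Finset.sum_sub_distrib]
    refine Finset.sum_congr rfl fun m _ => ?_
    have n1 : z - τ l * I ≠ 0 := sub_ne_zero.2 (hz l)
    have n2 : z + τ m * I ≠ 0 := by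
      intro h0
      exact hz' m (eq_neg_of_add_eq_zero_left h0)
    have n3 : (τ l : ℂ) + τ m ≠ 0 := by
      have : (0 : ℝ) < τ l + τ m := add_pos (hτ l) (hτ m)
      exact_mod_cast this.ne'
    have key : (z + τ m * I) - (z - τ l * I) = I * (τ l + τ m) := by ring
    rw [ofReal_add]
    generalize z + τ m * I = Q at *
    generalize z - τ l * I = P at *
    generalize (τ l : ℂ) + τ m = R at *
    field_simp
    linear_combination ((v l : ℂ) * f l * v m * f' m) * I * key
      + ((v l : ℂ) * f l * v m * f' m * R) * I_sq
  have hgK : ∀ k, -I * carlemanSum v τ g (τ k) = 1 - g k := fun k => by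
    linear_combination hg k
  have hhK : ∀ k, -I * carlemanSum v τ h (τ k) = h k - 1 := fun k => by
    linear_combination -hh k
  have p1 := hprod g h
  have p2 := hprod h g
  simp only [hgK, hhK] at p1 p2
  have q1 : (∑ l, (v l : ℂ) * g l / (z - τ l * I) * (h l - 1)) +
      ∑ l, (v l : ℂ) * h l / (z - τ l * I) * (1 - g l)
      = (∑ l, (v l : ℂ) * h l / (z - τ l * I)) - ∑ l, (v l : ℂ) * g l / (z - τ l * I) := by
    rw [← Finset.sum_add_distrib, ← Finset.sum_sub_distrib]
    exact Finset.sum_congr rfl fun l _ => by ring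
  have q2 : (∑ l, (v l : ℂ) * h l / (z + τ l * I) * (1 - g l)) +
      ∑ l, (v l : ℂ) * g l / (z + τ l * I) * (h l - 1)
      = (∑ l, (v l : ℂ) * h l / (z + τ l * I)) - ∑ l, (v l : ℂ) * g l / (z + τ l * I) := by
    rw [← Finset.sum_add_distrib, ← Finset.sum_sub_distrib]
    exact Finset.sum_congr rfl fun l _ => by ring
  rw [hneg, hneg]
  linear_combination p1 + p2 + q1 - q2

/-- The symmetry `z ↦ -1/z` of the row function. -/
theorem reflConj_rowFun_inv (hv : (∀ l, 0 ≤ v l) ∨ ∀ l, v l ≤ 0) {d : ℝ} (hd : 0 < d)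
    (hτ : ∀ l, d ≤ τ l) (σ : ι ≃ ι) (hσσ : ∀ l, σ (σ l) = l) (hστ : ∀ l, τ (σ l) = 1 / τ l)
    (hσv : ∀ l, v (σ l) = v l / τ l ^ 2) {g : ι → ℂ}
    (hg : ∀ k, g k = 1 + I * carlemanSum v τ g (τ k)) {z : ℂ} (hz0 : z ≠ 0)
    (hz : ∀ l, z ≠ τ l * I) :
    reflConj (rowFun v τ g) z = reflConj (rowFun v τ g) 0 * rowFun v τ g (-(1 / z)) := by
  have hτ0 : ∀ l, τ l ≠ 0 := fun l => (hd.trans_le (hτ l)).ne'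
  have hτ0' : ∀ l, (τ l : ℂ) ≠ 0 := fun l => by exact_mod_cast hτ0 l
  have hh : ∀ k, star (g k) = 1 - I * carlemanSum v τ (fun l => star (g l)) (τ k) := by
    intro k
    have := congrArg star (hg k)
    rw [star_add, star_mul', star_carlemanSum] at this
    rw [this]
    simp
    ring
  have hc : reflConj (rowFun v τ g) 0 = 1 - I * ∑ l, (v l : ℂ) * star (g l) / τ l := by
    rw [reflConj_rowFun, Finset.mul_sum]
    congr 1
    refine Finset.sum_congr rfl fun l _ => ?_
    rw [zero_sub, div_neg, ← div_div, div_I]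
    ring
  set c := reflConj (rowFun v τ g) 0 with hcdef
  have hc' : c = 1 - I * ∑ l, (v l : ℂ) * star (g (σ l)) / τ l := by
    rw [hc, ← Equiv.sum_comp σ]
    congr 2
    refine Finset.sum_congr rfl fun l _ => ?_
    have := hτ0' l
    rw [hστ, hσv]
    push_cast
    field_simp
  have hf : (fun k => star (g (σ k))) = fun k => c * g k := by
    refine system_unique hv hd hτ (φ := fun _ => c) (fun k => ?_) fun k => ?_
    · rw [hh, hc', carlemanSum, carlemanSum, ← Equiv.sum_comp σ, Finset.mul_sum, Finset.mul_sum,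
        Finset.mul_sum, sub_add, ← Finset.sum_sub_distrib]
      congr 1
      refine Finset.sum_congr rfl fun l _ => ?_
      rw [hστ, hστ, hσv]
      have n1 := hτ0' l
      have n2 := hτ0' k
      have n3 : (τ k : ℂ) + τ l ≠ 0 := by
        have : (0 : ℝ) < τ k + τ l := add_pos (hd.trans_le (hτ k)) (hd.trans_le (hτ l))
        exact_mod_cast this.ne'
      have n4 : (τ l : ℂ) + τ k ≠ 0 := by rwa [add_comm]
      push_cast
      field_simp
      ring
    · rw [carlemanSum_const_mul]
      linear_combination c * hg k
  have hgσ : ∀ l, star (g l) = c * g (σ l) := fun l => by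
    have := congrFun hf (σ l)
    simpa only [hσσ] using this
  rw [reflConj_rowFun, rowFun, mul_add, mul_one]
  nth_rewrite 1 [hc]
  rw [← Equiv.sum_comp σ (fun l => (v l : ℂ) * g l / (-(1 / z) - τ l * I)), Finset.mul_sum,
    Finset.mul_sum, sub_add, ← Finset.sum_sub_distrib]
  congr 1
  refine Finset.sum_congr rfl fun l _ => ?_
  rw [hgσ, hστ, hσv]
  have n1 := hτ0' l
  have n2 : z - τ l * I ≠ 0 := sub_ne_zero.2 (hz l)
  have n3 : (-(1 / z) - ((1 / τ l : ℝ) : ℂ) * I)⁻¹ = I * (z * τ l) / (z - τ l * I) := by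
    have e : -(1 / z) - ((1 / τ l : ℝ) : ℂ) * I = -I * (z - τ l * I) / (z * τ l) := by
      push_cast
      field_simp
      ring_nf
      linear_combination (-(τ l : ℂ)) * I_sq
    rw [e, inv_div, div_eq_div_iff (mul_ne_zero (neg_ne_zero.2 I_ne_zero) n2) n2]
    linear_combination (z * τ l * (z - τ l * I)) * I_sq
  have n4 : I * (z - τ l * I) - τ l = I * z := by linear_combination (-(τ l : ℂ)) * I_sq
  rw [div_eq_mul_inv _ (-(1 / z) - _), n3]
  push_cast
  calc _ = (v l : ℂ) * c * g (σ l) / (τ l * (z - τ l * I)) * τ l := by field_simp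
    _ = (v l : ℂ) * c * g (σ l) / (τ l * (z - τ l * I)) * (I * (z - τ l * I) - I * z) := by
        rw [← n4]
        ring
    _ = _ := by field_simp

/-- A function which is analytic off finitely many points has no residue at the points of
analyticity. -/
theorem tendsto_sub_mul_of_continuousAt {f : ℂ → ℂ} {p : ℂ} (hf : ContinuousAt f p) :
    Tendsto (fun z => (z - p) * f z) (𝓝[≠] p) (𝓝 0) := by
  have : ContinuousAt (fun z => (z - p) * f z) p := (continuousAt_id.sub continuousAt_const).mul hf
  have h := this.tendsto
  simp only [sub_self, zero_mul] at h
  exact h.mono_left nhdsWithin_le_nhds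

/-- The residue of a finite sum of simple poles. -/
theorem tendsto_sub_mul_poleSum {p : ι → ℂ} (hinj : Function.Injective p) (c : ι → ℂ) (k : ι) :
    Tendsto (fun z : ℂ => (z - p k) * ∑ l, c l / (z - p l)) (𝓝[≠] (p k)) (𝓝 (c k)) := by
  classical
  simp_rw [Finset.mul_sum]
  have : c k = ∑ l, if l = k then c k else 0 := by simp
  rw [this]
  refine tendsto_finsetSum _ fun l _ => ?_
  split_ifs with hlk
  · subst hlk
    refine tendsto_const_nhds.congr' ?_
    filter_upwards [self_mem_nhdsWithin] with z hz
    rw [mul_div_cancel₀]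
    exact sub_ne_zero.2 hz
  · refine tendsto_sub_mul_of_continuousAt (continuousAt_const.div
      (continuousAt_id.sub continuousAt_const) (sub_ne_zero.2 fun h => ?_))
    exact hlk (hinj h.symm)

omit [Fintype ι] in
theorem injective_mul_I (hinj : Function.Injective τ) :
    Function.Injective fun l => (τ l : ℂ) * I := fun _ _ h =>
  hinj (by exact_mod_cast mul_right_cancel₀ I_ne_zero h)

theorem tendsto_sub_mul_rowFun (hinj : Function.Injective τ) (g : ι → ℂ) (k : ι) :
    Tendsto (fun z : ℂ => (z - τ k * I) * rowFun v τ g z) (𝓝[≠] (τ k * I : ℂ))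
      (𝓝 (v k * g k)) := by
  have h1 := tendsto_sub_mul_of_continuousAt (f := fun _ => (1 : ℂ)) (p := τ k * I)
    continuousAt_const
  have := h1.add (tendsto_sub_mul_poleSum (injective_mul_I hinj) (fun l => (v l : ℂ) * g l) k)
  simp only [zero_add, ← mul_add] at this
  exact this

theorem tendsto_sub_mul_reflConj (hinj : Function.Injective τ) (g : ι → ℂ) (k : ι) :
    Tendsto (fun z : ℂ => (z - τ k * I) * reflConj (rowFun v τ g) z) (𝓝[≠] (τ k * I : ℂ))
      (𝓝 (-(v k * star (g k)))) := by
  have h1 := tendsto_sub_mul_of_continuousAt (f := fun _ => (1 : ℂ)) (p := τ k * I)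
    continuousAt_const
  have := h1.sub (tendsto_sub_mul_poleSum (injective_mul_I hinj) (fun l => (v l : ℂ) * star (g l)) k)
  simp only [zero_sub, ← mul_sub] at this
  simpa only [reflConj_rowFun] using this

theorem tendsto_neg_punctured (p : ℂ) : Tendsto (fun z : ℂ => -z) (𝓝[≠] (-p)) (𝓝[≠] p) := by
  refine tendsto_nhdsWithin_iff.2 ⟨?_, ?_⟩
  · have : Tendsto (fun z : ℂ => -z) (𝓝 (-p)) (𝓝 (- -p)) := continuous_neg.continuousAt
    rw [neg_neg] at this
    exact this.mono_left nhdsWithin_le_nhds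
  · filter_upwards [self_mem_nhdsWithin] with z hz h
    exact hz (by rw [← (h : -z = p), neg_neg]; rfl)

theorem continuousAt_rowFun_neg (hτ : ∀ l, 0 < τ l) (g : ι → ℂ) (k : ι) :
    ContinuousAt (rowFun v τ g) (-(τ k * I)) := by
  refine (differentiableAt_rowFun g fun l h => ?_).continuousAt
  have := congrArg Complex.im h
  simp at this
  linarith [hτ l, hτ k]

theorem continuousAt_reflConj_neg (hτ : ∀ l, 0 < τ l) (g : ι → ℂ) (k : ι) :
    ContinuousAt (reflConj (rowFun v τ g)) (-(τ k * I)) := by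
  refine (differentiableAt_reflConj (differentiableAt_rowFun g fun l h => ?_)).continuousAt
  have := congrArg Complex.im h
  simp at this
  linarith [hτ l, hτ k]

/-- The residue conditions in the upper half-plane. -/
theorem residueCondition_low (hτ : ∀ l, 0 < τ l) (hinj : Function.Injective τ) {g : ι → ℂ}
    (hg : ∀ k, g k = 1 + I * carlemanSum v τ g (τ k)) (k : ι) :
    ResidueCondition (symMatrix (rowFun v τ g)) (τ k * I) (lowNil (v k)) := by
  have hG := tendsto_sub_mul_rowFun (v := v) hinj g k
  have hH := tendsto_sub_mul_reflConj (v := v) hinj g k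
  have hn : Tendsto (fun z : ℂ => -z) (𝓝[≠] (τ k * I : ℂ)) (𝓝 (-(τ k * I))) :=
    (continuous_neg.tendsto _).mono_left nhdsWithin_le_nhds
  have hGc := continuousAt_rowFun_neg (v := v) hτ g k
  have hHc := continuousAt_reflConj_neg (v := v) hτ g k
  have eG : rowFun v τ g (-(τ k * I)) = g k := by rw [rowFun_neg_mul_I, ← hg]
  have eH : reflConj (rowFun v τ g) (-(τ k * I)) = star (g k) := by
    rw [reflConj, ← eG]
    simp
  have hG' := hGc.tendsto.comp hn
  have hH' := hHc.tendsto.comp hn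
  rw [eG] at hG'
  rw [eH] at hH'
  have hz : Tendsto (fun z : ℂ => z - τ k * I) (𝓝[≠] (τ k * I : ℂ)) (𝓝 0) := by
    have := tendsto_sub_mul_of_continuousAt (f := fun _ => (1 : ℂ)) (p := τ k * I)
      continuousAt_const
    simpa using this
  refine ⟨!![(v k * g k - v k * star (g k)) / 2, 0; (v k * g k + v k * star (g k)) / 2, 0], ?_, ?_⟩
  · rw [tendsto_mat2_iff]
    intro i j
    fin_cases i <;> fin_cases j <;>
      simp only [symMatrix, Matrix.smul_apply, Matrix.of_apply, Matrix.cons_val', smul_eq_mul,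
        Matrix.cons_val_zero, Matrix.cons_val_one, Matrix.cons_val_fin_one, Fin.zero_eta,
        Fin.mk_one]
    · refine ((hG.add hH).div_const 2).congr' (.of_forall fun z => by ring) |>.trans ?_
      rw [← sub_eq_add_neg]
    · simpa using hz.mul ((hG'.sub hH').div_const 2)
    · refine ((hG.sub hH).div_const 2).congr' (.of_forall fun z => by ring) |>.trans ?_
      rw [sub_neg_eq_add]
    · simpa using hz.mul ((hG'.add hH').div_const 2)
  · rw [tendsto_mat2_iff]
    intro i j
    fin_cases i <;> fin_cases j <;>
      simp only [symMatrix, lowNil, Matrix.mul_apply, Fin.sum_univ_two, Matrix.of_apply,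
        Matrix.cons_val', Matrix.cons_val_zero, Matrix.cons_val_one, Matrix.cons_val_fin_one,
        Fin.zero_eta, Fin.mk_one, mul_zero, zero_add, add_zero]
    · refine (((hG'.sub hH').div_const 2).mul_const (v k : ℂ)).trans ?_
      ring_nf
      rfl
    · exact tendsto_const_nhds
    · refine (((hG'.add hH').div_const 2).mul_const (v k : ℂ)).trans ?_
      ring_nf
      rfl
    · exact tendsto_const_nhds

end RowFun

/-- Conjugation with `σ₁` and `z ↦ -z` exchanges the two kinds of residue conditions. -/
theorem residueCondition_up_of_low {G : ℂ → ℂ} {p v : ℂ}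
    (h : ResidueCondition (symMatrix G) p (lowNil v)) :
    ResidueCondition (symMatrix G) (-p) (upNil (-v)) := by
  obtain ⟨R, h1, h2⟩ := h
  have h1' := h1.comp (tendsto_neg_punctured p)
  have h2' := h2.comp (tendsto_neg_punctured p)
  have e1 : ∀ i j, Tendsto (fun z => (-z - p) * symMatrix G (-z) i j) (𝓝[≠] (-p))
      (𝓝 (R i j)) := fun i j =>
    tendsto_mat2_iff.1 h1' i j
  have e2 : ∀ i j, Tendsto (fun z => (symMatrix G (-z) * lowNil v) i j) (𝓝[≠] (-p))
      (𝓝 (R i j)) := fun i j =>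
    tendsto_mat2_iff.1 h2' i j
  have hs : ∀ z i j, symMatrix G z i j = symMatrix G (-z) (1 - i) (1 - j) := by
    intro z i j
    fin_cases i <;> fin_cases j <;> simp [symMatrix]
  refine ⟨fun i j => -R (1 - i) (1 - j), ?_, ?_⟩
  · refine tendsto_mat2_iff.2 fun i j => ?_
    refine (e1 (1 - i) (1 - j)).neg.congr fun z => ?_
    rw [Matrix.smul_apply, hs z i j, smul_eq_mul]
    ring
  · refine tendsto_mat2_iff.2 fun i j => ?_
    refine (e2 (1 - i) (1 - j)).neg.congr fun z => ?_
    fin_cases i <;> fin_cases j <;>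
      simp [Matrix.mul_apply, lowNil, upNil, Fin.sum_univ_two, symMatrix]

/-! ### Rational functions from their residues -/

theorem isLittleO_of_tendsto_sub_mul {f : ℂ → ℂ} {p : ℂ}
    (h : Tendsto (fun z => (z - p) * f z) (𝓝[≠] p) (𝓝 0)) :
    (fun z => f z - f p) =o[𝓝[≠] p] fun z => (z - p)⁻¹ := by
  rw [Asymptotics.isLittleO_iff_tendsto']
  · have h2 := h.sub (tendsto_sub_mul_of_continuousAt (f := fun _ => f p) (p := p)
      continuousAt_const)
    simp only [sub_zero, ← mul_sub] at h2
    refine h2.congr fun z => ?_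
    rw [div_inv_eq_mul, mul_comm]
  · filter_upwards [self_mem_nhdsWithin] with z hz h0
    exact absurd (inv_eq_zero.1 h0) (sub_ne_zero.2 hz)

theorem eventually_notMem_of_finite {P : Set ℂ} (hP : P.Finite) (p : ℂ) :
    ∀ᶠ z in 𝓝[≠] p, z ∉ P := by
  have h : (P \ {p})ᶜ ∈ 𝓝 p := (hP.subset sdiff_subset).isClosed.isOpen_compl.mem_nhds (by simp)
  filter_upwards [self_mem_nhdsWithin, mem_nhdsWithin_of_mem_nhds h] with z hz hz' hzP
  exact hz' ⟨hzP, hz⟩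

theorem differentiableAt_of_notMem_finite {P : Set ℂ} (hP : P.Finite) {f : ℂ → ℂ}
    (hf : DifferentiableOn ℂ f Pᶜ) {z : ℂ} (hz : z ∉ P) : DifferentiableAt ℂ f z :=
  hf.differentiableAt (hP.isClosed.isOpen_compl.mem_nhds hz)

theorem exists_tendsto_of_finite {P : Set ℂ} (hP : P.Finite) {f : ℂ → ℂ}
    (hf : DifferentiableOn ℂ f Pᶜ) {p : ℂ}
    (h : Tendsto (fun z => (z - p) * f z) (𝓝[≠] p) (𝓝 0)) :
    ∃ m, Tendsto f (𝓝[≠] p) (𝓝 m) := by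
  refine ⟨_, Complex.tendsto_limUnder_of_differentiable_on_punctured_nhds_of_isLittleO ?_
    (isLittleO_of_tendsto_sub_mul h)⟩
  filter_upwards [eventually_notMem_of_finite hP p] with z hz
  exact differentiableAt_of_notMem_finite hP hf hz

/-- A function which is analytic off finitely many removable singularities and vanishes at
infinity is zero. -/
theorem eq_zero_of_removable {P : Set ℂ} (hP : P.Finite) {f : ℂ → ℂ}
    (hf : DifferentiableOn ℂ f Pᶜ)
    (h : ∀ p ∈ P, Tendsto (fun z => (z - p) * f z) (𝓝[≠] p) (𝓝 0))
    (hinf : Tendsto f (Bornology.cobounded ℂ) (𝓝 0)) {z : ℂ} (hz : z ∉ P) : f z = 0 := by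
  set F : ℂ → ℂ := fun w => limUnder (𝓝[≠] w) f with hF
  have hFeq : ∀ w ∉ P, F w = f w := fun w hw =>
    (((differentiableAt_of_notMem_finite hP hf hw).continuousAt.tendsto).mono_left
      nhdsWithin_le_nhds).limUnder_eq
  have hFd : Differentiable ℂ F := by
    intro w
    by_cases hw : w ∈ P
    · have hs : Pᶜ ∈ 𝓝[≠] w := eventually_notMem_of_finite hP w
      have hd := Complex.differentiableOn_update_limUnder_insert_of_isLittleO hs hf
        (isLittleO_of_tendsto_sub_mul (h w hw))
      refine (hd.differentiableAt (insert_mem_nhds_iff.2 hs)).congr_of_eventuallyEq ?_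
      have hs' := insert_mem_nhds_iff.2 hs
      filter_upwards [hs'] with u hu
      by_cases huw : u = w
      · rw [huw, Function.update_self]
      · rw [Function.update_of_ne huw, hFeq u (hu.resolve_left huw)]
    · refine (differentiableAt_of_notMem_finite hP hf hw).congr_of_eventuallyEq ?_
      filter_upwards [hP.isClosed.isOpen_compl.mem_nhds hw] with u hu
      exact hFeq u hu
  have hFinf : Tendsto F (cocompact ℂ) (𝓝 0) := by
    rw [← Metric.cobounded_eq_cocompact]
    refine hinf.congr' ?_
    have : Pᶜ ∈ Bornology.cobounded ℂ := by
      rw [← Bornology.isCobounded_def]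
      exact Bornology.isBounded_compl_iff.1 (by rw [compl_compl]; exact hP.isBounded)
    filter_upwards [this] with u hu
    exact (hFeq u hu).symm
  rw [← hFeq z hz]
  exact hFd.apply_eq_of_tendsto_cocompact z hFinf

variable {ι : Type*} [Fintype ι]

theorem tendsto_div_sub_cobounded (c p : ℂ) :
    Tendsto (fun z => c / (z - p)) (Bornology.cobounded ℂ) (𝓝 0) := by
  have h : Tendsto (fun z : ℂ => z - p) (Bornology.cobounded ℂ) (Bornology.cobounded ℂ) := by
    simpa only [sub_eq_add_neg] using tendsto_add_const_cobounded (-p)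
  have := (tendsto_inv₀_cobounded.comp h).const_mul c
  simpa [div_eq_mul_inv] using this

/-- Partial fraction expansion of a function with finitely many simple poles. -/
theorem eq_partial_fractions {P : Set ℂ} (hP : P.Finite) {f : ℂ → ℂ}
    (hf : DifferentiableOn ℂ f Pᶜ) {p : ι → ℂ} (hinj : Function.Injective p) (hp : ∀ l, p l ∈ P)
    {c : ι → ℂ} (hc : ∀ l, Tendsto (fun z => (z - p l) * f z) (𝓝[≠] (p l)) (𝓝 (c l)))
    (h0 : ∀ q ∈ P, q ∉ range p → Tendsto (fun z => (z - q) * f z) (𝓝[≠] q) (𝓝 0)) {C : ℂ}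
    (hinf : Tendsto f (Bornology.cobounded ℂ) (𝓝 C)) {z : ℂ} (hz : z ∉ P) :
    f z = C + ∑ l, c l / (z - p l) := by
  have hS : ∀ w, w ∉ range p → DifferentiableAt ℂ (fun z => C + ∑ l, c l / (z - p l)) w := by
    intro w hw
    refine (differentiableAt_const _).add (DifferentiableAt.fun_sum fun l _ => ?_)
    refine (differentiableAt_const _).div (differentiableAt_id.sub_const _) (sub_ne_zero.2 ?_)
    exact fun h => hw ⟨l, h.symm⟩
  have hrange : range p ⊆ P := by
    rintro _ ⟨l, rfl⟩
    exact hp l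
  refine sub_eq_zero.1 (eq_zero_of_removable hP (f := fun z => f z - (C + ∑ l, c l / (z - p l)))
    (hf.sub fun w hw => (hS w fun h => hw (hrange h)).differentiableWithinAt) ?_ ?_ hz)
  · intro q hq
    simp only [mul_sub]
    by_cases hqr : q ∈ range p
    · obtain ⟨l, rfl⟩ := hqr
      have h1 := (tendsto_sub_mul_of_continuousAt (f := fun _ => C) (p := p l)
        continuousAt_const).add (tendsto_sub_mul_poleSum hinj c l)
      have h2 := (hc l).sub h1
      simpa only [zero_add, sub_self, ← mul_add] using h2
    · have h2 := (h0 q hq hqr).sub (tendsto_sub_mul_of_continuousAt (hS q hqr).continuousAt)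
      simpa only [sub_self] using h2
  · have h1 : Tendsto (fun z => ∑ l, c l / (z - p l)) (Bornology.cobounded ℂ)
        (𝓝 (∑ _l : ι, (0 : ℂ))) :=
      tendsto_finsetSum _ fun l _ => tendsto_div_sub_cobounded (c l) (p l)
    have h2 := hinf.sub (h1.const_add C)
    simpa using h2

theorem tendsto_cobounded_of_normalized {M : ℂ → Mat2} (h : NormalizedAtInfinity M)
    (i j : Fin 2) : Tendsto (fun z => M z i j) (Bornology.cobounded ℂ) (𝓝 ((1 : Mat2) i j)) := by
  have h1 : Tendsto (fun z : ℂ => 1 / z) (Bornology.cobounded ℂ) (𝓝 0) := by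
    simpa using tendsto_inv₀_cobounded (α := ℂ)
  have h2 := ((h i j).trans_tendsto h1).add_const ((1 : Mat2) i j)
  simpa using h2

/-- Uniqueness for the reflectionless problem. -/
theorem eq_symMatrix_of_residues {v τ : ι → ℝ} (hv : (∀ l, 0 ≤ v l) ∨ ∀ l, v l ≤ 0) {d : ℝ}
    (hd : 0 < d) (hτ : ∀ l, d ≤ τ l) (hinj : Function.Injective τ) {g : ι → ℂ}
    (hg : ∀ k, g k = 1 + I * carlemanSum v τ g (τ k)) {M : ℂ → Mat2} {P : Set ℂ} (hP : P.Finite)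
    (hPr : ∀ z, z ∈ P ↔ ∃ l, z = τ l * I ∨ z = -(τ l * I))
    (hM : ∀ i j, DifferentiableOn ℂ (fun w => M w i j) Pᶜ)
    (hlow : ∀ k, ResidueCondition M (τ k * I) (lowNil (v k)))
    (hup : ∀ k, ResidueCondition M (-(τ k * I)) (upNil (-v k)))
    (hinf : NormalizedAtInfinity M) {z : ℂ} (hz : z ∉ P) :
    M z = symMatrix (rowFun v τ g) z := by
  have hτ0 : ∀ l, 0 < τ l := fun l => hd.trans_le (hτ l)
  have hne : ∀ k l, (τ k * I : ℂ) ≠ -(τ l * I) := by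
    intro k l h
    have := congrArg Complex.im h
    simp at this
    linarith [hτ0 k, hτ0 l]
  have hlow2 : ∀ k i, Tendsto (fun z => (z - τ k * I) * M z i 1) (𝓝[≠] (τ k * I : ℂ)) (𝓝 0) := by
    intro k i
    obtain ⟨R, h1, h2⟩ := hlow k
    have e1 := tendsto_mat2_iff.1 h1 i 1
    have e2 := tendsto_mat2_iff.1 h2 i 1
    simp only [Matrix.smul_apply, smul_eq_mul] at e1
    simp only [Matrix.mul_apply, lowNil, Fin.sum_univ_two, Matrix.of_apply, Matrix.cons_val',
      Matrix.cons_val_zero, Matrix.cons_val_one, Matrix.cons_val_fin_one, mul_zero, add_zero] at e2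
    rwa [tendsto_nhds_unique e2 tendsto_const_nhds] at e1
  have hup1 : ∀ k i, Tendsto (fun z => (z - -(τ k * I)) * M z i 0) (𝓝[≠] (-(τ k * I) : ℂ))
      (𝓝 0) := by
    intro k i
    obtain ⟨R, h1, h2⟩ := hup k
    have e1 := tendsto_mat2_iff.1 h1 i 0
    have e2 := tendsto_mat2_iff.1 h2 i 0
    simp only [Matrix.smul_apply, smul_eq_mul] at e1
    simp only [Matrix.mul_apply, upNil, Fin.sum_univ_two, Matrix.of_apply, Matrix.cons_val',
      Matrix.cons_val_zero, Matrix.cons_val_one, Matrix.cons_val_fin_one, mul_zero, add_zero] at e2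
    rwa [tendsto_nhds_unique e2 tendsto_const_nhds] at e1
  choose m hm using fun k i => exists_tendsto_of_finite hP (hM i 1) (hlow2 k i)
  choose n hn using fun k i => exists_tendsto_of_finite hP (hM i 0) (hup1 k i)
  have hlow1 : ∀ k i, Tendsto (fun z => (z - τ k * I) * M z i 0) (𝓝[≠] (τ k * I : ℂ))
      (𝓝 (v k * m k i)) := by
    intro k i
    obtain ⟨R, h1, h2⟩ := hlow k
    have e1 := tendsto_mat2_iff.1 h1 i 0
    have e2 := tendsto_mat2_iff.1 h2 i 0
    simp only [Matrix.smul_apply, smul_eq_mul] at e1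
    simp only [Matrix.mul_apply, lowNil, Fin.sum_univ_two, Matrix.of_apply, Matrix.cons_val',
      Matrix.cons_val_zero, Matrix.cons_val_one, Matrix.cons_val_fin_one, mul_zero, zero_add] at e2
    rwa [tendsto_nhds_unique e2 ((hm k i).mul_const _), mul_comm (m k i)] at e1
  have hup2 : ∀ k i, Tendsto (fun z => (z - -(τ k * I)) * M z i 1) (𝓝[≠] (-(τ k * I) : ℂ))
      (𝓝 (-v k * n k i)) := by
    intro k i
    obtain ⟨R, h1, h2⟩ := hup k
    have e1 := tendsto_mat2_iff.1 h1 i 1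
    have e2 := tendsto_mat2_iff.1 h2 i 1
    simp only [Matrix.smul_apply, smul_eq_mul] at e1
    simp only [Matrix.mul_apply, upNil, Fin.sum_univ_two, Matrix.of_apply, Matrix.cons_val',
      Matrix.cons_val_zero, Matrix.cons_val_one, Matrix.cons_val_fin_one, mul_zero, add_zero] at e2
    rwa [tendsto_nhds_unique e2 ((hn k i).mul_const _), mul_comm (n k i)] at e1
  have hcol1 : ∀ i w, w ∉ P →
      M w i 0 = (1 : Mat2) i 0 + ∑ l, (v l : ℂ) * m l i / (w - τ l * I) := by
    intro i w hw
    refine eq_partial_fractions hP (hM i 0) (injective_mul_I hinj)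
      (fun l => (hPr _).2 ⟨l, Or.inl rfl⟩) (fun l => hlow1 l i) (fun q hq hqr => ?_)
      (tendsto_cobounded_of_normalized hinf i 0) hw
    obtain ⟨l, rfl | rfl⟩ := (hPr q).1 hq
    · exact absurd ⟨l, rfl⟩ hqr
    · exact hup1 l i
  have hcol2 : ∀ i w, w ∉ P →
      M w i 1 = (1 : Mat2) i 1 + ∑ l, -(v l : ℂ) * n l i / (w - -(τ l * I)) := by
    intro i w hw
    refine eq_partial_fractions hP (hM i 1)
      (neg_injective.comp (injective_mul_I hinj))
      (fun l => (hPr _).2 ⟨l, Or.inr rfl⟩) (fun l => hup2 l i) (fun q hq hqr => ?_)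
      (tendsto_cobounded_of_normalized hinf i 1) hw
    obtain ⟨l, rfl | rfl⟩ := (hPr q).1 hq
    · exact hlow2 l i
    · exact absurd ⟨l, rfl⟩ hqr
  have hlim : ∀ (c f : ι → ℂ) (C : ℂ) (s : ℂ) (k : ι) (q : ℂ),
      (∀ l, q ≠ s * (τ l * I)) →
      Tendsto (fun w : ℂ => C + ∑ l, c l / (w - s * (τ l * I))) (𝓝[≠] q)
        (𝓝 (C + ∑ l, c l / (q - s * (τ l * I)))) := by
    intro c f C s k q hq
    have : ContinuousAt (fun w : ℂ => C + ∑ l, c l / (w - s * (τ l * I))) q := by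
      refine continuousAt_const.add (tendsto_finsetSum _ fun l _ => ?_)
      exact (continuousAt_const.div (continuousAt_id.sub continuousAt_const)
        (sub_ne_zero.2 (hq l)))
    exact this.tendsto.mono_left nhdsWithin_le_nhds
  have hm' : ∀ k i, m k i = (1 : Mat2) i 1 + I * carlemanSum v τ (fun l => n l i) (τ k) := by
    intro k i
    have h1 := hlim (fun l => -(v l : ℂ) * n l i) 0 ((1 : Mat2) i 1) (-1) k (τ k * I)
      (fun l => by rw [neg_one_mul]; exact hne k l)
    have h2 := h1.congr' (f₂ := fun w => M w i 1) (by
      filter_upwards [eventually_notMem_of_finite hP (τ k * I)] with w hw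
      rw [hcol2 i w hw]
      simp only [neg_one_mul])
    rw [tendsto_nhds_unique (hm k i) h2, carlemanSum, Finset.mul_sum]
    congr 1
    refine Finset.sum_congr rfl fun l _ => ?_
    have : (τ k * I - -1 * (τ l * I) : ℂ) = ((τ k + τ l : ℝ) : ℂ) * I := by push_cast; ring
    rw [this, ← div_div, div_I]
    ring
  have hn' : ∀ k i, n k i = (1 : Mat2) i 0 + I * carlemanSum v τ (fun l => m l i) (τ k) := by
    intro k i
    have h1 := hlim (fun l => (v l : ℂ) * m l i) 0 ((1 : Mat2) i 0) 1 k (-(τ k * I))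
      (fun l => by rw [one_mul]; exact (hne l k).symm)
    have h2 := h1.congr' (f₂ := fun w => M w i 0) (by
      filter_upwards [eventually_notMem_of_finite hP (-(τ k * I))] with w hw
      rw [hcol1 i w hw]
      simp only [one_mul])
    rw [tendsto_nhds_unique (hn k i) h2, carlemanSum, Finset.mul_sum]
    congr 1
    refine Finset.sum_congr rfl fun l _ => ?_
    have : (-(τ k * I) - 1 * (τ l * I) : ℂ) = -(((τ k + τ l : ℝ) : ℂ) * I) := by push_cast; ring
    rw [this, div_neg, ← div_div, div_I]
    ring
  have hsgn : ∀ e : ℂ, e = 1 ∨ e = -1 → ∀ i k, n k i + e * m k i =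
      (1 : Mat2) i 0 + e * (1 : Mat2) i 1
        + I * (e * carlemanSum v τ (fun l => n l i + e * m l i) (τ k)) := by
    intro e he i k
    have : carlemanSum v τ (fun l => n l i + e * m l i) (τ k)
        = carlemanSum v τ (fun l => n l i) (τ k) + e * carlemanSum v τ (fun l => m l i) (τ k) := by
      simp only [carlemanSum, Finset.mul_sum, ← Finset.sum_add_distrib]
      exact Finset.sum_congr rfl fun l _ => by ring
    rw [this]
    have he2 : e * e = 1 := by rcases he with rfl | rfl <;> norm_num
    rw [hm' k i, hn' k i]
    linear_combination (-(I * carlemanSum v τ (fun l => m l i) (τ k))) * he2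
  have hg2 : ∀ k, star (g k) = 1 + I * carlemanSum (fun l => -v l) τ (fun l => star (g l)) (τ k) := by
    intro k
    have h1 := congrArg star (hg k)
    rw [star_add, star_mul', star_carlemanSum] at h1
    rw [h1]
    simp [carlemanSum, neg_div]
  have hv2 : (∀ l, 0 ≤ -v l) ∨ ∀ l, -v l ≤ 0 := by
    rcases hv with hv | hv
    · exact Or.inr fun l => by simpa using hv l
    · exact Or.inl fun l => by simpa using hv l
  have hneg : ∀ f x, carlemanSum (fun l => -v l) τ f x = -carlemanSum v τ f x := by
    intro f x
    simp [carlemanSum, neg_div]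
  have hplus : ∀ i, (fun k => n k i + 1 * m k i) = g := by
    intro i
    refine system_unique hv hd hτ (φ := fun _ => 1) (fun k => ?_) hg
    rw [hsgn 1 (Or.inl rfl) i k, one_mul (carlemanSum _ _ _ _)]
    congr 1
    revert i
    rw [Fin.forall_fin_two]
    constructor <;> simp
  have hminus0 : (fun k => n k 0 + -1 * m k 0) = fun k => star (g k) := by
    refine system_unique hv2 hd hτ (φ := fun _ => 1) (fun k => ?_) hg2
    rw [hsgn (-1) (Or.inr rfl) 0 k, hneg, neg_one_mul (carlemanSum _ _ _ _)]
    simp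
  have hminus1 : (fun k => -1 * (n k 1 + -1 * m k 1)) = fun k => star (g k) := by
    refine system_unique hv2 hd hτ (φ := fun _ => 1) (fun k => ?_) hg2
    rw [hsgn (-1) (Or.inr rfl) 1 k, hneg, carlemanSum_const_mul]
    simp [add_comm]
  have p : ∀ k i, n k i + m k i = g k := fun k i => by simpa using congrFun (hplus i) k
  have q0 : ∀ k, n k 0 - m k 0 = star (g k) := fun k => by
    simpa [sub_eq_add_neg] using congrFun hminus0 k
  have q1 : ∀ k, m k 1 - n k 1 = star (g k) := fun k => by
    have := congrFun hminus1 k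
    rw [← this]
    ring
  have m0 : ∀ k, m k 0 = (g k + -1 * star (g k)) / 2 := fun k => by
    linear_combination (p k 0) / 2 - (q0 k) / 2
  have m1 : ∀ k, m k 1 = (g k + 1 * star (g k)) / 2 := fun k => by
    linear_combination (p k 1) / 2 + (q1 k) / 2
  have n0 : ∀ k, n k 0 = (g k + 1 * star (g k)) / 2 := fun k => by
    linear_combination (p k 0) / 2 + (q0 k) / 2
  have n1 : ∀ k, n k 1 = (g k + -1 * star (g k)) / 2 := fun k => by
    linear_combination (p k 1) / 2 - (q1 k) / 2
  have hlin : ∀ (e : ℂ) (D : ι → ℂ), ∑ l, (v l : ℂ) * ((g l + e * star (g l)) / 2) / D l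
      = ((∑ l, (v l : ℂ) * g l / D l) + e * ∑ l, (v l : ℂ) * star (g l) / D l) / 2 := by
    intro e D
    rw [Finset.mul_sum, ← Finset.sum_add_distrib, Finset.sum_div]
    exact Finset.sum_congr rfl fun l _ => by ring
  have hlin' : ∀ (e : ℂ), ∑ l, -(v l : ℂ) * ((g l + e * star (g l)) / 2) / (z - -(τ l * I))
      = ((∑ l, (v l : ℂ) * g l / (-z - τ l * I))
        + e * ∑ l, (v l : ℂ) * star (g l) / (-z - τ l * I)) / 2 := by
    intro e
    rw [← hlin e fun l => -z - τ l * I]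
    refine Finset.sum_congr rfl fun l _ => ?_
    rw [← neg_div_neg_eq]
    congr 1 <;> ring
  have hA : M z = !![M z 0 0, M z 0 1; M z 1 0, M z 1 1] := Matrix.eta_fin_two _
  rw [hA, symMatrix, reflConj_rowFun, reflConj_rowFun, hcol1 0 z hz, hcol1 1 z hz, hcol2 0 z hz,
    hcol2 1 z hz]
  simp only [m0, m1, n0, n1, hlin, hlin', rowFun]
  generalize ∑ l, (v l : ℂ) * g l / (z - τ l * I) = A
  generalize ∑ l, (v l : ℂ) * star (g l) / (z - τ l * I) = B
  generalize ∑ l, (v l : ℂ) * g l / (-z - τ l * I) = A'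
  generalize ∑ l, (v l : ℂ) * star (g l) / (-z - τ l * I) = B'
  ext i j
  fin_cases i <;> fin_cases j <;> simp <;> ring

/-! ### Normalization and reconstruction in terms of the row function -/

/-- The properties of the row function that give the normalization at `z = i`. -/
structure RowSymmetric (G : ℂ → ℂ) : Prop where
  diff_I : ∀ᶠ z in 𝓝 I, DifferentiableAt ℂ G z
  diff_neg_I : ∀ᶠ z in 𝓝 (-I), DifferentiableAt ℂ G z
  inv : ∃ c, (∀ᶠ z in 𝓝 I, reflConj G z = c * G (-(1 / z))) ∧
    ∀ᶠ z in 𝓝 (-I), reflConj G z = c * G (-(1 / z))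
  det : G I * reflConj G (-I) + reflConj G I * G (-I) = 2

theorem gauge_mul_mul_expSigma (ϑ h μ₁ μ₂ : ℝ) (e : ℂ) :
    gaugeMatrix ϑ * (1 + e • !![0, (μ₁ : ℂ); (μ₂ : ℂ), 0]) * expSigma h =
      !![(Real.cos ϑ + e * μ₂ * (I * Real.sin ϑ)) * Real.exp (h / 2),
          (I * Real.sin ϑ + e * μ₁ * Real.cos ϑ) * Real.exp (-(h / 2));
        (I * Real.sin ϑ + e * μ₂ * Real.cos ϑ) * Real.exp (h / 2),
          (Real.cos ϑ + e * μ₁ * (I * Real.sin ϑ)) * Real.exp (-(h / 2))] := by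
  have h1 : (1 + e • !![0, (μ₁ : ℂ); (μ₂ : ℂ), 0] : Mat2) = !![1, e * μ₁; e * μ₂, 1] := by
    ext i j
    fin_cases i <;> fin_cases j <;> simp
  rw [h1, gaugeMatrix, expSigma, Matrix.mul_fin_two, Matrix.mul_fin_two]
  simp only [mul_one, mul_zero, add_zero, zero_add]
  refine congrArg _ ?_
  ext i j
  fin_cases i <;> fin_cases j <;>
    simp only [Matrix.cons_val', Matrix.cons_val_zero, Matrix.cons_val_one,
      Matrix.cons_val_fin_one, Fin.zero_eta, Fin.mk_one] <;> ring

theorem isBigO_taylor_one {f : ℂ → ℂ} {p : ℂ} (hf : ∀ᶠ z in 𝓝 p, DifferentiableAt ℂ f z) :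
    (fun z => f z - (f p + (z - p) * deriv f p)) =O[𝓝 p] fun z => (z - p) ^ 2 := by
  have hd : DifferentiableAt ℂ (dslope f p) p := by
    have := (Complex.differentiableOn_dslope (f := f) hf).2
      fun z hz => (hz : DifferentiableAt ℂ f z).differentiableWithinAt
    exact this.differentiableAt hf
  have h1 := hd.isBigO_sub
  have h2 := (Asymptotics.isBigO_refl (fun z => z - p) (𝓝 p)).mul h1
  refine (h2.congr_left fun z => ?_).congr_right fun z => by ring
  rw [dslope_same]
  have : (z - p) * dslope f p z = f z - f p := by
    rw [← smul_eq_mul, sub_smul_dslope]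
  rw [mul_sub, this]
  ring

theorem hasDerivAt_reflConj {G : ℂ → ℂ} {D z : ℂ} (h : HasDerivAt G D (-star z)) :
    HasDerivAt (reflConj G) (-star D) z := by
  have h1 : HasDerivAt (fun w => G (-w)) (-D) (star z) := by
    have := h.comp (star z) (hasDerivAt_neg (star z))
    simpa using! this
  have h2 := HasDerivAt.conj_conj h1
  simpa [Function.comp_def, reflConj] using! h2

theorem eventually_differentiableAt_reflConj {G : ℂ → ℂ} {p : ℂ}
    (h : ∀ᶠ z in 𝓝 (-star p), DifferentiableAt ℂ G z) :
    ∀ᶠ z in 𝓝 p, DifferentiableAt ℂ (reflConj G) z := by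
  have : Tendsto (fun z : ℂ => -star z) (𝓝 p) (𝓝 (-star p)) :=
    (continuous_star.neg).continuousAt
  exact (this.eventually h).mono fun z hz => differentiableAt_reflConj hz

theorem neg_star_I : -star I = I := by simp

theorem neg_star_neg_I : -star (-I) = -I := by simp

theorem reflConj_I (G : ℂ → ℂ) : reflConj G I = star (G I) := by
  rw [reflConj, neg_star_I]

theorem reflConj_neg_I (G : ℂ → ℂ) : reflConj G (-I) = star (G (-I)) := by
  rw [reflConj, neg_star_neg_I]

namespace RowSymmetric

variable {G : ℂ → ℂ} (h : RowSymmetric G)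
include h

theorem mul_star_eq_one : G I * star (G (-I)) = 1 := by
  obtain ⟨c, h1, h2⟩ := h.inv
  have e1 := h1.self_of_nhds
  have e2 := h2.self_of_nhds
  have i1 : -(1 / I) = I := by simp
  have i2 : -(1 / -I) = -I := by simp
  rw [i1, reflConj_I] at e1
  rw [i2, reflConj_neg_I] at e2
  have hd := h.det
  rw [reflConj_I, reflConj_neg_I] at hd
  rw [e1, e2] at hd
  rw [e2]
  linear_combination hd / 2

theorem ne_zero : G I ≠ 0 := left_ne_zero_of_mul_eq_one h.mul_star_eq_one

theorem ne_zero' : G (-I) ≠ 0 := fun h0 => by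
  have := h.mul_star_eq_one
  simp [h0] at this

theorem deriv_ratio_real {p : ℂ} (hp : p = I ∨ p = -I) :
    star (deriv G p / G p) = deriv G p / G p := by
  obtain ⟨c, h1, h2⟩ := h.inv
  have hd : DifferentiableAt ℂ G p := by
    rcases hp with rfl | rfl
    · exact h.diff_I.self_of_nhds
    · exact h.diff_neg_I.self_of_nhds
  have hps : -star p = p := by
    rcases hp with rfl | rfl
    · exact neg_star_I
    · exact neg_star_neg_I
  have hpi : -(1 / p) = p := by rcases hp with rfl | rfl <;> simp
  have hp0 : p ≠ 0 := by rcases hp with rfl | rfl <;> simp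
  have hp2 : p ^ 2 = -1 := by rcases hp with rfl | rfl <;> simp
  have hG0 : G p ≠ 0 := by
    rcases hp with rfl | rfl
    · exact h.ne_zero
    · exact h.ne_zero'
  have he : ∀ᶠ z in 𝓝 p, reflConj G z = c * G (-(1 / z)) := by
    rcases hp with rfl | rfl
    · exact h1
    · exact h2
  have d1 : HasDerivAt (reflConj G) (-star (deriv G p)) p :=
    hasDerivAt_reflConj (by rw [hps]; exact hd.hasDerivAt)
  have d2 : HasDerivAt (fun z => c * G (-(1 / z))) (c * (deriv G p * -1)) p := by
    refine HasDerivAt.const_mul c ?_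
    have i1 : HasDerivAt (fun z : ℂ => -(1 / z)) (-1) p := by
      have := (hasDerivAt_inv hp0).neg
      simp only [one_div]
      convert! this using 1
      rw [hp2]
      norm_num
    refine HasDerivAt.comp p (h₂ := G) ?_ i1
    rw [hpi]
    exact hd.hasDerivAt
  have e := (d1.congr_of_eventuallyEq (he.mono fun z hz => hz.symm)).unique d2
  have e0 := he.self_of_nhds
  rw [hpi, reflConj, hps] at e0
  have e1 : star (deriv G p) = c * deriv G p := by linear_combination -e
  have hc : c ≠ 0 := by
    rintro rfl
    rw [zero_mul, star_eq_zero] at e0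
    exact hG0 e0
  rw [star_div₀, e0, e1, mul_div_mul_left _ _ hc]

theorem exists_deriv_eq {p : ℂ} (hp : p = I ∨ p = -I) : ∃ μ : ℝ, deriv G p = μ * G p := by
  have hG0 : G p ≠ 0 := by
    rcases hp with rfl | rfl
    · exact h.ne_zero
    · exact h.ne_zero'
  obtain ⟨μ, hμ⟩ := Complex.conj_eq_iff_real.1 (h.deriv_ratio_real hp)
  exact ⟨μ, (div_eq_iff hG0).1 hμ⟩

theorem normalizedAtI : NormalizedAtI (symMatrix G) := by
  obtain ⟨μ₂, hμ₂⟩ := h.exists_deriv_eq (Or.inl rfl)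
  obtain ⟨μ₁', hμ₁⟩ := h.exists_deriv_eq (Or.inr rfl)
  set A := G I with hA
  set A' := G (-I) with hA'
  have hA0 : A ≠ 0 := h.ne_zero
  have hr : 0 < ‖A‖ := norm_pos_iff.2 hA0
  have hAA : A * star A' = 1 := h.mul_star_eq_one
  have hAA' : star A * A' = 1 := by
    have := congrArg star hAA
    simpa [mul_comm] using this
  have t1 := isBigO_taylor_one h.diff_I
  have t2 : (fun z => reflConj G z - (star A + (z - I) * -star (deriv G I))) =O[𝓝 I]
      fun z => (z - I) ^ 2 := by
    have hd : ∀ᶠ z in 𝓝 I, DifferentiableAt ℂ (reflConj G) z :=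
      eventually_differentiableAt_reflConj (by rw [neg_star_I]; exact h.diff_I)
    have := isBigO_taylor_one hd
    rwa [reflConj_I, (hasDerivAt_reflConj (G := G) (z := I) (D := deriv G I)
      (by rw [neg_star_I]; exact h.diff_I.self_of_nhds.hasDerivAt)).deriv] at this
  have hneg : Tendsto (fun z : ℂ => -z) (𝓝 I) (𝓝 (-I)) := continuous_neg.continuousAt
  have t3 : (fun z => G (-z) - (A' - (z - I) * deriv G (-I))) =O[𝓝 I] fun z => (z - I) ^ 2 := by
    have := (isBigO_taylor_one h.diff_neg_I).comp_tendsto hneg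
    refine (this.congr_left fun z => ?_).congr_right fun z => ?_ <;>
      simp only [Function.comp_apply, hA'] <;> ring
  have t4 : (fun z => reflConj G (-z) - (star A' + (z - I) * star (deriv G (-I)))) =O[𝓝 I]
      fun z => (z - I) ^ 2 := by
    have hd : ∀ᶠ z in 𝓝 (-I), DifferentiableAt ℂ (reflConj G) z :=
      eventually_differentiableAt_reflConj (by rw [neg_star_neg_I]; exact h.diff_neg_I)
    have := (isBigO_taylor_one hd).comp_tendsto hneg
    rw [reflConj_neg_I, (hasDerivAt_reflConj (G := G) (z := -I) (D := deriv G (-I))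
      (by rw [neg_star_neg_I]; exact h.diff_neg_I.self_of_nhds.hasDerivAt)).deriv] at this
    refine (this.congr_left fun z => ?_).congr_right fun z => ?_ <;>
      simp only [Function.comp_apply, hA'] <;> ring
  have s1 : star (deriv G I) = μ₂ * star A := by rw [hμ₂]; simp
  have s2 : star (deriv G (-I)) = μ₁' * star A' := by rw [hμ₁]; simp
  rw [s1] at t2
  rw [hμ₂, ← hA] at t1
  rw [hμ₁] at t3
  rw [s2] at t4
  refine ⟨arg A, 2 * Real.log ‖A‖, -μ₁', μ₂, ?_⟩
  have hex : Real.exp (2 * Real.log ‖A‖ / 2) = ‖A‖ := by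
    rw [mul_div_cancel_left₀ _ two_ne_zero, Real.exp_log hr]
  have hex' : Real.exp (-(2 * Real.log ‖A‖ / 2)) = ‖A‖⁻¹ := by rw [Real.exp_neg, hex]
  have hre : (‖A‖ : ℂ) * Real.cos (arg A) = (A + star A) / 2 := by
    rw [← ofReal_mul, Complex.norm_mul_cos_arg, RCLike.star_def, Complex.add_conj]
    push_cast
    ring
  have him : (‖A‖ : ℂ) * (I * Real.sin (arg A)) = (A - star A) / 2 := by
    rw [mul_left_comm, ← ofReal_mul, Complex.norm_mul_sin_arg, RCLike.star_def, Complex.sub_conj]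
    push_cast
    ring
  have hr0 : (‖A‖ : ℂ) ≠ 0 := by exact_mod_cast hr.ne'
  have hnn : (‖A‖ : ℂ) * ‖A‖ = A * star A := by
    rw [RCLike.star_def, Complex.mul_conj, Complex.normSq_eq_norm_sq]
    push_cast
    ring
  have hinvA : ∀ B : ℂ, B * A' = B * A / (‖A‖ * ‖A‖) := by
    intro B
    rw [hnn, eq_div_iff (mul_ne_zero hA0 (star_ne_zero.2 hA0))]
    linear_combination (B * A) * hAA'
  have hA'1 : A' = A / (‖A‖ * ‖A‖) := by simpa using hinvA 1
  have hA'2 : star A' = star A / (‖A‖ * ‖A‖) := by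
    rw [hnn, eq_div_iff (mul_ne_zero hA0 (star_ne_zero.2 hA0))]
    linear_combination star A * hAA
  have hre' : (‖A‖⁻¹ : ℂ) * Real.cos (arg A) = (A' + star A') / 2 := by
    rw [hA'2, hA'1, ← add_div, div_right_comm, ← hre]
    field_simp
  have him' : (‖A‖⁻¹ : ℂ) * (I * Real.sin (arg A)) = (A' - star A') / 2 := by
    rw [hA'2, hA'1, ← sub_div, div_right_comm, ← him]
    field_simp
  intro i j
  fin_cases i <;> fin_cases j
  · refine ((t1.add t2).const_mul_left (1 / 2)).congr_left fun z => ?_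
    rw [Matrix.sub_apply, gauge_mul_mul_expSigma]
    simp only [hex, hex', symMatrix, Matrix.of_apply,
      Matrix.cons_val', Matrix.cons_val_zero, Matrix.cons_val_fin_one,
      Fin.zero_eta, ofReal_inv, ofReal_neg]
    linear_combination hre + ((z - I) * μ₂) * him
  · refine ((t3.sub t4).const_mul_left (1 / 2)).congr_left fun z => ?_
    rw [Matrix.sub_apply, gauge_mul_mul_expSigma]
    simp only [hex, hex', symMatrix, Matrix.of_apply,
      Matrix.cons_val', Matrix.cons_val_zero, Matrix.cons_val_one, Matrix.cons_val_fin_one,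
      Fin.zero_eta, Fin.mk_one, ofReal_inv, ofReal_neg]
    linear_combination him' - ((z - I) * μ₁') * hre'
  · refine ((t1.sub t2).const_mul_left (1 / 2)).congr_left fun z => ?_
    rw [Matrix.sub_apply, gauge_mul_mul_expSigma]
    simp only [hex, hex', symMatrix, Matrix.of_apply,
      Matrix.cons_val', Matrix.cons_val_zero, Matrix.cons_val_one, Matrix.cons_val_fin_one,
      Fin.zero_eta, Fin.mk_one, ofReal_inv, ofReal_neg]
    linear_combination him + ((z - I) * μ₂) * hre
  · refine ((t3.add t4).const_mul_left (1 / 2)).congr_left fun z => ?_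
    rw [Matrix.sub_apply, gauge_mul_mul_expSigma]
    simp only [hex, hex', symMatrix, Matrix.of_apply,
      Matrix.cons_val', Matrix.cons_val_one, Matrix.cons_val_fin_one,
      Fin.mk_one, ofReal_inv, ofReal_neg]
    linear_combination hre' - ((z - I) * μ₁') * him'

theorem ratio_eq : G (-I) / G I = ((‖G I‖ ^ 2)⁻¹ : ℝ) := by
  have h1 := congrArg star h.mul_star_eq_one
  have h2 : star (G I) * G (-I) = 1 := by simpa [mul_comm] using h1
  have h3 : ((‖G I‖ ^ 2 : ℝ) : ℂ) = G I * star (G I) := by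
    rw [RCLike.star_def, Complex.mul_conj, Complex.normSq_eq_norm_sq]
  have h4 := h.ne_zero
  have h5 := star_ne_zero.2 h4
  rw [ofReal_inv, h3, div_eq_iff h4, inv_mul_eq_div, eq_div_iff (mul_ne_zero h4 h5)]
  linear_combination G I * h2

/-- Reconstruction of `x` and `u` from the row function. -/
theorem recovers (y : ℝ) : Recovers y (symMatrix G) (y - Real.log (G (-I) / G I).re)
    (deriv G (-I) / G (-I) - deriv G I / G I).re := by
  have hprod : ∀ z, recProd (symMatrix G) z = G z * G (-z) := by
    intro z
    simp only [recProd, symMatrix, Matrix.of_apply, Matrix.cons_val', Matrix.cons_val_zero,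
      Matrix.cons_val_one, Matrix.cons_val_fin_one]
    ring
  have hratio : recRatio (symMatrix G) = G (-I) / G I := by
    simp only [recRatio, symMatrix, Matrix.of_apply, Matrix.cons_val', Matrix.cons_val_zero,
      Matrix.cons_val_one, Matrix.cons_val_fin_one]
    congr 1 <;> ring
  have h0 := h.ne_zero
  have h0' := h.ne_zero'
  have hpos : 0 < ‖G I‖ := norm_pos_iff.2 h0
  refine ⟨?_, ?_, ?_, ?_, ?_⟩
  · rw [hprod]
    exact mul_ne_zero h0 h0'
  · rw [hratio, h.ratio_eq, ofReal_im]
  · rw [hratio, h.ratio_eq, ofReal_re]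
    positivity
  · rw [hratio]
  · obtain ⟨μ, hμ⟩ := h.exists_deriv_eq (Or.inl rfl)
    obtain ⟨μ', hμ'⟩ := h.exists_deriv_eq (Or.inr rfl)
    have hu : ((deriv G (-I) / G (-I) - deriv G I / G I).re : ℂ) = μ' - μ := by
      rw [hμ, hμ', mul_div_cancel_right₀ _ h0, mul_div_cancel_right₀ _ h0', ← ofReal_sub, ofReal_re]
    rw [hu]
    have d1 : HasDerivAt G (deriv G I) I := h.diff_I.self_of_nhds.hasDerivAt
    have d2 : HasDerivAt (fun z => G (-z)) (-deriv G (-I)) I := by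
      have := (h.diff_neg_I.self_of_nhds.hasDerivAt).comp I (hasDerivAt_neg I)
      simpa using! this
    have d3 := (d1.mul d2).const_mul (-(G I * G (-I))⁻¹)
    have e : -(G I * G (-I))⁻¹ * (deriv G I * G (-I) + G I * -deriv G (-I)) = μ' - μ := by
      rw [hμ, hμ']
      field_simp
      ring
    rw [e] at d3
    refine (hasDerivAt_iff_tendsto_slope.1 d3).congr' ?_
    filter_upwards [self_mem_nhdsWithin] with z hz
    rw [slope_def_field, hprod, hprod]
    have hz0 : z - I ≠ 0 := sub_ne_zero.2 hz
    simp only [Pi.mul_apply]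
    field_simp
    ring

end RowSymmetric

theorem Recovers.congr {y : ℝ} {M M' : ℂ → Mat2} {x u : ℝ} (h : Recovers y M x u)
    (he : M' =ᶠ[𝓝 I] M) : Recovers y M' x u := by
  have e0 := he.self_of_nhds
  have e1 : recRatio M' = recRatio M := by rw [recRatio, recRatio, e0]
  have e2 : recProd M' I = recProd M I := by rw [recProd, recProd, e0]
  refine ⟨e2 ▸ h.den_ne, e1 ▸ h.ratio_im, e1 ▸ h.ratio_pos, e1 ▸ h.x_eq, h.u_lim.congr' ?_⟩
  filter_upwards [he.filter_mono nhdsWithin_le_nhds] with z hz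
  have e3 : recProd M' z = recProd M z := by rw [recProd, recProd, hz]
  rw [e2, e3]

/-- Normalization at infinity from that of the row function. -/
theorem normalizedAtInfinity_symMatrix {G : ℂ → ℂ}
    (h : (fun z => G z - 1) =O[Bornology.cobounded ℂ] fun z => 1 / z) :
    NormalizedAtInfinity (symMatrix G) := by
  have hn : Tendsto (fun z : ℂ => -z) (Bornology.cobounded ℂ) (Bornology.cobounded ℂ) :=
    tendsto_neg_cobounded
  have hs : Tendsto (fun z : ℂ => -star z) (Bornology.cobounded ℂ) (Bornology.cobounded ℂ) := by
    rw [← tendsto_norm_atTop_iff_cobounded]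
    simpa using! tendsto_norm_cobounded_atTop (E := ℂ)
  have h2 : (fun z => reflConj G z - 1) =O[Bornology.cobounded ℂ] fun z => 1 / z := by
    have := h.comp_tendsto hs
    rw [← Asymptotics.isBigO_norm_norm] at this ⊢
    refine (this.congr_left fun z => ?_).congr_right fun z => ?_
    · rw [Function.comp_apply, reflConj, ← norm_star (G (-star z) - 1)]
      simp
    · simp
  have hneg : ∀ {f : ℂ → ℂ}, (fun z => f z - 1) =O[Bornology.cobounded ℂ] (fun z => 1 / z) →
      (fun z => f (-z) - 1) =O[Bornology.cobounded ℂ] fun z => 1 / z := by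
    intro f hf
    have := hf.comp_tendsto hn
    rw [← Asymptotics.isBigO_norm_norm] at this ⊢
    refine (this.congr_left fun z => rfl).congr_right fun z => ?_
    simp
  intro i j
  fin_cases i <;> fin_cases j
  · refine ((h.add h2).const_mul_left (1 / 2)).congr_left fun z => ?_
    simp [symMatrix]
    ring
  · refine (((hneg h).sub (hneg h2)).const_mul_left (1 / 2)).congr_left fun z => ?_
    simp [symMatrix]
    ring
  · refine ((h.sub h2).const_mul_left (1 / 2)).congr_left fun z => ?_
    simp [symMatrix]
    ring
  · refine (((hneg h).add (hneg h2)).const_mul_left (1 / 2)).congr_left fun z => ?_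
    simp [symMatrix]
    ring

/-! ### The phase on the imaginary axis -/

/-- The positive number `e^{-2iθ(is)}`. -/
noncomputable def phaseWeight (y t s : ℝ) : ℝ :=
  Real.exp (-(1 / 2) * (s + 1 / s) * (y + 8 * t / (s - 1 / s) ^ 2))

theorem phaseWeight_pos (y t s : ℝ) : 0 < phaseWeight y t s := Real.exp_pos _

theorem theta_neg (y t : ℝ) (z : ℂ) : theta y t (-z) = -theta y t z := by
  have h1 : kfun (-z) = -kfun z := by rw [kfun, kfun, div_neg]; ring
  have h2 : lamfun (-z) = -lamfun z := by rw [lamfun, lamfun, div_neg]; ring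
  rw [theta, theta, h1, h2, neg_sq]
  ring

theorem exp_theta_mul_I (y t : ℝ) {s : ℝ} (hs : s ≠ 0) :
    exp (-2 * I * theta y t (s * I)) = phaseWeight y t s := by
  have hs' : (s : ℂ) ≠ 0 := by exact_mod_cast hs
  have hI : (1 : ℂ) / (s * I) = -(1 / s) * I := by
    rw [← div_div, div_I]
    ring
  have h1 : kfun (s * I) = -(1 / 2) * (s + 1 / s) := by
    rw [kfun, hI]
    linear_combination (1 / 2 * (s + 1 / s : ℂ)) * I_sq
  have h2 : lamfun (s * I) ^ 2 = -(1 / 4) * (s - 1 / s) ^ 2 := by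
    rw [lamfun, hI]
    linear_combination (1 / 4 * (s - 1 / s : ℂ) ^ 2) * I_sq
  have h3 : (2 * t : ℂ) / (-(1 / 4) * (s - 1 / s) ^ 2) = -(8 * t / (s - 1 / s) ^ 2) := by
    rw [div_mul_eq_div_div]
    ring
  rw [theta, h1, h2, h3, phaseWeight, ofReal_exp]
  congr 1
  push_cast
  linear_combination (1 / 2 * (s + 1 / s) * (y + 8 * t / (s - 1 / s) ^ 2) : ℂ) * I_sq

theorem phaseWeight_inv (y t : ℝ) (s : ℝ) : phaseWeight y t (1 / s) = phaseWeight y t s := by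
  rw [phaseWeight, phaseWeight, one_div_one_div]
  congr 2
  · ring
  · rw [show (1 / s - s) ^ 2 = (s - 1 / s) ^ 2 by ring]

theorem exp_theta_neg_mul_I (y t : ℝ) {s : ℝ} (hs : s ≠ 0) :
    exp (2 * I * theta y t (-(s * I))) = phaseWeight y t s := by
  rw [theta_neg, ← exp_theta_mul_I y t hs]
  congr 1
  ring

theorem exp_theta_inv_mul_I (y t : ℝ) {s : ℝ} (hs : s ≠ 0) :
    exp (-2 * I * theta y t ((1 / s : ℝ) * I)) = phaseWeight y t s := by
  rw [exp_theta_mul_I y t (one_div_ne_zero hs), phaseWeight_inv]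

theorem exp_theta_neg_inv_mul_I (y t : ℝ) {s : ℝ} (hs : s ≠ 0) :
    exp (2 * I * theta y t (-((1 / s : ℝ) * I))) = phaseWeight y t s := by
  rw [exp_theta_neg_mul_I y t (one_div_ne_zero hs), phaseWeight_inv]

/-! ### Points of the imaginary axis -/

theorem eq_im_mul_I {z : ℂ} (hz : z.re = 0) : z = z.im * I := by
  apply Complex.ext <;> simp [hz]

theorem star_mul_I (s : ℝ) : star ((s : ℂ) * I) = -(s * I) := by simp

theorem neg_star_mul_I (s : ℝ) : -star ((s : ℂ) * I) = s * I := by simp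

theorem one_div_mul_I (s : ℝ) : 1 / ((s : ℂ) * I) = -((1 / s : ℝ) * I) := by
  rw [← div_div, div_I]
  push_cast
  ring

theorem neg_one_div_mul_I (s : ℝ) : -(1 / ((s : ℂ) * I)) = (1 / s : ℝ) * I := by
  rw [one_div_mul_I, neg_neg]

theorem one_div_star_mul_I (s : ℝ) : 1 / star ((s : ℂ) * I) = (1 / s : ℝ) * I := by
  rw [star_mul_I, div_neg, one_div_mul_I, neg_neg]

theorem neg_one_div_star_mul_I (s : ℝ) : -(1 / star ((s : ℂ) * I)) = -((1 / s : ℝ) * I) := by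
  rw [one_div_star_mul_I]

theorem mul_I_mem_cseg {p q s : ℝ} : (s : ℂ) * I ∈ cseg p q ↔ s ∈ Icc p q := by
  simp [cseg]

theorem mul_I_mem_oseg {p q s : ℝ} : (s : ℂ) * I ∈ oseg p q ↔ s ∈ Ioo p q := by
  simp [oseg]

/-! ### The reflectionless problem as a system on the imaginary axis -/

section Soliton

variable {N : ℕ}

/-- The points `τ` with poles `±iτ`. -/
noncomputable def poleHeight (s : Fin N → ℝ) : Fin N ⊕ Fin N → ℝ :=
  Sum.elim s fun j => 1 / s j

/-- The residue coefficients at the points `iτ`. -/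
noncomputable def poleWeight (κ s : Fin N → ℝ) : Fin N ⊕ Fin N → ℝ :=
  Sum.elim κ fun j => κ j / s j ^ 2

theorem mem_spectrumSet_iff {z : Fin N → ℂ} {s : Fin N → ℝ} (hz : ∀ j, z j = s j * I) (w : ℂ) :
    w ∈ spectrumSet z ↔ ∃ l, w = poleHeight s l * I ∨ w = -(poleHeight s l * I) := by
  simp only [spectrumSet, mem_ofPred_eq, hz, star_mul_I, div_neg, one_div_mul_I, neg_neg,
    Sum.exists, poleHeight, Sum.elim_inl, Sum.elim_inr, ← exists_or]
  exact exists_congr fun j => by tauto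

theorem finite_spectrumSet (z : Fin N → ℂ) : (spectrumSet z).Finite := by
  have : spectrumSet z = ⋃ j, {z j, -star (z j), 1 / star (z j), -(1 / z j), star (z j), -z j,
      1 / z j, -(1 / star (z j))} := by
    ext w
    simp [spectrumSet]
  rw [this]
  exact finite_iUnion fun j => by simp

variable {z c : Fin N → ℂ} {s γ κ : Fin N → ℝ} {y t : ℝ} {M : ℂ → Mat2}

theorem solvesSolitonRHP_iff (hz : ∀ j, z j = s j * I) (hs : ∀ j, s j ≠ 0)
    (hc : ∀ j, c j = γ j) (hκ : ∀ j, κ j = γ j * phaseWeight y t (s j)) :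
    SolvesSolitonRHP z c y t M ↔
      (∀ i j, DifferentiableOn ℂ (fun w => M w i j) (spectrumSet z)ᶜ) ∧
      (∀ k, ResidueCondition M (poleHeight s k * I) (lowNil (poleWeight κ s k))) ∧
      (∀ k, ResidueCondition M (-(poleHeight s k * I)) (upNil (-poleWeight κ s k))) ∧
      NormalizedAtInfinity M ∧ NormalizedAtI M := by
  have hstar : ∀ j, star (c j) = c j := fun j => by rw [hc]; simp
  have hsq : ∀ j, ((s j : ℂ) * I) ^ 2 = -(s j : ℂ) ^ 2 := fun j => by rw [mul_pow, I_sq]; ring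
  have hsq' : ∀ j, (-((s j : ℂ) * I)) ^ 2 = -(s j : ℂ) ^ 2 := fun j => by rw [neg_sq, hsq]
  have v1 : ∀ j, ((poleWeight κ s (Sum.inl j) : ℝ) : ℂ) = c j * phaseWeight y t (s j) := fun j => by
    simp [poleWeight, hκ, hc]
  have v2 : ∀ j, ((poleWeight κ s (Sum.inr j) : ℝ) : ℂ)
      = c j / (s j : ℂ) ^ 2 * phaseWeight y t (s j) := fun j => by
    simp only [poleWeight, Sum.elim_inr, hκ, hc]
    push_cast
    ring
  have e3 : ∀ j, -(c j / -(s j : ℂ) ^ 2 * phaseWeight y t (s j))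
      = c j / (s j : ℂ) ^ 2 * phaseWeight y t (s j) := fun j => by rw [div_neg]; ring
  have e7 : ∀ j, c j / -(s j : ℂ) ^ 2 * phaseWeight y t (s j)
      = -(c j / (s j : ℂ) ^ 2 * phaseWeight y t (s j)) := fun j => by rw [div_neg]; ring
  have p1 : ∀ j, poleHeight s (Sum.inl j) = s j := fun j => rfl
  have p2 : ∀ j, poleHeight s (Sum.inr j) = 1 / s j := fun j => rfl
  constructor
  · intro h
    refine ⟨h.analytic, ?_, ?_, h.at_infinity, h.at_I⟩
    · rintro (j | j)
      · have := h.res₁ j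
        rwa [hz, exp_theta_mul_I y t (hs j), ← v1, ← p1] at this
      · have := h.res₄ j
        rwa [hz, neg_one_div_mul_I, exp_theta_inv_mul_I y t (hs j), hsq, e3, ← v2, ← p2] at this
    · rintro (j | j)
      · have := h.res₆ j
        rwa [hz, exp_theta_neg_mul_I y t (hs j), ← v1, ← p1] at this
      · have := h.res₇ j
        rwa [hz, one_div_mul_I, exp_theta_neg_inv_mul_I y t (hs j), hsq, e7, ← v2, ← p2] at this
  · rintro ⟨h0, hl, hu, hi, hI⟩
    have l1 : ∀ j, ResidueCondition M (s j * I) (lowNil (c j * phaseWeight y t (s j))) := fun j => by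
      rw [← v1]; exact hl (Sum.inl j)
    have l2 : ∀ j, ResidueCondition M ((1 / s j : ℝ) * I)
        (lowNil (c j / (s j : ℂ) ^ 2 * phaseWeight y t (s j))) := fun j => by
      rw [← v2]; exact hl (Sum.inr j)
    have u1 : ∀ j, ResidueCondition M (-(s j * I)) (upNil (-(c j * phaseWeight y t (s j)))) :=
      fun j => by rw [← v1]; exact hu (Sum.inl j)
    have u2 : ∀ j, ResidueCondition M (-((1 / s j : ℝ) * I))
        (upNil (-(c j / (s j : ℂ) ^ 2 * phaseWeight y t (s j)))) := fun j => by
      rw [← v2]; exact hu (Sum.inr j)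
    refine ⟨h0, fun j => ?_, fun j => ?_, fun j => ?_, fun j => ?_, fun j => ?_, fun j => ?_,
      fun j => ?_, fun j => ?_, hi, hI⟩
    · rw [hz, exp_theta_mul_I y t (hs j)]
      exact l1 j
    · rw [hz, neg_star_mul_I, exp_theta_mul_I y t (hs j), hstar]
      exact l1 j
    · rw [hz, one_div_star_mul_I, star_mul_I, exp_theta_inv_mul_I y t (hs j), hstar, hsq', e3]
      exact l2 j
    · rw [hz, neg_one_div_mul_I, exp_theta_inv_mul_I y t (hs j), hsq, e3]
      exact l2 j
    · rw [hz, star_mul_I, exp_theta_neg_mul_I y t (hs j), hstar]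
      exact u1 j
    · rw [hz, exp_theta_neg_mul_I y t (hs j)]
      exact u1 j
    · rw [hz, one_div_mul_I, exp_theta_neg_inv_mul_I y t (hs j), hsq, e7]
      exact u2 j
    · rw [hz, neg_one_div_star_mul_I, star_mul_I, exp_theta_neg_inv_mul_I y t (hs j), hstar, hsq',
        e7]
      exact u2 j

theorem poleWeight_sign (hκ : (∀ j, 0 ≤ κ j) ∨ ∀ j, κ j ≤ 0) :
    (∀ l, 0 ≤ poleWeight κ s l) ∨ ∀ l, poleWeight κ s l ≤ 0 := by
  rcases hκ with h | h
  · left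
    rintro (j | j)
    · exact h j
    · exact div_nonneg (h j) (sq_nonneg _)
  · right
    rintro (j | j)
    · exact h j
    · exact div_nonpos_of_nonpos_of_nonneg (h j) (sq_nonneg _)

theorem le_poleHeight {b : ℝ} (hs1 : ∀ j, 1 < s j) (hsb : ∀ j, s j ≤ b) (l : Fin N ⊕ Fin N) :
    1 / b ≤ poleHeight s l := by
  rcases l with j | j
  · have h1 := hs1 j
    have h2 := hsb j
    have : 1 / b ≤ 1 := by
      rw [div_le_one (by linarith)]
      linarith
    exact this.trans h1.le
  · exact one_div_le_one_div_of_le (by linarith [hs1 j]) (hsb j)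

theorem poleHeight_injective (hs1 : ∀ j, 1 < s j) (hinj : Function.Injective s) :
    Function.Injective (poleHeight s) := by
  have h1 : ∀ j, 1 / s j < 1 := fun j => by
    rw [div_lt_one (by linarith [hs1 j])]
    exact hs1 j
  rintro (j | j) (k | k) h
  · exact congrArg _ (hinj h)
  · have : s j = 1 / s k := h
    linarith [hs1 j, h1 k]
  · have : 1 / s j = s k := h
    linarith [hs1 k, h1 j]
  · have : 1 / s j = 1 / s k := h
    rw [one_div, one_div, inv_inj] at this
    exact congrArg _ (hinj this)

variable {b : ℝ} {g : Fin N ⊕ Fin N → ℂ}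

theorem ne_mul_I_of_im {x : ℝ} {w : ℂ} (h : w.im ≠ x) : w ≠ x * I := by
  rintro rfl
  simp at h

theorem norm_poleHeight_ne_one (hs1 : ∀ j, 1 < s j) (l : Fin N ⊕ Fin N) : poleHeight s l ≠ 1 := by
  rcases l with j | j
  · exact (hs1 j).ne'
  · intro h
    have : 1 / s j = 1 := h
    rw [div_eq_one_iff_eq (by linarith [hs1 j])] at this
    linarith [hs1 j]

theorem rowFun_isBigO {ι : Type*} [Fintype ι] (v τ : ι → ℝ) (g : ι → ℂ) :
    (fun z => rowFun v τ g z - 1) =O[Bornology.cobounded ℂ] fun z => 1 / z := by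
  simp only [rowFun, add_sub_cancel_left]
  refine Asymptotics.IsBigO.fun_sum fun l _ => ?_
  have h1 : (fun z : ℂ => (z - τ l * I)⁻¹) =O[Bornology.cobounded ℂ] fun z : ℂ => z⁻¹ := by
    refine Asymptotics.IsBigO.inv_rev ?_ ?_
    · have : (fun _ : ℂ => (τ l : ℂ) * I) =o[Bornology.cobounded ℂ] fun z : ℂ => z :=
        Asymptotics.isLittleO_const_id_cobounded ((τ l : ℂ) * I)
      have h2 := this.right_isBigO_sub
      exact h2
    · have h0 : ({0} : Set ℂ)ᶜ ∈ Bornology.cobounded ℂ :=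
        Bornology.isCobounded_compl_iff.2 Bornology.isBounded_singleton
      filter_upwards [h0] with z hz hz0
      exact absurd hz0 hz
  simpa [div_eq_mul_inv] using h1.const_mul_left ((v l : ℂ) * g l)

/-- The row function of the `N`-soliton problem has the symmetries of the problem. -/
theorem rowSymmetric_soliton (hs1 : ∀ j, 1 < s j) (hsb : ∀ j, s j ≤ b) (hb : 0 < b)
    (hκ : (∀ j, 0 ≤ κ j) ∨ ∀ j, κ j ≤ 0)
    (hg : ∀ k, g k = 1 + I * carlemanSum (poleWeight κ s) (poleHeight s) g (poleHeight s k)) :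
    RowSymmetric (rowFun (poleWeight κ s) (poleHeight s) g) ∧
      ∀ z, z ≠ 0 → (∀ l, z ≠ poleHeight s l * I) →
        reflConj (rowFun (poleWeight κ s) (poleHeight s) g) z =
          reflConj (rowFun (poleWeight κ s) (poleHeight s) g) 0 *
            rowFun (poleWeight κ s) (poleHeight s) g (-(1 / z)) := by
  have hd : 0 < 1 / b := by positivity
  have hτ := le_poleHeight hs1 hsb
  have hτ0 : ∀ l, 0 < poleHeight s l := fun l => hd.trans_le (hτ l)
  have hs0 : ∀ j, s j ≠ 0 := fun j => by linarith [hs1 j]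
  have hinv : ∀ z, z ≠ 0 → (∀ l, z ≠ poleHeight s l * I) →
        reflConj (rowFun (poleWeight κ s) (poleHeight s) g) z =
          reflConj (rowFun (poleWeight κ s) (poleHeight s) g) 0 *
            rowFun (poleWeight κ s) (poleHeight s) g (-(1 / z)) := by
    intro z hz0 hz
    refine reflConj_rowFun_inv (poleWeight_sign hκ) hd hτ (Equiv.sumComm _ _) (fun l => ?_)
      (fun l => ?_) (fun l => ?_) hg hz0 hz
    · rcases l with j | j <;> rfl
    · rcases l with j | j
      · rfl
      · simp [poleHeight]
    · rcases l with j | j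
      · rfl
      · have := hs0 j
        simp only [Equiv.sumComm_apply, Sum.swap_inr, poleWeight, Sum.elim_inl, Sum.elim_inr,
          poleHeight]
        field_simp
  have hI : ∀ l, I ≠ poleHeight s l * I := fun l => by
    refine ne_mul_I_of_im ?_
    rw [I_im]
    exact (norm_poleHeight_ne_one hs1 l).symm
  have hnI : ∀ l, -I ≠ poleHeight s l * I := fun l => by
    refine ne_mul_I_of_im ?_
    rw [neg_im, I_im]
    linarith [hτ0 l]
  have hev : ∀ p : ℂ, (∀ l, p ≠ poleHeight s l * I) →
      ∀ᶠ z in 𝓝 p, ∀ l, z ≠ poleHeight s l * I := fun p hp =>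
    eventually_all.2 fun l => eventually_ne_nhds (hp l)
  refine ⟨⟨?_, ?_, ⟨reflConj (rowFun (poleWeight κ s) (poleHeight s) g) 0, ?_, ?_⟩, ?_⟩, hinv⟩
  · filter_upwards [hev I hI] with z hz
    exact differentiableAt_rowFun g hz
  · filter_upwards [hev (-I) hnI] with z hz
    exact differentiableAt_rowFun g hz
  · filter_upwards [hev I hI, eventually_ne_nhds I_ne_zero] with z hz hz0
    exact hinv z hz0 hz
  · filter_upwards [hev (-I) hnI, eventually_ne_nhds (neg_ne_zero.2 I_ne_zero)] with z hz hz0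
    exact hinv z hz0 hz
  · refine rowFun_det hg hτ0 hI fun l h => hnI l (neg_eq_iff_eq_neg.2 h)

/-- Solution of the `N`-soliton problem. -/
theorem solvesSolitonRHP_symMatrix (hs1 : ∀ j, 1 < s j) (hsb : ∀ j, s j ≤ b) (hb : 0 < b)
    (hinj : Function.Injective s) (hz : ∀ j, z j = s j * I)
    (hc : ∀ j, c j = γ j) (hκ : ∀ j, κ j = γ j * phaseWeight y t (s j))
    (hκ' : (∀ j, 0 ≤ κ j) ∨ ∀ j, κ j ≤ 0)
    (hg : ∀ k, g k = 1 + I * carlemanSum (poleWeight κ s) (poleHeight s) g (poleHeight s k)) :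
    SolvesSolitonRHP z c y t (symMatrix (rowFun (poleWeight κ s) (poleHeight s) g)) := by
  have hd : 0 < 1 / b := by positivity
  have hτ := le_poleHeight hs1 hsb
  have hτ0 : ∀ l, 0 < poleHeight s l := fun l => hd.trans_le (hτ l)
  have hlow := residueCondition_low (v := poleWeight κ s) hτ0 (poleHeight_injective hs1 hinj) hg
  refine (solvesSolitonRHP_iff hz (fun j => by linarith [hs1 j]) hc hκ).2
    ⟨fun i j => ?_, hlow, fun k => ?_,
      normalizedAtInfinity_symMatrix (rowFun_isBigO _ _ _),
      (rowSymmetric_soliton hs1 hsb hb hκ' hg).1.normalizedAtI⟩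
  · intro w hw
    rw [mem_compl_iff, mem_spectrumSet_iff hz] at hw
    push Not at hw
    have hG : ∀ u : ℂ, (∀ l, u ≠ poleHeight s l * I) →
        DifferentiableAt ℂ (rowFun (poleWeight κ s) (poleHeight s) g) u ∧
        DifferentiableAt ℂ (reflConj (rowFun (poleWeight κ s) (poleHeight s) g)) u := by
      intro u hu
      refine ⟨differentiableAt_rowFun g hu, differentiableAt_reflConj
        (differentiableAt_rowFun g fun l h => hu l ?_)⟩
      rw [← neg_star_mul_I, ← h]
      simp
    obtain ⟨d1, d2⟩ := hG w fun l => (hw l).1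
    obtain ⟨d3, d4⟩ := hG (-w) fun l h => (hw l).2 (by rw [← h, neg_neg])
    have d3' : DifferentiableAt ℂ
        (fun w => rowFun (poleWeight κ s) (poleHeight s) g (-w)) w :=
      DifferentiableAt.comp (g := rowFun (poleWeight κ s) (poleHeight s) g) w d3 differentiableAt_id.neg
    have d4' : DifferentiableAt ℂ
        (fun w => reflConj (rowFun (poleWeight κ s) (poleHeight s) g) (-w)) w :=
      DifferentiableAt.comp (g := reflConj (rowFun (poleWeight κ s) (poleHeight s) g)) w d4 differentiableAt_id.neg
    refine DifferentiableAt.differentiableWithinAt ?_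
    fin_cases i <;> fin_cases j
    · exact (d1.add d2).div_const 2
    · exact (d3'.sub d4').div_const 2
    · exact (d1.sub d2).div_const 2
    · exact (d3'.add d4').div_const 2
  · exact residueCondition_up_of_low (hlow k)

/-- Uniqueness for the `N`-soliton problem. -/
theorem SolvesSolitonRHP.eq_symMatrix (hM : SolvesSolitonRHP z c y t M) (hs1 : ∀ j, 1 < s j)
    (hsb : ∀ j, s j ≤ b) (hb : 0 < b)
    (hinj : Function.Injective s) (hz : ∀ j, z j = s j * I)
    (hc : ∀ j, c j = γ j) (hκ : ∀ j, κ j = γ j * phaseWeight y t (s j))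
    (hκ' : (∀ j, 0 ≤ κ j) ∨ ∀ j, κ j ≤ 0)
    (hg : ∀ k, g k = 1 + I * carlemanSum (poleWeight κ s) (poleHeight s) g (poleHeight s k))
    {w : ℂ} (hw : w ∉ spectrumSet z) :
    M w = symMatrix (rowFun (poleWeight κ s) (poleHeight s) g) w := by
  obtain ⟨h0, hl, hu, hi, -⟩ :=
    (solvesSolitonRHP_iff hz (fun j => by linarith [hs1 j]) hc hκ).1 hM
  exact eq_symMatrix_of_residues (poleWeight_sign hκ') (one_div_pos.2 hb) (le_poleHeight hs1 hsb)
    (poleHeight_injective hs1 hinj) hg (finite_spectrumSet z) (mem_spectrumSet_iff hz) h0 hl hu hi hw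

end Soliton

/-! ### The limit of the scalar systems -/

/-- `∫_a^b ρ(x) η(x) (φ(x) + x⁻² φ(1/x)) dx`. -/
noncomputable def densityFunctional (a b : ℝ) (ρ η : ℝ → ℝ) (φ : ℝ → ℂ) : ℂ :=
  ∫ x in a..b, (ρ x : ℂ) * (η x * (φ x + φ (1 / x) / (x : ℂ) ^ 2))

/-- `∑_l v_l φ(τ_l)` for the poles generated by the points `s_j` with coefficients `η(s_j)/N`. -/
noncomputable def sampleFunctional {N : ℕ} (η : ℝ → ℝ) (s : Fin N → ℝ) (φ : ℝ → ℂ) : ℂ :=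
  ∑ l, (poleWeight (fun j => η (s j) / N) s l : ℂ) * φ (poleHeight s l)

/-- Bounded Lipschitz functions on `[a, b]` and, through `x ↦ 1/x`, on `[1/b, 1/a]`. -/
structure TameOn (a b B K : ℝ) (φ : ℝ → ℂ) : Prop where
  bound : ∀ x ∈ Icc a b, ‖φ x‖ ≤ B
  bound_inv : ∀ x ∈ Icc a b, ‖φ (1 / x)‖ ≤ B
  lip : ∀ x ∈ Icc a b, ∀ x' ∈ Icc a b, ‖φ x - φ x'‖ ≤ K * |x - x'|
  lip_inv : ∀ x ∈ Icc a b, ∀ x' ∈ Icc a b, ‖φ (1 / x) - φ (1 / x')‖ ≤ K * |x - x'|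

theorem abs_inv_sub_inv_le {x x' : ℝ} (hx : 1 ≤ x) (hx' : 1 ≤ x') :
    |1 / x - 1 / x'| ≤ |x - x'| := by
  have h0 : 0 < x := by linarith
  have h0' : 0 < x' := by linarith
  have e : 1 / x - 1 / x' = -(x - x') / (x * x') := by field_simp; ring
  rw [e, abs_div, abs_neg, abs_of_pos (mul_pos h0 h0')]
  exact div_le_self (abs_nonneg _) (by nlinarith)

theorem TameOn.of_Icc {a b B K : ℝ} (ha : 1 < a) {φ : ℝ → ℂ} (hK : 0 ≤ K)
    (hB : ∀ x, 1 / b ≤ x → ‖φ x‖ ≤ B)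
    (hL : ∀ x x', 1 / b ≤ x → 1 / b ≤ x' → ‖φ x - φ x'‖ ≤ K * |x - x'|) : TameOn a b B K φ := by
  have h1 : ∀ x ∈ Icc a b, 1 / b ≤ x := fun x hx => by
    have : 1 / b ≤ 1 := by
      rw [div_le_one (by linarith [hx.1, hx.2])]
      linarith [hx.1, hx.2]
    linarith [hx.1]
  have h2 : ∀ x ∈ Icc a b, 1 / b ≤ 1 / x := fun x hx =>
    one_div_le_one_div_of_le (by linarith [hx.1]) hx.2
  refine ⟨fun x hx => hB x (h1 x hx), fun x hx => hB _ (h2 x hx),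
    fun x hx x' hx' => hL x x' (h1 x hx) (h1 x' hx'), fun x hx x' hx' => ?_⟩
  refine (hL _ _ (h2 x hx) (h2 x' hx')).trans (mul_le_mul_of_nonneg_left ?_ hK)
  exact abs_inv_sub_inv_le (by linarith [hx.1]) (by linarith [hx'.1])

theorem norm_mul_sub_mul_le {x y x' y' : ℂ} {B₁ B₂ K₁ K₂ D : ℝ} (h1 : ‖x'‖ ≤ B₁) (h2 : ‖y‖ ≤ B₂)
    (h3 : ‖x - x'‖ ≤ K₁ * D) (h4 : ‖y - y'‖ ≤ K₂ * D) :
    ‖x * y - x' * y'‖ ≤ (K₁ * B₂ + B₁ * K₂) * D := by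
  have e : x * y - x' * y' = (x - x') * y + x' * (y - y') := by ring
  have a1 : ‖(x - x') * y‖ ≤ K₁ * D * B₂ := by
    rw [norm_mul]
    exact mul_le_mul h3 h2 (norm_nonneg _) ((norm_nonneg _).trans h3)
  have a2 : ‖x' * (y - y')‖ ≤ B₁ * (K₂ * D) := by
    rw [norm_mul]
    exact mul_le_mul h1 h4 (norm_nonneg _) ((norm_nonneg _).trans h1)
  rw [e]
  linarith [norm_add_le ((x - x') * y) (x' * (y - y'))]

theorem norm_mul_le_mul {x y : ℂ} {B₁ B₂ : ℝ} (h1 : ‖x‖ ≤ B₁) (h2 : ‖y‖ ≤ B₂) :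
    ‖x * y‖ ≤ B₁ * B₂ := by
  rw [norm_mul]
  exact mul_le_mul h1 h2 (norm_nonneg _) ((norm_nonneg _).trans h1)

theorem TameOn.mul {a b B₁ K₁ B₂ K₂ : ℝ} {φ ψ : ℝ → ℂ} (hφ : TameOn a b B₁ K₁ φ)
    (hψ : TameOn a b B₂ K₂ ψ) :
    TameOn a b (B₁ * B₂) (K₁ * B₂ + B₁ * K₂) fun x => φ x * ψ x :=
  ⟨fun x hx => norm_mul_le_mul (hφ.bound x hx) (hψ.bound x hx),
    fun x hx => norm_mul_le_mul (hφ.bound_inv x hx) (hψ.bound_inv x hx),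
    fun x hx x' hx' => norm_mul_sub_mul_le (hφ.bound x' hx') (hψ.bound x hx)
      (hφ.lip x hx x' hx') (hψ.lip x hx x' hx'),
    fun x hx x' hx' => norm_mul_sub_mul_le (hφ.bound_inv x' hx') (hψ.bound_inv x hx)
      (hφ.lip_inv x hx x' hx') (hψ.lip_inv x hx x' hx')⟩

theorem norm_inv_sub_inv_le {z w : ℂ} {d : ℝ} (hd : 0 < d) (hz : d ≤ ‖z‖) (hw : d ≤ ‖w‖) :
    ‖z⁻¹ - w⁻¹‖ ≤ (d⁻¹ * d⁻¹) * ‖z - w‖ := by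
  have hz0 : z ≠ 0 := norm_pos_iff.1 (hd.trans_le hz)
  have hw0 : w ≠ 0 := norm_pos_iff.1 (hd.trans_le hw)
  rw [inv_sub_inv hz0 hw0, norm_div, norm_mul, norm_sub_rev, div_eq_inv_mul, mul_inv]
  gcongr

/-- The Cauchy kernel is tame away from its singularities. -/
theorem tameOn_cauchyKernel {a b d : ℝ} (ha : 1 < a) (hd : 0 < d) {z : ℂ}
    (hz : ∀ x ∈ Icc a b, d ≤ ‖z - x * I‖ ∧ d ≤ ‖z - (1 / x : ℝ) * I‖) :
    TameOn a b d⁻¹ (d⁻¹ * d⁻¹) fun x => (z - x * I)⁻¹ := by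
  have hb : ∀ x : ℝ, d ≤ ‖z - x * I‖ → ‖(z - x * I)⁻¹‖ ≤ d⁻¹ := fun x hx => by
    rw [norm_inv]
    exact inv_anti₀ hd hx
  have hl : ∀ x x' : ℝ, d ≤ ‖z - x * I‖ → d ≤ ‖z - x' * I‖ →
      ‖(z - x * I)⁻¹ - (z - x' * I)⁻¹‖ ≤ (d⁻¹ * d⁻¹) * |x - x'| := fun x x' hx hx' => by
    refine (norm_inv_sub_inv_le hd hx hx').trans_eq ?_
    rw [sub_sub_sub_cancel_left, ← sub_mul, norm_mul, norm_I, mul_one, ← ofReal_sub,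
      Complex.norm_real, Real.norm_eq_abs, abs_sub_comm]
  refine ⟨fun x hx => hb x (hz x hx).1, fun x hx => hb _ (hz x hx).2,
    fun x hx x' hx' => hl x x' (hz x hx).1 (hz x' hx').1, fun x hx x' hx' => ?_⟩
  refine (hl _ _ (hz x hx).2 (hz x' hx').2).trans (mul_le_mul_of_nonneg_left ?_ (by positivity))
  exact abs_inv_sub_inv_le (by linarith [hx.1]) (by linarith [hx'.1])

theorem sampleFunctional_eq {N : ℕ} (η : ℝ → ℝ) (s : Fin N → ℝ) (φ : ℝ → ℂ) :
    sampleFunctional η s φ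
      = (∑ j, (η (s j) : ℂ) * (φ (s j) + φ (1 / s j) / (s j : ℂ) ^ 2)) / N := by
  rw [sampleFunctional, Fintype.sum_sum_type, ← Finset.sum_add_distrib, Finset.sum_div]
  refine Finset.sum_congr rfl fun j _ => ?_
  simp only [poleWeight, poleHeight, Sum.elim_inl, Sum.elim_inr]
  push_cast
  ring

/-- The hypotheses on density, weight and sampling points. -/
structure SamplingData (a b : ℝ) (ρ η : ℝ → ℝ) (s : (N : ℕ) → Fin N → ℝ) : Prop where
  one_lt : 1 < a
  lt : a < b
  density_cont : ContinuousOn ρ (Icc a b)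
  density_nonneg : ∀ x ∈ Icc a b, 0 ≤ ρ x
  density_integral : ∫ x in a..b, ρ x = 1
  weight_cont : ContinuousOn η (Icc a b)
  weight_sign : (∀ x ∈ Icc a b, 0 ≤ η x) ∨ ∀ x ∈ Icc a b, η x ≤ 0
  mem : ∀ N j, s N j ∈ Icc a b
  quantile : ∀ N j, ∫ x in a..s N j, ρ x = ((j : ℕ) + 1 : ℝ) / N

namespace SamplingData

variable {a b : ℝ} {ρ η : ℝ → ℝ} {s : (N : ℕ) → Fin N → ℝ} (h : SamplingData a b ρ η s)
include h

theorem b_pos : 0 < b := by linarith [h.one_lt, h.lt]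

theorem one_lt_point (N : ℕ) (j : Fin N) : 1 < s N j := h.one_lt.trans_le (h.mem N j).1

theorem injective (N : ℕ) : Function.Injective (s N) := by
  intro j k hjk
  have h1 := h.quantile N j
  rw [hjk, h.quantile N k] at h1
  have hN : (N : ℝ) ≠ 0 := by
    have := j.2
    have : 0 < N := by omega
    exact_mod_cast this.ne'
  rw [div_left_inj' hN] at h1
  have : (k : ℕ) = j := by exact_mod_cast (add_right_cancel h1)
  exact Fin.ext this.symm

theorem coeff_sign (N : ℕ) :
    (∀ j, 0 ≤ η (s N j) / N) ∨ ∀ j, η (s N j) / N ≤ 0 := by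
  rcases h.weight_sign with hs | hs
  · exact Or.inl fun j => div_nonneg (hs _ (h.mem N j)) (Nat.cast_nonneg _)
  · exact Or.inr fun j => div_nonpos_of_nonpos_of_nonneg (hs _ (h.mem N j)) (Nat.cast_nonneg _)

theorem exists_total_weight : ∃ V, 0 ≤ V ∧ ∀ N,
    ∑ l, |poleWeight (fun j => η (s N j) / N) (s N) l| ≤ V := by
  obtain ⟨W, hW⟩ := isCompact_Icc.exists_bound_of_continuousOn h.weight_cont
  refine ⟨2 * |W|, by positivity, fun N => ?_⟩
  rw [Fintype.sum_sum_type, ← Finset.sum_add_distrib]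
  rcases Nat.eq_zero_or_pos N with rfl | hN
  · simp
  have hN' : (0 : ℝ) < N := by exact_mod_cast hN
  calc _ ≤ ∑ _j : Fin N, 2 * |W| / N := by
        refine Finset.sum_le_sum fun j _ => ?_
        have h1 : |η (s N j)| ≤ |W| := (hW _ (h.mem N j)).trans (le_abs_self W)
        have h2 : (1 : ℝ) ≤ s N j ^ 2 := one_le_pow₀ (h.one_lt_point N j).le
        simp only [poleWeight, Sum.elim_inl, Sum.elim_inr, abs_div, abs_pow, Nat.abs_cast, sq_abs]
        have h3 : |η (s N j)| / N / s N j ^ 2 ≤ |η (s N j)| / N := div_le_self (by positivity) h2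
        have h4 : |η (s N j)| / N ≤ |W| / N := by gcongr
        rw [mul_div_assoc]
        linarith
    _ = 2 * |W| := by
        simp only [Finset.sum_const, Finset.card_univ, Fintype.card_fin, nsmul_eq_mul]
        field_simp

/-- Convergence of the sample functionals, uniform on bounded sets of Lipschitz functions. -/
theorem eventually_sample_approx (B K : ℝ) {ε : ℝ} (hε : 0 < ε) :
    ∀ᶠ N in atTop, ∀ φ, TameOn a b B K φ →
      ‖sampleFunctional η (s N) φ - densityFunctional a b ρ η φ‖ ≤ ε := by
  filter_upwards [eventually_quantile_sum_approx h.lt.le h.density_cont h.density_nonneg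
    h.density_integral h.mem h.quantile (w := fun x => (η x : ℂ))
    (continuous_ofReal.comp_continuousOn h.weight_cont) (2 * B) (K + (K + B * 2)) hε]
    with N hN φ hφ
  rw [sampleFunctional_eq, densityFunctional]
  have hx1 : ∀ x ∈ Icc a b, 1 ≤ x := fun x hx => h.one_lt.le.trans hx.1
  have hq : ∀ x ∈ Icc a b, ‖((x : ℂ) ^ 2)⁻¹‖ ≤ 1 := fun x hx => by
    rw [norm_inv, norm_pow, Complex.norm_real, Real.norm_eq_abs, sq_abs]
    exact inv_le_one_of_one_le₀ (one_le_pow₀ (hx1 x hx))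
  refine hN (fun x => φ x + φ (1 / x) / (x : ℂ) ^ 2) (fun x hx => ?_) fun x hx x' hx' => ?_
  · rw [div_eq_mul_inv]
    have := norm_mul_le_mul (hφ.bound_inv x hx) (hq x hx)
    linarith [norm_add_le (φ x) (φ (1 / x) * ((x : ℂ) ^ 2)⁻¹), hφ.bound x hx]
  · have hB : 0 ≤ B := (norm_nonneg _).trans (hφ.bound x hx)
    have hsq : ‖((x : ℂ) ^ 2)⁻¹ - ((x' : ℂ) ^ 2)⁻¹‖ ≤ 2 * |x - x'| := by
      have e : (((x : ℂ) ^ 2)⁻¹ - ((x' : ℂ) ^ 2)⁻¹) = (((1 / x + 1 / x') * (1 / x - 1 / x') : ℝ) : ℂ) := by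
        push_cast
        ring
      rw [e, Complex.norm_real, Real.norm_eq_abs, abs_mul]
      have h1 : |1 / x + 1 / x'| ≤ 2 := by
        have p1 : 1 / x ≤ 1 := by rw [div_le_one (by linarith [hx1 x hx])]; exact hx1 x hx
        have p2 : 1 / x' ≤ 1 := by rw [div_le_one (by linarith [hx1 x' hx'])]; exact hx1 x' hx'
        have p3 : 0 < 1 / x := one_div_pos.2 (by linarith [hx1 x hx])
        have p4 : 0 < 1 / x' := one_div_pos.2 (by linarith [hx1 x' hx'])
        rw [abs_of_pos (by linarith)]
        linarith
      exact mul_le_mul h1 (abs_inv_sub_inv_le (hx1 x hx) (hx1 x' hx')) (abs_nonneg _) (by norm_num)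
    have e : φ x + φ (1 / x) / (x : ℂ) ^ 2 - (φ x' + φ (1 / x') / (x' : ℂ) ^ 2)
        = (φ x - φ x') + (φ (1 / x) * ((x : ℂ) ^ 2)⁻¹ - φ (1 / x') * ((x' : ℂ) ^ 2)⁻¹) := by
      rw [div_eq_mul_inv, div_eq_mul_inv]
      ring
    rw [e]
    have h1 := norm_mul_sub_mul_le (hφ.bound_inv x' hx') (hq x hx) (hφ.lip_inv x hx x' hx') hsq
    rw [mul_one] at h1
    rw [add_mul K]
    exact (norm_add_le _ _).trans (add_le_add (hφ.lip x hx x' hx') h1)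

omit h in
/-- Sample functionals are bounded by the total weight. -/
theorem norm_sampleFunctional_le {V : ℝ}
    (hV : ∀ N, ∑ l, |poleWeight (fun j => η (s N j) / N) (s N) l| ≤ V) {N : ℕ} {φ : ℝ → ℂ} {B : ℝ}
    (hB0 : 0 ≤ B)
    (hB : ∀ l, ‖φ (poleHeight (s N) l)‖ ≤ B) : ‖sampleFunctional η (s N) φ‖ ≤ V * B := by
  calc _ ≤ ∑ l, |poleWeight (fun j => η (s N j) / N) (s N) l| * B := by
        refine norm_sum_le_of_le _ fun l _ => ?_
        rw [norm_mul, Complex.norm_real, Real.norm_eq_abs]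
        gcongr
        exact hB l
    _ ≤ _ := by
        rw [← Finset.sum_mul]
        gcongr
        exact hV N

end SamplingData

/-- The Carleman kernel is tame. -/
theorem tameOn_carlemanKernel {a b x : ℝ} (ha : 1 < a) (hb : 0 < b) (hx : 1 / b ≤ x) :
    TameOn a b (1 / b)⁻¹ ((1 / b)⁻¹ * (1 / b)⁻¹) fun u => (((x + u : ℝ) : ℂ))⁻¹ := by
  have hd : 0 < 1 / b := one_div_pos.2 hb
  have hle : ∀ u, 1 / b ≤ u → 1 / b ≤ ‖((x + u : ℝ) : ℂ)‖ := fun u hu => by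
    rw [Complex.norm_real, Real.norm_of_nonneg (by linarith)]
    linarith
  refine TameOn.of_Icc ha (by positivity) (fun u hu => ?_) fun u u' hu hu' => ?_
  · rw [norm_inv]
    exact inv_anti₀ hd (hle u hu)
  · refine (norm_inv_sub_inv_le hd (hle u hu) (hle u' hu')).trans_eq ?_
    rw [← ofReal_sub, Complex.norm_real, Real.norm_eq_abs, add_sub_add_left_eq_sub]

namespace SamplingData

variable {a b : ℝ} {ρ η : ℝ → ℝ} {s : (N : ℕ) → Fin N → ℝ} (h : SamplingData a b ρ η s)
include h

theorem sign (N : ℕ) :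
    (∀ l, 0 ≤ poleWeight (fun j => η (s N j) / N) (s N) l) ∨
      ∀ l, poleWeight (fun j => η (s N j) / N) (s N) l ≤ 0 :=
  poleWeight_sign (h.coeff_sign N)

theorem le_height (N : ℕ) (l : Fin N ⊕ Fin N) : 1 / b ≤ poleHeight (s N) l :=
  le_poleHeight (h.one_lt_point N) (fun j => (h.mem N j).2) l

theorem exists_solution (N : ℕ) : ∃ g : Fin N ⊕ Fin N → ℂ, ∀ k,
    g k = 1 + I * carlemanSum (poleWeight (fun j => η (s N j) / N) (s N)) (poleHeight (s N)) g
      (poleHeight (s N) k) :=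
  exists_system_solution (h.sign N) (one_div_pos.2 h.b_pos) (h.le_height N)

/-- The solution of the scalar system with `2N` unknowns. -/
noncomputable def sol (N : ℕ) : Fin N ⊕ Fin N → ℂ := (h.exists_solution N).choose

theorem sol_eq (N : ℕ) (k : Fin N ⊕ Fin N) :
    h.sol N k = 1 + I * carlemanSum (poleWeight (fun j => η (s N j) / N) (s N))
      (poleHeight (s N)) (h.sol N) (poleHeight (s N) k) :=
  (h.exists_solution N).choose_spec k

/-- The row function of the `N`-soliton problem. -/
noncomputable def row (N : ℕ) : ℂ → ℂ :=
  rowFun (poleWeight (fun j => η (s N j) / N) (s N)) (poleHeight (s N)) (h.sol N)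

theorem row_height (N : ℕ) (k : Fin N ⊕ Fin N) :
    h.row N (-(poleHeight (s N) k * I)) = h.sol N k := by
  rw [row, rowFun_neg_mul_I, ← h.sol_eq]

theorem row_eq (N : ℕ) (z : ℂ) :
    h.row N z = 1 + sampleFunctional η (s N) fun x => h.row N (-(x * I)) * (z - x * I)⁻¹ := by
  rw [sampleFunctional]
  simp only [h.row_height]
  rw [row, rowFun]
  congr 1
  exact Finset.sum_congr rfl fun l _ => by rw [div_eq_mul_inv, mul_assoc]

omit h in
theorem carlemanSum_eq (N : ℕ) (F : ℝ → ℂ) (x : ℝ) :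
    carlemanSum (poleWeight (fun j => η (s N j) / N) (s N)) (poleHeight (s N))
      (fun l => F (poleHeight (s N) l)) x
      = sampleFunctional η (s N) fun u => F u * ((x + u : ℝ) : ℂ)⁻¹ := by
  rw [sampleFunctional, carlemanSum]
  exact Finset.sum_congr rfl fun l _ => by rw [div_eq_mul_inv, mul_assoc]

theorem row_neg_mul_I (N : ℕ) (x : ℝ) :
    h.row N (-(x * I))
      = 1 + I * sampleFunctional η (s N) fun u => h.row N (-(u * I)) * ((x + u : ℝ) : ℂ)⁻¹ := by
  rw [← carlemanSum_eq N (fun u => h.row N (-(u * I))) x]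
  simp only [h.row_height]
  rw [row, rowFun_neg_mul_I]

theorem sum_norm_sol_le {V : ℝ}
    (hV : ∀ N, ∑ l, |poleWeight (fun j => η (s N j) / N) (s N) l| ≤ V) (N : ℕ) :
    ∑ l, |poleWeight (fun j => η (s N j) / N) (s N) l| * ‖h.sol N l‖ ≤ V := by
  have := sum_abs_mul_norm_le (h.sign N) (f := h.sol N) (φ := fun _ => 1) (h.sol_eq N) (B := 1)
    (by simp)
  rw [mul_one] at this
  exact this.trans (hV N)

theorem norm_row_le {V : ℝ}
    (hV : ∀ N, ∑ l, |poleWeight (fun j => η (s N j) / N) (s N) l| ≤ V) (N : ℕ) {x : ℝ}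
    (hx : 1 / b ≤ x) : ‖h.row N (-(x * I))‖ ≤ 1 + V / (2 * (1 / b)) := by
  have hd : 0 < 1 / b := one_div_pos.2 h.b_pos
  rw [row, rowFun_neg_mul_I]
  refine (norm_add_le _ _).trans ?_
  rw [norm_one, norm_mul, norm_I, one_mul]
  gcongr
  refine (norm_carlemanSum_le hd (h.le_height N) hx).trans ?_
  gcongr
  exact h.sum_norm_sol_le hV N

theorem norm_row_sub_row_le {V : ℝ}
    (hV : ∀ N, ∑ l, |poleWeight (fun j => η (s N j) / N) (s N) l| ≤ V) (N : ℕ) {x x' : ℝ}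
    (hx : 1 / b ≤ x) (hx' : 1 / b ≤ x') :
    ‖h.row N (-(x * I)) - h.row N (-(x' * I))‖ ≤ V * ((1 / b)⁻¹ * (1 / b)⁻¹) * |x - x'| := by
  have hd : 0 < 1 / b := one_div_pos.2 h.b_pos
  rw [row, rowFun_neg_mul_I, rowFun_neg_mul_I, add_sub_add_left_eq_sub, ← mul_sub, norm_mul,
    norm_I, one_mul, carlemanSum, carlemanSum, ← Finset.sum_sub_distrib]
  calc _ ≤ ∑ l, |poleWeight (fun j => η (s N j) / N) (s N) l| * ‖h.sol N l‖ *
        ((1 / b)⁻¹ * (1 / b)⁻¹ * |x - x'|) := by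
        refine norm_sum_le_of_le _ fun l _ => ?_
        have hle : ∀ u, 1 / b ≤ u → 1 / b ≤ ‖((u + poleHeight (s N) l : ℝ) : ℂ)‖ := fun u hu => by
          have := h.le_height N l
          rw [Complex.norm_real, Real.norm_of_nonneg (by linarith)]
          linarith
        rw [div_eq_mul_inv, div_eq_mul_inv, ← mul_sub, norm_mul, norm_mul, Complex.norm_real,
          Real.norm_eq_abs]
        gcongr
        refine (norm_inv_sub_inv_le hd (hle x hx) (hle x' hx')).trans_eq ?_
        rw [← ofReal_sub, Complex.norm_real, Real.norm_eq_abs, add_sub_add_right_eq_sub]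
    _ ≤ _ := by
        rw [← Finset.sum_mul, mul_assoc V]
        gcongr
        exact h.sum_norm_sol_le hV N

/-- The solutions of the scalar systems form a uniform Cauchy sequence. -/
theorem row_cauchy {ε : ℝ} (hε : 0 < ε) : ∃ N₀, ∀ N ≥ N₀, ∀ M ≥ N₀, ∀ x, 1 / b ≤ x →
    ‖h.row N (-(x * I)) - h.row M (-(x * I))‖ ≤ ε := by
  obtain ⟨V, hV0, hV⟩ := h.exists_total_weight
  have hd : 0 < 1 / b := one_div_pos.2 h.b_pos
  set B := 1 + V / (2 * (1 / b)) with hB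
  set L := V * ((1 / b)⁻¹ * (1 / b)⁻¹) with hL
  set ε' := ε / (2 + V / (1 / b)) with hε'
  have hε'0 : 0 < ε' := by positivity
  obtain ⟨N₀, hN₀⟩ := eventually_atTop.1 (h.eventually_sample_approx (B * (1 / b)⁻¹)
    (L * (1 / b)⁻¹ + B * ((1 / b)⁻¹ * (1 / b)⁻¹)) hε'0)
  refine ⟨N₀, fun N hN M hM x hx => ?_⟩
  have htame : ∀ u, 1 / b ≤ u → TameOn a b (B * (1 / b)⁻¹)
      (L * (1 / b)⁻¹ + B * ((1 / b)⁻¹ * (1 / b)⁻¹))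
      fun v => h.row M (-(v * I)) * ((u + v : ℝ) : ℂ)⁻¹ := fun u hu =>
    (TameOn.of_Icc h.one_lt (by positivity) (fun v hv => h.norm_row_le hV M hv)
      fun v v' hv hv' => h.norm_row_sub_row_le hV M hv hv').mul
      (tameOn_carlemanKernel h.one_lt h.b_pos hu)
  set ψ : ℝ → ℂ := fun u =>
    I * (sampleFunctional η (s N) (fun v => h.row M (-(v * I)) * ((u + v : ℝ) : ℂ)⁻¹) -
      sampleFunctional η (s M) (fun v => h.row M (-(v * I)) * ((u + v : ℝ) : ℂ)⁻¹)) with hψ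
  have hψle : ∀ u, 1 / b ≤ u → ‖ψ u‖ ≤ 2 * ε' := fun u hu => by
    have h1 := hN₀ N hN _ (htame u hu)
    have h2 := hN₀ M hM _ (htame u hu)
    rw [hψ, norm_mul, norm_I, one_mul]
    have h3 := norm_sub_le_norm_sub_add_norm_sub
      (sampleFunctional η (s N) fun v => h.row M (-(v * I)) * ((u + v : ℝ) : ℂ)⁻¹)
      (densityFunctional a b ρ η fun v => h.row M (-(v * I)) * ((u + v : ℝ) : ℂ)⁻¹)
      (sampleFunctional η (s M) fun v => h.row M (-(v * I)) * ((u + v : ℝ) : ℂ)⁻¹)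
    rw [norm_sub_rev (densityFunctional a b ρ η _)] at h3
    linarith
  set F : ℝ → ℂ := fun u => h.row N (-(u * I)) - h.row M (-(u * I)) with hF
  have hFeq : ∀ u, F u = ψ u + I * carlemanSum (poleWeight (fun j => η (s N j) / N) (s N))
      (poleHeight (s N)) (fun l => F (poleHeight (s N) l)) u := fun u => by
    rw [carlemanSum_eq]
    have e : (sampleFunctional η (s N) fun v => F v * ((u + v : ℝ) : ℂ)⁻¹)
        = (sampleFunctional η (s N) fun v => h.row N (-(v * I)) * ((u + v : ℝ) : ℂ)⁻¹)
          - sampleFunctional η (s N) fun v => h.row M (-(v * I)) * ((u + v : ℝ) : ℂ)⁻¹ := by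
      simp only [sampleFunctional, ← Finset.sum_sub_distrib]
      exact Finset.sum_congr rfl fun l _ => by ring
    rw [e]
    simp only [hF, hψ]
    rw [h.row_neg_mul_I N u, h.row_neg_mul_I M u]
    ring
  have hsum := sum_abs_mul_norm_le (h.sign N) (f := fun l => F (poleHeight (s N) l))
    (φ := fun l => ψ (poleHeight (s N) l)) (fun k => hFeq _) (B := 2 * ε')
    fun k => hψle _ (h.le_height N k)
  have hsum' : ∑ l, |poleWeight (fun j => η (s N j) / N) (s N) l| * ‖F (poleHeight (s N) l)‖
      ≤ V * (2 * ε') := hsum.trans (by gcongr; exact hV N)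
  have h2 := norm_carlemanSum_le (v := poleWeight (fun j => η (s N j) / N) (s N))
    (f := fun l => F (poleHeight (s N) l)) hd (h.le_height N) hx
  change ‖F x‖ ≤ ε
  rw [hFeq x]
  calc _ ≤ 2 * ε' + V * (2 * ε') / (2 * (1 / b)) := by
        refine (norm_add_le _ _).trans (add_le_add (hψle x hx) ?_)
        rw [norm_mul, norm_I, one_mul]
        refine h2.trans ?_
        gcongr
    _ = ε' * (2 + V / (1 / b)) := by
        field_simp
    _ = ε := by
        rw [hε', div_mul_cancel₀]
        positivity

/-- The limit of the row functions on the negative imaginary axis. -/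
noncomputable def limSol (x : ℝ) : ℂ := limUnder atTop fun N => h.row N (-(x * I))

theorem tendsto_limSol {x : ℝ} (hx : 1 / b ≤ x) :
    Tendsto (fun N => h.row N (-(x * I))) atTop (𝓝 (h.limSol x)) := by
  have hc : CauchySeq fun N => h.row N (-(x * I)) := by
    refine Metric.cauchySeq_iff.2 fun ε hε => ?_
    obtain ⟨N₀, hN₀⟩ := h.row_cauchy (half_pos hε)
    refine ⟨N₀, fun m hm n hn => ?_⟩
    rw [dist_eq_norm]
    exact (hN₀ m hm n hn x hx).trans_lt (half_lt_self hε)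
  exact hc.tendsto_limUnder

theorem eventually_row_sub_limSol_le {ε : ℝ} (hε : 0 < ε) :
    ∀ᶠ N in atTop, ∀ x, 1 / b ≤ x → ‖h.row N (-(x * I)) - h.limSol x‖ ≤ ε := by
  obtain ⟨N₀, hN₀⟩ := h.row_cauchy hε
  filter_upwards [eventually_ge_atTop N₀] with N hN x hx
  refine le_of_tendsto ((h.tendsto_limSol hx).const_sub _).norm ?_
  filter_upwards [eventually_ge_atTop N₀] with M hM
  exact hN₀ N hN M hM x hx

theorem exists_limSol_tame : ∃ B L, 0 ≤ B ∧ 0 ≤ L ∧ (∀ x, 1 / b ≤ x → ‖h.limSol x‖ ≤ B) ∧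
    ∀ x x', 1 / b ≤ x → 1 / b ≤ x' → ‖h.limSol x - h.limSol x'‖ ≤ L * |x - x'| := by
  obtain ⟨V, hV0, hV⟩ := h.exists_total_weight
  have hb := h.b_pos
  refine ⟨1 + V / (2 * (1 / b)), V * ((1 / b)⁻¹ * (1 / b)⁻¹), by positivity, by positivity,
    fun x hx => ?_, fun x x' hx hx' => ?_⟩
  · exact le_of_tendsto (h.tendsto_limSol hx).norm (.of_forall fun N => h.norm_row_le hV N hx)
  · exact le_of_tendsto ((h.tendsto_limSol hx).sub (h.tendsto_limSol hx')).norm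
      (.of_forall fun N => h.norm_row_sub_row_le hV N hx hx')

/-- Convergence of the sums weighted with the solutions. -/
theorem eventually_weighted_approx (B K : ℝ) {ε : ℝ} (hε : 0 < ε) :
    ∀ᶠ N in atTop, ∀ φ, TameOn a b B K φ →
      ‖sampleFunctional η (s N) (fun x => h.row N (-(x * I)) * φ x) -
        densityFunctional a b ρ η fun x => h.limSol x * φ x‖ ≤ ε := by
  obtain ⟨V, hV0, hV⟩ := h.exists_total_weight
  obtain ⟨B', L', hB', hL', hbd, hlip⟩ := h.exists_limSol_tame
  have hε' : 0 < ε / (2 * (V * |B| + 1)) := by positivity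
  filter_upwards [h.eventually_row_sub_limSol_le hε', h.eventually_sample_approx (B' * B)
    (L' * B + B' * K) (half_pos hε)] with N h1 h2 φ hφ
  have e3 := h2 _ ((TameOn.of_Icc h.one_lt hL' hbd hlip).mul hφ)
  have e4 : ‖sampleFunctional η (s N) fun x => (h.row N (-(x * I)) - h.limSol x) * φ x‖
      ≤ V * (ε / (2 * (V * |B| + 1)) * |B|) := by
    refine norm_sampleFunctional_le hV (by positivity) fun l => ?_
    refine norm_mul_le_mul (h1 _ (h.le_height N l)) ?_
    rcases l with j | j
    · exact (hφ.bound _ (h.mem N j)).trans (le_abs_self B)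
    · exact (hφ.bound_inv _ (h.mem N j)).trans (le_abs_self B)
  have e5 : V * (ε / (2 * (V * |B| + 1)) * |B|) ≤ ε / 2 := by
    have : V * (ε / (2 * (V * |B| + 1)) * |B|) = (V * |B|) / (V * |B| + 1) * (ε / 2) := by
      field_simp
    rw [this]
    refine mul_le_of_le_one_left (by positivity) ?_
    rw [div_le_one (by positivity)]
    linarith
  have e6 : sampleFunctional η (s N) (fun x => h.row N (-(x * I)) * φ x) -
        densityFunctional a b ρ η (fun x => h.limSol x * φ x)
      = (sampleFunctional η (s N) fun x => (h.row N (-(x * I)) - h.limSol x) * φ x) +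
        (sampleFunctional η (s N) (fun x => h.limSol x * φ x) -
          densityFunctional a b ρ η fun x => h.limSol x * φ x) := by
    have : (sampleFunctional η (s N) fun x => (h.row N (-(x * I)) - h.limSol x) * φ x)
        = sampleFunctional η (s N) (fun x => h.row N (-(x * I)) * φ x) -
          sampleFunctional η (s N) (fun x => h.limSol x * φ x) := by
      simp only [sampleFunctional, ← Finset.sum_sub_distrib]
      exact Finset.sum_congr rfl fun l _ => by ring
    rw [this]
    ring
  rw [e6]
  linarith [norm_add_le (sampleFunctional η (s N) fun x => (h.row N (-(x * I)) - h.limSol x) * φ x)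
    (sampleFunctional η (s N) (fun x => h.limSol x * φ x) -
          densityFunctional a b ρ η fun x => h.limSol x * φ x)]

/-- The limiting row function. -/
noncomputable def limRow (z : ℂ) : ℂ :=
  1 + densityFunctional a b ρ η fun x => h.limSol x * (z - x * I)⁻¹

theorem eventually_row_sub_limRow_le {d ε : ℝ} (hd : 0 < d) (hε : 0 < ε) :
    ∀ᶠ N in atTop, ∀ z : ℂ,
      (∀ x ∈ Icc a b, d ≤ ‖z - x * I‖ ∧ d ≤ ‖z - (1 / x : ℝ) * I‖) →
      ‖h.row N z - h.limRow z‖ ≤ ε := by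
  filter_upwards [h.eventually_weighted_approx d⁻¹ (d⁻¹ * d⁻¹) hε] with N hN z hz
  rw [h.row_eq, limRow, add_sub_add_left_eq_sub]
  exact hN _ (tameOn_cauchyKernel h.one_lt hd hz)

theorem limRow_neg_mul_I {x : ℝ} (hx : 1 / b ≤ x) : h.limRow (-(x * I)) = h.limSol x := by
  have hb := h.b_pos
  have hd : 0 < 1 / b := one_div_pos.2 hb
  have hdist : ∀ u : ℝ, 1 / b ≤ u → 1 / b ≤ ‖(-(x * I) - u * I : ℂ)‖ := fun u hu => by
    have : (-(x * I) - u * I : ℂ) = ((-(x + u) : ℝ) : ℂ) * I := by push_cast; ring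
    rw [this, norm_mul, norm_I, mul_one, Complex.norm_real, norm_neg,
      Real.norm_of_nonneg (by linarith)]
    linarith
  have hz : ∀ u ∈ Icc a b, 1 / b ≤ ‖(-(x * I) - u * I : ℂ)‖ ∧
      1 / b ≤ ‖(-(x * I) - (1 / u : ℝ) * I : ℂ)‖ := fun u hu => by
    refine ⟨hdist u ?_, hdist _ (one_div_le_one_div_of_le (by linarith [hu.1, h.one_lt]) hu.2)⟩
    have : 1 / b ≤ 1 := by
      rw [div_le_one hb]
      linarith [h.one_lt, h.lt]
    linarith [hu.1, h.one_lt]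
  refine tendsto_nhds_unique (f := fun N => h.row N (-(x * I))) (l := atTop) ?_
    (h.tendsto_limSol hx)
  refine Metric.tendsto_nhds.2 fun ε hε => ?_
  filter_upwards [h.eventually_row_sub_limRow_le hd (half_pos hε)] with N hN
  rw [dist_eq_norm]
  exact (hN _ hz).trans_lt (half_lt_self hε)

end SamplingData

/-! ### The limiting row function -/

theorem cseg_eq_image (p q : ℝ) : cseg p q = (fun x : ℝ => (x : ℂ) * I) '' Icc p q := by
  ext z
  constructor
  · rintro ⟨h1, h2⟩
    exact ⟨z.im, h2, (eq_im_mul_I h1).symm⟩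
  · rintro ⟨x, hx, rfl⟩
    exact mul_I_mem_cseg.2 hx

theorem isCompact_cseg (p q : ℝ) : IsCompact (cseg p q) := by
  rw [cseg_eq_image]
  exact isCompact_Icc.image (by fun_prop)

/-- The two closed segments in the upper half-plane. -/
def upperContour (a b : ℝ) : Set ℂ := cseg a b ∪ cseg (1 / b) (1 / a)

theorem isCompact_upperContour (a b : ℝ) : IsCompact (upperContour a b) :=
  (isCompact_cseg _ _).union (isCompact_cseg _ _)

theorem isOpen_compl_upperContour (a b : ℝ) : IsOpen (upperContour a b)ᶜ :=
  (isCompact_upperContour a b).isClosed.isOpen_compl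

theorem mul_I_mem_upperContour {a b x : ℝ} (hx : x ∈ Icc a b) : (x : ℂ) * I ∈ upperContour a b :=
  Or.inl (mul_I_mem_cseg.2 hx)

theorem one_div_mem_Icc {a b x : ℝ} (ha : 0 < a) (hx : x ∈ Icc a b) :
    1 / x ∈ Icc (1 / b) (1 / a) :=
  ⟨one_div_le_one_div_of_le (ha.trans_le hx.1) hx.2, one_div_le_one_div_of_le ha hx.1⟩

theorem one_div_mul_I_mem_upperContour {a b x : ℝ} (ha : 0 < a) (hx : x ∈ Icc a b) :
    ((1 / x : ℝ) : ℂ) * I ∈ upperContour a b :=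
  Or.inr (mul_I_mem_cseg.2 (one_div_mem_Icc ha hx))

theorem im_pos_of_mem_upperContour {a b : ℝ} (ha : 0 < a) (hab : a ≤ b) {z : ℂ}
    (hz : z ∈ upperContour a b) : 0 < z.im := by
  rcases hz with hz | hz
  · exact ha.trans_le hz.2.1
  · exact (one_div_pos.2 (ha.trans_le hab)).trans_le hz.2.1

theorem notMem_upperContour_of_im_nonpos {a b : ℝ} (ha : 0 < a) (hab : a ≤ b) {z : ℂ}
    (hz : z.im ≤ 0) : z ∉ upperContour a b := fun h =>
  absurd (im_pos_of_mem_upperContour ha hab h) hz.not_gt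

theorem I_notMem_upperContour {a b : ℝ} (ha : 1 < a) : I ∉ upperContour a b := by
  rintro (h | h)
  · have := h.2.1
    rw [I_im] at this
    linarith
  · have := h.2.2
    rw [I_im, le_div_iff₀ (by linarith)] at this
    linarith

theorem neg_one_div_mem_upperContour {a b : ℝ} (ha : 0 < a) (hb : 0 < b) {z : ℂ}
    (hz : z ∈ upperContour a b) : -(1 / z) ∈ upperContour a b := by
  rcases hz with hz | hz
  · rw [eq_im_mul_I hz.1, neg_one_div_mul_I]
    exact one_div_mul_I_mem_upperContour ha hz.2
  · rw [eq_im_mul_I hz.1, neg_one_div_mul_I]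
    refine mul_I_mem_upperContour ?_
    have h1 := one_div_le_one_div_of_le (one_div_pos.2 hb) hz.2.1
    have h2 := one_div_le_one_div_of_le ((one_div_pos.2 hb).trans_le hz.2.1) hz.2.2
    rw [one_div_one_div] at h1 h2
    exact ⟨h2, h1⟩

theorem neg_star_mem_upperContour {a b : ℝ} {z : ℂ} :
    -star z ∈ upperContour a b ↔ z ∈ upperContour a b := by
  simp [upperContour, cseg]

/-- Points off the segments have a neighbourhood at positive distance from them. -/
theorem exists_dist_upperContour {a b : ℝ} (ha : 0 < a) (hab : a ≤ b) {z₀ : ℂ}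
    (hz : z₀ ∉ upperContour a b) : ∃ d, 0 < d ∧ ∀ᶠ z in 𝓝 z₀, ∀ x ∈ Icc a b,
      d ≤ ‖z - x * I‖ ∧ d ≤ ‖z - (1 / x : ℝ) * I‖ := by
  have hne : (upperContour a b).Nonempty := ⟨_, mul_I_mem_upperContour (left_mem_Icc.2 hab)⟩
  have hpos := ((isCompact_upperContour a b).isClosed.notMem_iff_infDist_pos hne).1 hz
  refine ⟨Metric.infDist z₀ (upperContour a b) / 2, half_pos hpos, ?_⟩
  have hc : ContinuousAt (fun z => Metric.infDist z (upperContour a b)) z₀ :=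
    (Metric.continuous_infDist_pt _).continuousAt
  filter_upwards [hc.eventually_const_le (half_lt_self hpos)] with z h x hx
  have key : ∀ w ∈ upperContour a b, Metric.infDist z₀ (upperContour a b) / 2 ≤ ‖z - w‖ :=
    fun w hw => h.trans ((Metric.infDist_le_dist_of_mem hw).trans_eq (dist_eq_norm _ _))
  exact ⟨key _ (mul_I_mem_upperContour hx), key _ (one_div_mul_I_mem_upperContour ha hx)⟩

namespace SamplingData

variable {a b : ℝ} {ρ η : ℝ → ℝ} {s : (N : ℕ) → Fin N → ℝ} (h : SamplingData a b ρ η s)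
include h

theorem a_pos : 0 < a := by linarith [h.one_lt]

theorem poleHeight_mem (N : ℕ) (l : Fin N ⊕ Fin N) :
    (poleHeight (s N) l : ℂ) * I ∈ upperContour a b := by
  rcases l with j | j
  · exact mul_I_mem_upperContour (h.mem N j)
  · exact one_div_mul_I_mem_upperContour h.a_pos (h.mem N j)

theorem differentiableAt_row (N : ℕ) {z : ℂ} (hz : z ∉ upperContour a b) :
    DifferentiableAt ℂ (h.row N) z :=
  differentiableAt_rowFun _ fun l hl => hz (hl ▸ h.poleHeight_mem N l)

theorem tendstoLocallyUniformlyOn_row :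
    TendstoLocallyUniformlyOn h.row h.limRow atTop (upperContour a b)ᶜ := by
  rw [Metric.tendstoLocallyUniformlyOn_iff]
  intro ε hε z₀ hz₀
  obtain ⟨d, hd, hev⟩ := exists_dist_upperContour h.a_pos h.lt.le hz₀
  refine ⟨_, mem_nhdsWithin_of_mem_nhds hev, ?_⟩
  filter_upwards [h.eventually_row_sub_limRow_le hd (half_pos hε)] with N hN z hz
  rw [dist_comm, dist_eq_norm]
  exact (hN z hz).trans_lt (half_lt_self hε)

theorem tendsto_row {z : ℂ} (hz : z ∉ upperContour a b) :
    Tendsto (fun N => h.row N z) atTop (𝓝 (h.limRow z)) :=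
  h.tendstoLocallyUniformlyOn_row.tendsto_at hz

theorem differentiableOn_limRow : DifferentiableOn ℂ h.limRow (upperContour a b)ᶜ :=
  h.tendstoLocallyUniformlyOn_row.differentiableOn
    (.of_forall fun N _ hz => (h.differentiableAt_row N hz).differentiableWithinAt)
    (isOpen_compl_upperContour a b)

theorem differentiableAt_limRow {z : ℂ} (hz : z ∉ upperContour a b) :
    DifferentiableAt ℂ h.limRow z :=
  h.differentiableOn_limRow.differentiableAt ((isOpen_compl_upperContour a b).mem_nhds hz)

theorem tendsto_deriv_row {z : ℂ} (hz : z ∉ upperContour a b) :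
    Tendsto (fun N => deriv (h.row N) z) atTop (𝓝 (deriv h.limRow z)) :=
  (h.tendstoLocallyUniformlyOn_row.deriv
    (.of_forall fun N _ hz => (h.differentiableAt_row N hz).differentiableWithinAt)
    (isOpen_compl_upperContour a b)).tendsto_at hz

theorem rowSymmetric_row (N : ℕ) : RowSymmetric (h.row N) :=
  (rowSymmetric_soliton (h.one_lt_point N) (fun j => (h.mem N j).2) h.b_pos (h.coeff_sign N)
    (h.sol_eq N)).1

theorem reflConj_row (N : ℕ) {z : ℂ} (hz0 : z ≠ 0) (hz : z ∉ upperContour a b) :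
    reflConj (h.row N) z = reflConj (h.row N) 0 * h.row N (-(1 / z)) :=
  (rowSymmetric_soliton (h.one_lt_point N) (fun j => (h.mem N j).2) h.b_pos (h.coeff_sign N)
    (h.sol_eq N)).2 z hz0 fun l hl => hz (hl ▸ h.poleHeight_mem N l)

theorem neg_one_div_mem {z : ℂ} : -(1 / z) ∈ upperContour a b ↔ z ∈ upperContour a b := by
  refine ⟨fun hz => ?_, neg_one_div_mem_upperContour h.a_pos h.b_pos⟩
  have := neg_one_div_mem_upperContour h.a_pos h.b_pos hz
  simpa using this

theorem zero_notMem : (0 : ℂ) ∉ upperContour a b :=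
  notMem_upperContour_of_im_nonpos h.a_pos h.lt.le (by simp)

theorem tendsto_reflConj_row {z : ℂ} (hz : z ∉ upperContour a b) :
    Tendsto (fun N => reflConj (h.row N) z) atTop (𝓝 (reflConj h.limRow z)) :=
  (continuous_star.tendsto _).comp (h.tendsto_row fun hz' => hz (neg_star_mem_upperContour.1 hz'))

/-- The inversion symmetry. -/
theorem reflConj_limRow {z : ℂ} (hz0 : z ≠ 0) (hz : z ∉ upperContour a b) :
    reflConj h.limRow z = reflConj h.limRow 0 * h.limRow (-(1 / z)) := by
  refine tendsto_nhds_unique (h.tendsto_reflConj_row hz) ?_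
  simp only [h.reflConj_row _ hz0 hz]
  exact (h.tendsto_reflConj_row h.zero_notMem).mul
    (h.tendsto_row fun hz' => hz (h.neg_one_div_mem.1 hz'))

theorem I_notMem : I ∉ upperContour a b := I_notMem_upperContour h.one_lt

theorem neg_I_notMem : -I ∉ upperContour a b :=
  notMem_upperContour_of_im_nonpos h.a_pos h.lt.le (by simp)

theorem rowSymmetric_limRow : RowSymmetric h.limRow := by
  have hI := (isOpen_compl_upperContour a b).mem_nhds h.I_notMem
  have hI' := (isOpen_compl_upperContour a b).mem_nhds h.neg_I_notMem
  refine ⟨?_, ?_, ⟨reflConj h.limRow 0, ?_, ?_⟩, ?_⟩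
  · filter_upwards [hI] with z hz using h.differentiableAt_limRow hz
  · filter_upwards [hI'] with z hz using h.differentiableAt_limRow hz
  · filter_upwards [hI, eventually_ne_nhds I_ne_zero] with z hz hz0 using h.reflConj_limRow hz0 hz
  · filter_upwards [hI', eventually_ne_nhds (neg_ne_zero.2 I_ne_zero)] with z hz hz0 using
      h.reflConj_limRow hz0 hz
  · refine tendsto_nhds_unique (((h.tendsto_row h.I_notMem).mul
      (h.tendsto_reflConj_row h.neg_I_notMem)).add ((h.tendsto_reflConj_row h.I_notMem).mul
      (h.tendsto_row h.neg_I_notMem))) ?_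
    simp only [(h.rowSymmetric_row _).det]
    exact tendsto_const_nhds

theorem limRow_isBigO : (fun z => h.limRow z - 1) =O[Bornology.cobounded ℂ] fun z => 1 / z := by
  obtain ⟨V, hV0, hV⟩ := h.exists_total_weight
  have hb := h.b_pos
  set B := 1 + V / (2 * (1 / b)) with hB
  have hB0 : 0 ≤ B := by positivity
  refine Asymptotics.IsBigO.of_bound (V * (B * 2)) ?_
  have hev : ∀ᶠ z : ℂ in Bornology.cobounded ℂ, 2 * b ≤ ‖z‖ :=
    tendsto_norm_cobounded_atTop.eventually_ge_atTop _
  have ha1 : 1 / a ≤ b := by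
    rw [div_le_iff₀ h.a_pos]
    nlinarith [h.one_lt, h.lt]
  have hle : ∀ w ∈ upperContour a b, ‖w‖ ≤ b := by
    rintro w (hw | hw)
    · rw [eq_im_mul_I hw.1, norm_mul, norm_I, mul_one, Complex.norm_real,
        Real.norm_of_nonneg (h.a_pos.le.trans hw.2.1)]
      exact hw.2.2
    · rw [eq_im_mul_I hw.1, norm_mul, norm_I, mul_one, Complex.norm_real,
        Real.norm_of_nonneg ((one_div_pos.2 hb).le.trans hw.2.1)]
      exact hw.2.2.trans ha1
  filter_upwards [hev] with z hz
  have hz' : z ∉ upperContour a b := fun hz' => by linarith [hle z hz']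
  refine le_of_tendsto ((h.tendsto_row hz').sub_const 1).norm (.of_forall fun N => ?_)
  rw [h.row_eq, add_sub_cancel_left, norm_div, norm_one, mul_assoc V]
  refine norm_sampleFunctional_le hV (by positivity) fun l => ?_
  rw [mul_assoc B]
  refine norm_mul_le_mul (h.norm_row_le hV N (h.le_height N l)) ?_
  have h1 : ‖z‖ / 2 ≤ ‖z - poleHeight (s N) l * I‖ := by
    have := norm_sub_norm_le z (poleHeight (s N) l * I)
    have := hle _ (h.poleHeight_mem N l)
    linarith
  have h2 : 0 < ‖z‖ / 2 := by linarith
  rw [norm_inv]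
  refine (inv_anti₀ h2 h1).trans_eq ?_
  rw [inv_div]
  ring

theorem normalizedAtInfinity_limRow : NormalizedAtInfinity (symMatrix h.limRow) :=
  normalizedAtInfinity_symMatrix h.limRow_isBigO

theorem tendsto_x (y : ℝ) : Tendsto (fun N => y - Real.log (h.row N (-I) / h.row N I).re) atTop
    (𝓝 (y - Real.log (h.limRow (-I) / h.limRow I).re)) := by
  have h1 := (h.tendsto_row h.neg_I_notMem).div (h.tendsto_row h.I_notMem)
    h.rowSymmetric_limRow.ne_zero
  have h2 := (continuous_re.tendsto _).comp h1
  refine (h2.log ?_).const_sub y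
  have := h.rowSymmetric_limRow.ratio_eq
  simp only [this, ofReal_re]
  have := h.rowSymmetric_limRow.ne_zero
  positivity

theorem tendsto_u : Tendsto (fun N => (deriv (h.row N) (-I) / h.row N (-I) -
      deriv (h.row N) I / h.row N I).re) atTop
    (𝓝 (deriv h.limRow (-I) / h.limRow (-I) - deriv h.limRow I / h.limRow I).re) :=
  (continuous_re.tendsto _).comp
    (((h.tendsto_deriv_row h.neg_I_notMem).div (h.tendsto_row h.neg_I_notMem)
      h.rowSymmetric_limRow.ne_zero').sub
    ((h.tendsto_deriv_row h.I_notMem).div (h.tendsto_row h.I_notMem)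
      h.rowSymmetric_limRow.ne_zero))

end SamplingData

/-! ### Boundary values of Cauchy integrals -/

theorem intervalIntegrable_abs_rpow {α : ℝ} (hα : 0 < α) (p q : ℝ) :
    IntervalIntegrable (fun x : ℝ => |x| ^ (α - 1)) volume p q := by
  refine intervalIntegrable_of_even (fun x => by rw [abs_neg]) ?_
  intro x hx
  refine (intervalIntegral.intervalIntegrable_rpow' (r := α - 1) (by linarith)).congr ?_
  intro u hu
  rw [uIoc_of_le hx.le] at hu
  simp only [abs_of_pos hu.1]

/-- The regularized Cauchy integral is continuous up to the line of integration. -/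
theorem exists_tendsto_regularized {f : ℝ → ℂ} (hf : Continuous f) {p q σ : ℝ} (hσ : σ ∈ Ioo p q)
    {C α δ : ℝ} (hα : 0 < α) (hC : 0 ≤ C) (hδ : 0 < δ)
    (hH : ∀ τ τ', |τ - σ| ≤ 2 * δ → |τ' - σ| ≤ 2 * δ →
      ‖f τ - f τ'‖ ≤ C * (|τ - τ'| ^ α + |τ - τ'|)) :
    ∃ L, Tendsto (fun z : ℂ => ∫ τ in p..q, (f τ - f z.im) / (z - τ * I)) (𝓝 (σ * I)) (𝓝 L) := by
  have hpq : p ≤ q := (hσ.1.trans hσ.2).le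
  obtain ⟨B, hB⟩ := isCompact_Icc.exists_bound_of_continuousOn (hf.continuousOn (s := Icc p q))
  have hB0 : 0 ≤ B := (norm_nonneg _).trans (hB p (left_mem_Icc.2 hpq))
  set F : ℂ → ℝ → ℂ := fun z u =>
    (Ioc p q).indicator (fun τ => (f τ - f z.im) / (z - τ * I)) (z.im + u) with hF
  set bound : ℝ → ℝ := (Icc (p - q) (q - p)).indicator
    fun u => C * (|u| ^ (α - 1) + 1) + 2 * B / δ with hbound
  refine ⟨∫ u, F (σ * I) u, ?_⟩
  have hshift : ∀ z : ℂ, ∫ τ in p..q, (f τ - f z.im) / (z - τ * I) = ∫ u, F z u := fun z => by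
    rw [intervalIntegral.integral_of_le hpq, ← integral_indicator measurableSet_Ioc]
    exact (integral_add_left_eq_self _ z.im).symm
  simp only [hshift]
  have him : Tendsto (fun z : ℂ => z.im) (𝓝 (σ * I)) (𝓝 σ) := by
    have := continuous_im.tendsto (σ * I : ℂ)
    simpa using this
  have hnear : ∀ᶠ z : ℂ in 𝓝 (σ * I), z.im ∈ Ioo p q ∧ |z.im - σ| < δ := by
    refine him.eventually (p := fun v => v ∈ Ioo p q ∧ |v - σ| < δ) ?_
    filter_upwards [Ioo_mem_nhds hσ.1 hσ.2, Metric.ball_mem_nhds σ hδ] with v h1 h2 using ⟨h1, h2⟩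
  refine tendsto_integral_filter_of_dominated_convergence bound ?_ ?_ ?_ ?_
  · refine .of_forall fun z => ?_
    have : Measurable ((Ioc p q).indicator fun τ : ℝ => (f τ - f z.im) / (z - τ * I)) := by
      refine Measurable.indicator ?_ measurableSet_Ioc
      exact (hf.measurable.sub_const _).div (by fun_prop)
    exact (this.comp (measurable_const_add z.im)).aestronglyMeasurable
  · filter_upwards [hnear] with z ⟨hz, hzσ⟩
    refine .of_forall fun u => ?_
    by_cases hu : z.im + u ∈ Ioc p q
    · have hu' : u ∈ Icc (p - q) (q - p) :=
        ⟨by linarith [hu.1, hz.2], by linarith [hu.2, hz.1]⟩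
      simp only [hF, hbound, indicator_of_mem hu, indicator_of_mem hu']
      have hden : |u| ≤ ‖(z - (z.im + u : ℝ) * I : ℂ)‖ := by
        have := Complex.abs_im_le_norm (z - (z.im + u : ℝ) * I : ℂ)
        simpa using this
      rcases eq_or_ne u 0 with rfl | hu0
      · simp only [add_zero, sub_self, zero_div, norm_zero]
        positivity
      have hu1 : 0 < |u| := abs_pos.2 hu0
      rw [norm_div]
      rcases le_or_gt |u| δ with hle | hgt
      · have h1 := hH (z.im + u) z.im (by
          have := abs_add_le (z.im - σ) u
          rw [show z.im + u - σ = z.im - σ + u by ring]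
          linarith) (by linarith)
        rw [add_sub_cancel_left] at h1
        have h2 : ‖f (z.im + u) - f z.im‖ / ‖(z - (z.im + u : ℝ) * I : ℂ)‖
            ≤ C * (|u| ^ α + |u|) / |u| := by gcongr
        refine h2.trans ?_
        have h3 : C * (|u| ^ α + |u|) / |u| = C * (|u| ^ (α - 1) + 1) := by
          rw [Real.rpow_sub_one hu1.ne', mul_div_assoc, add_div, div_self hu1.ne']
        rw [h3]
        have : 0 ≤ 2 * B / δ := by positivity
        linarith
      · have h1 : ‖f (z.im + u) - f z.im‖ ≤ 2 * B := by
          have := norm_sub_le (f (z.im + u)) (f z.im)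
          linarith [hB _ (Ioc_subset_Icc_self hu), hB _ (Ioo_subset_Icc_self hz)]
        have h2 : ‖f (z.im + u) - f z.im‖ / ‖(z - (z.im + u : ℝ) * I : ℂ)‖ ≤ 2 * B / δ := by
          gcongr
          exact hgt.le.trans hden
        have : 0 ≤ C * (|u| ^ (α - 1) + 1) := by positivity
        linarith
    · simp only [hF, indicator_of_notMem hu, norm_zero]
      exact indicator_nonneg (fun u _ => by positivity) u
  · rw [hbound, integrable_indicator_iff measurableSet_Icc]
    have : IntervalIntegrable (fun u : ℝ => C * (|u| ^ (α - 1) + 1) + 2 * B / δ) volume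
        (p - q) (q - p) :=
      (((intervalIntegrable_abs_rpow hα _ _).add intervalIntegrable_const).const_mul C).add
        intervalIntegrable_const
    exact (intervalIntegrable_iff_integrableOn_Icc_of_le (by linarith)).1 this
  · have h0 : ∀ᵐ u : ℝ, u ≠ 0 ∧ σ + u ≠ p ∧ σ + u ≠ q := by
      have e : ∀ v : ℝ, ∀ᵐ u : ℝ, u ≠ v := fun v => by
        simp [ae_iff]
      filter_upwards [e 0, e (p - σ), e (q - σ)] with u h1 h2 h3
      exact ⟨h1, fun h => h2 (by linarith), fun h => h3 (by linarith)⟩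
    filter_upwards [h0] with u ⟨hu0, hup, huq⟩
    have hadd : Tendsto (fun z : ℂ => z.im + u) (𝓝 (σ * I)) (𝓝 (σ + u)) := him.add_const u
    have hval : (σ * I : ℂ).im = σ := by simp
    by_cases hmem : σ + u ∈ Ioo p q
    · have hev : ∀ᶠ z : ℂ in 𝓝 (σ * I), z.im + u ∈ Ioc p q :=
        (hadd.eventually (Ioo_mem_nhds hmem.1 hmem.2)).mono fun z hz => Ioo_subset_Ioc_self hz
      have e1 : F (σ * I) u = (f (σ + u) - f σ) / (σ * I - (σ + u : ℝ) * I) := by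
        simp only [hF, hval]
        rw [indicator_of_mem (Ioo_subset_Ioc_self hmem)]
      rw [e1]
      refine Tendsto.congr' (f₁ := fun z : ℂ =>
        (f (z.im + u) - f z.im) / (z - (z.im + u : ℝ) * I)) ?_ ?_
      · filter_upwards [hev] with z hz
        simp only [hF, indicator_of_mem hz]
      · refine Tendsto.div (((hf.tendsto _).comp hadd).sub ((hf.tendsto _).comp him)) ?_ ?_
        · exact tendsto_id.sub (((continuous_ofReal.tendsto _).comp hadd).mul_const I)
        · rw [← sub_mul]
          refine mul_ne_zero ?_ I_ne_zero
          rw [← ofReal_sub]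
          exact_mod_cast (by simpa using hu0)
    · have hev : ∀ᶠ z : ℂ in 𝓝 (σ * I), z.im + u ∉ Ioc p q := by
        have : σ + u ∈ (Icc p q)ᶜ := fun h =>
          hmem ⟨lt_of_le_of_ne h.1 hup.symm, lt_of_le_of_ne h.2 huq⟩
        exact (hadd.eventually (isClosed_Icc.isOpen_compl.mem_nhds this)).mono
          fun z hz h => hz (Ioc_subset_Icc_self h)
      have e1 : F (σ * I) u = 0 := by
        simp only [hF, hval]
        exact indicator_of_notMem (fun h => hmem ⟨h.1, lt_of_le_of_ne h.2 huq⟩) _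
      rw [e1]
      refine tendsto_const_nhds.congr' ?_
      filter_upwards [hev] with z hz
      simp only [hF, indicator_of_notMem hz]

theorem mem_slitPlane_of_mul_I {x : ℝ} (hx : x ≠ 0) : (x : ℂ) * I ∈ slitPlane :=
  Or.inr (by simpa using hx)

/-- Boundary values of the Cauchy integral of a constant. -/
theorem exists_tendsto_const_cauchy {p q σ : ℝ} (hσ : σ ∈ Ioo p q) : ∃ L : ℂ,
    Tendsto (fun z : ℂ => ∫ τ in p..q, 1 / (z - τ * I)) (𝓝[{w | w.re < 0}] (σ * I))
      (𝓝 (L - Real.pi)) ∧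
    Tendsto (fun z : ℂ => ∫ τ in p..q, 1 / (z - τ * I)) (𝓝[{w | 0 < w.re}] (σ * I))
      (𝓝 (L + Real.pi)) := by
  have hq : 0 < q - σ := sub_pos.2 hσ.2
  have hp : 0 < σ - p := sub_pos.2 hσ.1
  have hlogp : ∀ x : ℝ, 0 < x → log (x * I) = Real.log x + Real.pi / 2 * I := fun x hx => by
    rw [log_ofReal_mul hx I_ne_zero, log_I]
  have hlogm : ∀ x : ℝ, 0 < x → log ((-x : ℝ) * I) = Real.log x - Real.pi / 2 * I := fun x hx => by
    have : ((-x : ℝ) : ℂ) * I = x * (-I) := by push_cast; ring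
    rw [this, log_ofReal_mul hx (neg_ne_zero.2 I_ne_zero), log_neg_I]
    ring
  have hderiv : ∀ (z : ℂ) (τ : ℝ), HasDerivAt (fun τ : ℝ => z - τ * I) (-I) τ := fun z τ => by
    have := ((hasDerivAt_id τ).ofReal_comp.mul_const I).const_sub z
    simpa using! this
  have hint : ∀ z : ℂ, z.re ≠ 0 → IntervalIntegrable (fun τ : ℝ => 1 / (z - τ * I)) volume p q :=
    fun z hz => by
      refine Continuous.intervalIntegrable ?_ _ _
      refine continuous_const.div (by fun_prop) fun τ h => hz ?_
      simpa using congrArg Complex.re h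
  refine ⟨I * (Real.log (q - σ) - Real.log (σ - p)), ?_, ?_⟩
  · have e : ∀ z : ℂ, z.re < 0 → ∫ τ in p..q, 1 / (z - τ * I)
        = I * log (-(z - q * I)) - I * log (-(z - p * I)) := fun z hz => by
      refine intervalIntegral.integral_eq_sub_of_hasDerivAt
        (f := fun τ : ℝ => I * log (-(z - τ * I))) (fun τ _ => ?_) (hint z hz.ne)
      have hs : -(z - τ * I) ∈ slitPlane := Or.inl (by simpa using hz)
      have := (((hderiv z τ).neg.clog_real hs).const_mul I)
      convert! this using 1
      change 1 / (z - τ * I) = I * (- -I / -(z - τ * I))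
      rw [neg_neg, mul_div_assoc', I_mul_I, neg_div_neg_eq]
    have hl : ∀ x : ℝ, σ ≠ x → Tendsto (fun z : ℂ => log (-(z - x * I)))
        (𝓝[{w | w.re < 0}] (σ * I)) (𝓝 (log ((x - σ : ℝ) * I))) := fun x hx => by
      have hc : ContinuousAt (fun z : ℂ => log (-(z - x * I))) (σ * I) := by
        refine ContinuousAt.clog (by fun_prop) ?_
        rw [show -(σ * I - x * I : ℂ) = (x - σ : ℝ) * I by push_cast; ring]
        exact mem_slitPlane_of_mul_I (sub_ne_zero.2 hx.symm)
      have := hc.tendsto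
      rw [show -(σ * I - x * I : ℂ) = (x - σ : ℝ) * I by push_cast; ring] at this
      exact this.mono_left nhdsWithin_le_nhds
    have := ((hl q hσ.2.ne).const_mul I).sub ((hl p hσ.1.ne').const_mul I)
    rw [hlogp _ hq, show p - σ = -(σ - p) by ring, hlogm _ hp] at this
    have e2 : I * (Real.log (q - σ) - Real.log (σ - p) : ℂ) - Real.pi
        = I * (Real.log (q - σ) + Real.pi / 2 * I) - I * (Real.log (σ - p) - Real.pi / 2 * I) := by
      linear_combination (-Real.pi : ℂ) * I_mul_I
    rw [e2]
    refine this.congr' ?_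
    filter_upwards [self_mem_nhdsWithin] with z hz using (e z hz).symm
  · have e : ∀ z : ℂ, 0 < z.re → ∫ τ in p..q, 1 / (z - τ * I)
        = I * log (z - q * I) - I * log (z - p * I) := fun z hz => by
      refine intervalIntegral.integral_eq_sub_of_hasDerivAt
        (f := fun τ : ℝ => I * log (z - τ * I)) (fun τ _ => ?_) (hint z hz.ne')
      have hs : z - τ * I ∈ slitPlane := Or.inl (by simpa using hz)
      have := (((hderiv z τ).clog_real hs).const_mul I)
      convert! this using 1
      rw [mul_div_assoc', mul_neg, I_mul_I, neg_neg]
    have hl : ∀ x : ℝ, σ ≠ x → Tendsto (fun z : ℂ => log (z - x * I))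
        (𝓝[{w | 0 < w.re}] (σ * I)) (𝓝 (log ((σ - x : ℝ) * I))) := fun x hx => by
      have hc : ContinuousAt (fun z : ℂ => log (z - x * I)) (σ * I) := by
        refine ContinuousAt.clog (by fun_prop) ?_
        rw [show (σ * I - x * I : ℂ) = (σ - x : ℝ) * I by push_cast; ring]
        exact mem_slitPlane_of_mul_I (sub_ne_zero.2 hx)
      have := hc.tendsto
      rw [show (σ * I - x * I : ℂ) = (σ - x : ℝ) * I by push_cast; ring] at this
      exact this.mono_left nhdsWithin_le_nhds
    have := ((hl q hσ.2.ne).const_mul I).sub ((hl p hσ.1.ne').const_mul I)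
    rw [hlogp _ hp, show σ - q = -(q - σ) by ring, hlogm _ hq] at this
    have e2 : I * (Real.log (q - σ) - Real.log (σ - p) : ℂ) + Real.pi
        = I * (Real.log (q - σ) - Real.pi / 2 * I) - I * (Real.log (σ - p) + Real.pi / 2 * I) := by
      linear_combination (Real.pi : ℂ) * I_mul_I
    rw [e2]
    refine this.congr' ?_
    filter_upwards [self_mem_nhdsWithin] with z hz using (e z hz).symm

/-- Boundary values of the Cauchy integral of a locally Hölder continuous function. -/
theorem exists_tendsto_cauchy {f : ℝ → ℂ} {p q σ : ℝ} (hf : ContinuousOn f (Icc p q))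
    (hσ : σ ∈ Ioo p q) {C α δ : ℝ} (hα : 0 < α) (hC : 0 ≤ C) (hδ : 0 < δ)
    (hδ' : Icc (σ - 2 * δ) (σ + 2 * δ) ⊆ Icc p q)
    (hH : ∀ τ τ', |τ - σ| ≤ 2 * δ → |τ' - σ| ≤ 2 * δ →
      ‖f τ - f τ'‖ ≤ C * (|τ - τ'| ^ α + |τ - τ'|)) :
    ∃ L, Tendsto (fun z : ℂ => ∫ τ in p..q, f τ * (z - τ * I)⁻¹) (𝓝[{w | w.re < 0}] (σ * I))
      (𝓝 (L - Real.pi * f σ)) ∧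
    Tendsto (fun z : ℂ => ∫ τ in p..q, f τ * (z - τ * I)⁻¹) (𝓝[{w | 0 < w.re}] (σ * I))
      (𝓝 (L + Real.pi * f σ)) := by
  have hpq : p ≤ q := (hσ.1.trans hσ.2).le
  set g := IccExtend hpq ((Icc p q).domRestrict f) with hg
  have hgc : Continuous g := (continuousOn_iff_continuous_domRestrict.1 hf).Icc_extend'
  have hgf : ∀ τ ∈ Icc p q, g τ = f τ := fun τ hτ => IccExtend_of_mem hpq _ hτ
  have hmem : ∀ τ, |τ - σ| ≤ 2 * δ → τ ∈ Icc p q := fun τ hτ => hδ' (by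
    rw [abs_le] at hτ
    exact ⟨by linarith [hτ.1], by linarith [hτ.2]⟩)
  obtain ⟨L₀, hL₀⟩ := exists_tendsto_regularized hgc hσ hα hC hδ fun τ τ' h h' => by
    rw [hgf _ (hmem _ h), hgf _ (hmem _ h')]
    exact hH τ τ' h h'
  obtain ⟨L₁, hm, hp⟩ := exists_tendsto_const_cauchy hσ
  have e : ∀ z : ℂ, z.re ≠ 0 → ∫ τ in p..q, f τ * (z - τ * I)⁻¹
      = (∫ τ in p..q, (g τ - g z.im) / (z - τ * I)) + g z.im * ∫ τ in p..q, 1 / (z - τ * I) :=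
    fun z hz => by
      have hne : ∀ τ : ℝ, z - τ * I ≠ 0 := fun τ h => hz (by simpa using congrArg Complex.re h)
      rw [← intervalIntegral.integral_const_mul, ← intervalIntegral.integral_add]
      · refine intervalIntegral.integral_congr fun τ hτ => ?_
        rw [uIcc_of_le hpq] at hτ
        simp only [hgf τ hτ, div_eq_mul_inv]
        ring
      · exact Continuous.intervalIntegrable
          ((hgc.sub continuous_const).div (by fun_prop) hne) _ _
      · exact Continuous.intervalIntegrable
          (continuous_const.mul (continuous_const.div (by fun_prop) hne)) _ _
  have hgσ : Tendsto (fun z : ℂ => g z.im) (𝓝 (σ * I)) (𝓝 (f σ)) := by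
    rw [← hgf σ (Ioo_subset_Icc_self hσ)]
    have h1 := continuous_im.tendsto (σ * I : ℂ)
    rw [show (σ * I : ℂ).im = σ by simp] at h1
    exact (hgc.tendsto σ).comp h1
  refine ⟨L₀ + f σ * L₁, ?_, ?_⟩
  · have := (hL₀.mono_left nhdsWithin_le_nhds).add ((hgσ.mono_left nhdsWithin_le_nhds).mul hm)
    rw [show L₀ + f σ * L₁ - Real.pi * f σ = L₀ + f σ * (L₁ - Real.pi) by ring]
    refine this.congr' ?_
    filter_upwards [self_mem_nhdsWithin] with z hz using (e z (ne_of_lt hz)).symm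
  · have := (hL₀.mono_left nhdsWithin_le_nhds).add ((hgσ.mono_left nhdsWithin_le_nhds).mul hp)
    rw [show L₀ + f σ * L₁ + Real.pi * f σ = L₀ + f σ * (L₁ + Real.pi) by ring]
    refine this.congr' ?_
    filter_upwards [self_mem_nhdsWithin] with z hz using (e z (ne_of_gt hz)).symm

/-! ### Jump relations -/

/-- The jump relation of a row function at a point of the upper imaginary axis. -/
def HasJump (G : ℂ → ℂ) (σ v : ℝ) : Prop :=
  ∃ P Q, Tendsto G (𝓝[{w | w.re < 0}] (σ * I)) (𝓝 P) ∧
    Tendsto G (𝓝[{w | 0 < w.re}] (σ * I)) (𝓝 Q) ∧ P = Q + v * G (-(σ * I))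

theorem tendsto_neg_star_left (σ : ℝ) :
    Tendsto (fun z : ℂ => -star z) (𝓝[{w | w.re < 0}] (σ * I)) (𝓝[{w | 0 < w.re}] (σ * I)) := by
  refine tendsto_nhdsWithin_iff.2 ⟨?_, ?_⟩
  · have : Tendsto (fun z : ℂ => -star z) (𝓝 (σ * I)) (𝓝 (-star (σ * I))) :=
      (continuous_star.neg).continuousAt
    rw [neg_star_mul_I] at this
    exact this.mono_left nhdsWithin_le_nhds
  · filter_upwards [self_mem_nhdsWithin] with z hz
    simpa using hz

theorem tendsto_neg_star_right (σ : ℝ) :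
    Tendsto (fun z : ℂ => -star z) (𝓝[{w | 0 < w.re}] (σ * I)) (𝓝[{w | w.re < 0}] (σ * I)) := by
  refine tendsto_nhdsWithin_iff.2 ⟨?_, ?_⟩
  · have : Tendsto (fun z : ℂ => -star z) (𝓝 (σ * I)) (𝓝 (-star (σ * I))) :=
      (continuous_star.neg).continuousAt
    rw [neg_star_mul_I] at this
    exact this.mono_left nhdsWithin_le_nhds
  · filter_upwards [self_mem_nhdsWithin] with z hz
    simpa using hz

theorem tendsto_neg_left (p : ℂ) :
    Tendsto (fun z : ℂ => -z) (𝓝[{w | w.re < 0}] (-p)) (𝓝[{w | 0 < w.re}] p) := by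
  refine tendsto_nhdsWithin_iff.2 ⟨?_, ?_⟩
  · have : Tendsto (fun z : ℂ => -z) (𝓝 (-p)) (𝓝 (- -p)) := continuous_neg.continuousAt
    rw [neg_neg] at this
    exact this.mono_left nhdsWithin_le_nhds
  · filter_upwards [self_mem_nhdsWithin] with z hz
    simpa using hz

theorem tendsto_neg_right (p : ℂ) :
    Tendsto (fun z : ℂ => -z) (𝓝[{w | 0 < w.re}] (-p)) (𝓝[{w | w.re < 0}] p) := by
  refine tendsto_nhdsWithin_iff.2 ⟨?_, ?_⟩
  · have : Tendsto (fun z : ℂ => -z) (𝓝 (-p)) (𝓝 (- -p)) := continuous_neg.continuousAt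
    rw [neg_neg] at this
    exact this.mono_left nhdsWithin_le_nhds
  · filter_upwards [self_mem_nhdsWithin] with z hz
    simpa using hz

theorem tendsto_symMatrix {α : Type*} {l : Filter α} {G : α → ℂ → ℂ} {f : α → ℂ} {g h g' h' : ℂ}
    (h1 : Tendsto (fun q => G q (f q)) l (𝓝 g))
    (h2 : Tendsto (fun q => reflConj (G q) (f q)) l (𝓝 h))
    (h3 : Tendsto (fun q => G q (-f q)) l (𝓝 g'))
    (h4 : Tendsto (fun q => reflConj (G q) (-f q)) l (𝓝 h')) :
    Tendsto (fun q => symMatrix (G q) (f q)) l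
      (𝓝 !![(g + h) / 2, (g' - h') / 2; (g - h) / 2, (g' + h') / 2]) := by
  rw [tendsto_mat2_iff]
  intro i j
  fin_cases i <;> fin_cases j
  · exact (h1.add h2).div_const 2
  · exact (h3.sub h4).div_const 2
  · exact (h1.sub h2).div_const 2
  · exact (h3.add h4).div_const 2

/-- Boundary values of the matrix on the upper segments. -/
theorem HasJump.symMatrix_upper {G : ℂ → ℂ} {σ v : ℝ} (h : HasJump G σ v)
    (hc : ContinuousAt G (-(σ * I))) :
    ∃ P Q : Mat2, Tendsto (symMatrix G) (𝓝[{w | w.re < 0}] (σ * I)) (𝓝 P) ∧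
      Tendsto (symMatrix G) (𝓝[{w | 0 < w.re}] (σ * I)) (𝓝 Q) ∧ P = Q * low v := by
  obtain ⟨P, Q, hP, hQ, e⟩ := h
  have hP' : Tendsto (reflConj G) (𝓝[{w | w.re < 0}] (σ * I)) (𝓝 (star Q)) :=
    (continuous_star.tendsto _).comp (hQ.comp (tendsto_neg_star_left σ))
  have hQ' : Tendsto (reflConj G) (𝓝[{w | 0 < w.re}] (σ * I)) (𝓝 (star P)) :=
    (continuous_star.tendsto _).comp (hP.comp (tendsto_neg_star_right σ))
  have h3 : Tendsto (fun z => G (-z)) (𝓝 (σ * I)) (𝓝 (G (-(σ * I)))) :=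
    hc.tendsto.comp (continuous_neg.tendsto _)
  have h4 : Tendsto (fun z => reflConj G (-z)) (𝓝 (σ * I)) (𝓝 (star (G (-(σ * I))))) := by
    have h5 : Tendsto (fun z : ℂ => -star (-z)) (𝓝 (σ * I)) (𝓝 (-star (-(σ * I)))) :=
      Continuous.tendsto (by fun_prop) _
    rw [star_neg, neg_neg, star_mul_I] at h5
    exact (continuous_star.tendsto _).comp (hc.tendsto.comp h5)
  refine ⟨_, _, tendsto_symMatrix hP hP' (h3.mono_left nhdsWithin_le_nhds)
    (h4.mono_left nhdsWithin_le_nhds), tendsto_symMatrix hQ hQ' (h3.mono_left nhdsWithin_le_nhds)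
    (h4.mono_left nhdsWithin_le_nhds), ?_⟩
  have e' : star P = star Q + v * star (G (-(σ * I))) := by
    rw [e, star_add, star_mul', RCLike.star_def, conj_ofReal]
  rw [low, Matrix.mul_fin_two, e', e]
  ext i j
  fin_cases i <;> fin_cases j <;> simp <;> ring

theorem symMatrix_neg (G : ℂ → ℂ) (z : ℂ) :
    symMatrix G (-z) = !![0, 1; 1, 0] * symMatrix G z * !![0, 1; 1, 0] := by
  rw [symMatrix, symMatrix, Matrix.mul_fin_two, Matrix.mul_fin_two, neg_neg]
  simp

/-- Boundary values of the matrix on the lower segments. -/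
theorem HasJump.symMatrix_lower {G : ℂ → ℂ} {σ v : ℝ} (h : HasJump G σ v)
    (hc : ContinuousAt G (-(σ * I))) :
    ∃ P Q : Mat2, Tendsto (symMatrix G) (𝓝[{w | w.re < 0}] (-(σ * I))) (𝓝 P) ∧
      Tendsto (symMatrix G) (𝓝[{w | 0 < w.re}] (-(σ * I))) (𝓝 Q) ∧ P = Q * up (-v) := by
  obtain ⟨P, Q, hP, hQ, e⟩ := h.symMatrix_upper hc
  set S : Mat2 := !![0, 1; 1, 0] with hS
  have hfun : symMatrix G = fun z => S * symMatrix G (-z) * S := by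
    funext z
    rw [hS, ← symMatrix_neg, neg_neg]
  have hcont : Continuous fun X : Mat2 => S * X * S := by fun_prop
  refine ⟨S * Q * S, S * P * S, ?_, ?_, ?_⟩
  · rw [hfun]
    exact (hcont.tendsto _).comp (hQ.comp (tendsto_neg_left _))
  · rw [hfun]
    exact (hcont.tendsto _).comp (hP.comp (tendsto_neg_right _))
  · have h1 : low v * S * up (-v) = S := by
      rw [low, up, hS, Matrix.mul_fin_two, Matrix.mul_fin_two]
      simp
    rw [e]
    calc S * Q * S = S * Q * (low v * S * up (-v)) := by rw [h1]
      _ = _ := by simp only [Matrix.mul_assoc]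

theorem mem_closure_left {z : ℂ} (hz : z.re = 0) : z ∈ closure {w : ℂ | w.re < 0} := by
  rw [Complex.closure_setOfPred_re_lt]
  exact hz.le

theorem mem_closure_right {z : ℂ} (hz : z.re = 0) : z ∈ closure {w : ℂ | 0 < w.re} := by
  rw [Complex.closure_setOfPred_lt_re]
  exact hz.ge

theorem re_eq_zero_of_mem_openContour {a b : ℝ} {z : ℂ} (hz : z ∈ openContour a b) : z.re = 0 := by
  rcases hz with ((hz | hz) | hz) | hz <;> exact hz.1

/-- Pointwise boundary values are continuous along the contour. -/
theorem exists_continuous_boundary_values {a b : ℝ} {M V : ℂ → Mat2}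
    (h : ∀ z ∈ openContour a b, ∃ P Q : Mat2, Tendsto M (𝓝[{w | w.re < 0}] z) (𝓝 P) ∧
      Tendsto M (𝓝[{w | 0 < w.re}] z) (𝓝 Q) ∧ P = Q * V z) :
    ∃ Mp Mm : ℂ → Mat2,
    ContinuousOn Mp (openContour a b) ∧ ContinuousOn Mm (openContour a b) ∧
    ∀ z ∈ openContour a b,
      Tendsto M (𝓝[{w | w.re < 0}] z) (𝓝 (Mp z)) ∧
      Tendsto M (𝓝[{w | 0 < w.re}] z) (𝓝 (Mm z)) ∧
      Mp z = Mm z * V z := by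
  have : T3Space Mat2 := inferInstanceAs (T3Space (Fin 2 → Fin 2 → ℂ))
  refine ⟨extendFrom {w | w.re < 0} M, extendFrom {w | 0 < w.re} M, ?_, ?_, fun z hz => ?_⟩
  · exact continuousOn_extendFrom (fun z hz => mem_closure_left (re_eq_zero_of_mem_openContour hz))
      fun z hz => (h z hz).imp fun P hP => hP.choose_spec.1
  · exact continuousOn_extendFrom (fun z hz => mem_closure_right (re_eq_zero_of_mem_openContour hz))
      fun z hz => by
        obtain ⟨P, Q, -, hQ, -⟩ := h z hz
        exact ⟨Q, hQ⟩
  · obtain ⟨P, Q, hP, hQ, e⟩ := h z hz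
    rw [extendFrom_eq (mem_closure_left (re_eq_zero_of_mem_openContour hz)) hP,
      extendFrom_eq (mem_closure_right (re_eq_zero_of_mem_openContour hz)) hQ]
    exact ⟨hP, hQ, e⟩

theorem one_div_star_re (z : ℂ) : (1 / star z).re = z.re / normSq z := by
  rw [one_div, RCLike.star_def, inv_re, normSq_conj, conj_re]

/-- Local Hölder continuity, up to a Lipschitz term, on a neighbourhood inside the interval. -/
def HolderNear (a b : ℝ) (f : ℝ → ℝ) (σ : ℝ) : Prop :=
  ∃ C α δ : ℝ, 0 < α ∧ 0 ≤ C ∧ 0 < δ ∧ Icc (σ - 2 * δ) (σ + 2 * δ) ⊆ Icc a b ∧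
    ∀ τ τ', |τ - σ| ≤ 2 * δ → |τ' - σ| ≤ 2 * δ →
      |f τ - f τ'| ≤ C * (|τ - τ'| ^ α + |τ - τ'|)

theorem notMem_of_notMem_closedContour {a b : ℝ} {z : ℂ} (hz : z ∉ closedContour a b) :
    z ∉ upperContour a b ∧ -z ∉ upperContour a b := by
  constructor
  · rintro (h1 | h1)
    · exact hz (Or.inl (Or.inl (Or.inl h1)))
    · exact hz (Or.inl (Or.inl (Or.inr h1)))
  · rintro (⟨h1, h2⟩ | ⟨h1, h2⟩)
    · exact hz (Or.inl (Or.inr ⟨by simpa using h1, by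
        rw [neg_im] at h2
        exact ⟨by linarith [h2.2], by linarith [h2.1]⟩⟩))
    · exact hz (Or.inr ⟨by simpa using h1, by
        rw [neg_im] at h2
        exact ⟨by linarith [h2.2], by linarith [h2.1]⟩⟩)

namespace SamplingData

variable {a b : ℝ} {ρ η : ℝ → ℝ} {s : (N : ℕ) → Fin N → ℝ} (h : SamplingData a b ρ η s)
include h

theorem one_div_b_le {x : ℝ} (hx : x ∈ Icc a b) : 1 / b ≤ x := by
  have : 1 / b ≤ 1 := by
    rw [div_le_one h.b_pos]
    linarith [h.one_lt, h.lt]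
  linarith [hx.1, h.one_lt]

theorem continuousOn_limSol : ContinuousOn h.limSol (Ici (1 / b)) := by
  obtain ⟨B, L, -, hL, -, hlip⟩ := h.exists_limSol_tame
  have : LipschitzOnWith ⟨L, hL⟩ h.limSol (Ici (1 / b)) :=
    LipschitzOnWith.of_dist_le_mul fun x hx x' hx' => by
      rw [dist_eq_norm, Real.dist_eq]
      exact hlip x x' hx hx'
  exact this.continuousOn

theorem hasJump_limRow {σ : ℝ} (hσ : σ ∈ Ioo a b) (hH : HolderNear a b (fun x => ρ x * η x) σ) :
    HasJump h.limRow σ (-(2 * Real.pi * (ρ σ * η σ))) := by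
  obtain ⟨C, α, δ, hα, hC, hδ, hδ', hH⟩ := hH
  obtain ⟨B, L, hB0, hL, hB, hlip⟩ := h.exists_limSol_tame
  have hw : ContinuousOn (fun x => ρ x * η x) (Icc a b) := h.density_cont.mul h.weight_cont
  obtain ⟨W, hW⟩ := isCompact_Icc.exists_bound_of_continuousOn hw
  have hW0 : 0 ≤ W := (norm_nonneg _).trans (hW σ (Ioo_subset_Icc_self hσ))
  set f : ℝ → ℂ := fun x => ((ρ x * η x : ℝ) : ℂ) * h.limSol x with hf
  set f' : ℝ → ℂ := fun x => ((ρ x * η x : ℝ) : ℂ) * (h.limSol (1 / x) / (x : ℂ) ^ 2) with hf'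
  have hx0 : ∀ x ∈ Icc a b, (x : ℂ) ^ 2 ≠ 0 := fun x hx => by
    have : x ≠ 0 := (h.a_pos.trans_le hx.1).ne'
    exact_mod_cast pow_ne_zero 2 this
  have hfc : ContinuousOn f (Icc a b) :=
    (continuous_ofReal.comp_continuousOn hw).mul
      (h.continuousOn_limSol.mono fun x hx => h.one_div_b_le hx)
  have hfc' : ContinuousOn f' (Icc a b) := by
    refine (continuous_ofReal.comp_continuousOn hw).mul (ContinuousOn.div
      (h.continuousOn_limSol.comp (ContinuousOn.div continuousOn_const continuousOn_id fun x hx =>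
        (h.a_pos.trans_le hx.1).ne') fun x hx => ?_) (by fun_prop) hx0)
    exact (one_div_mem_Icc h.a_pos hx).1
  obtain ⟨L₀, hm, hp⟩ := exists_tendsto_cauchy hfc hσ (C := C * B + W * L) hα (by positivity) hδ hδ'
    fun τ τ' h1 h2 => by
      have hτ : τ ∈ Icc a b := hδ' (by
        rw [abs_le] at h1
        exact ⟨by linarith [h1.1], by linarith [h1.2]⟩)
      have hτ' : τ' ∈ Icc a b := hδ' (by
        rw [abs_le] at h2
        exact ⟨by linarith [h2.1], by linarith [h2.2]⟩)
      have e : f τ - f τ' = ((ρ τ * η τ - ρ τ' * η τ' : ℝ) : ℂ) * h.limSol τ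
          + ((ρ τ' * η τ' : ℝ) : ℂ) * (h.limSol τ - h.limSol τ') := by
        simp only [hf]
        push_cast
        ring
      have e1 : ‖((ρ τ * η τ - ρ τ' * η τ' : ℝ) : ℂ) * h.limSol τ‖
          ≤ C * (|τ - τ'| ^ α + |τ - τ'|) * B := by
        refine norm_mul_le_mul ?_ (hB τ (h.one_div_b_le hτ))
        rw [Complex.norm_real]
        exact hH τ τ' h1 h2
      have e2 : ‖((ρ τ' * η τ' : ℝ) : ℂ) * (h.limSol τ - h.limSol τ')‖ ≤ W * (L * |τ - τ'|) := by
        refine norm_mul_le_mul ?_ (hlip τ τ' (h.one_div_b_le hτ) (h.one_div_b_le hτ'))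
        rw [Complex.norm_real]
        exact hW τ' hτ'
      rw [e]
      have e3 : 0 ≤ W * L * |τ - τ'| ^ α := by positivity
      linarith [norm_add_le (((ρ τ * η τ - ρ τ' * η τ' : ℝ) : ℂ) * h.limSol τ)
        (((ρ τ' * η τ' : ℝ) : ℂ) * (h.limSol τ - h.limSol τ'))]
  have hsplit : ∀ z : ℂ, z.re ≠ 0 → h.limRow z = 1 + ((∫ x in a..b, f x * (z - x * I)⁻¹) +
      ∫ x in a..b, f' x * (z - (1 / x : ℝ) * I)⁻¹) := fun z hz => by
    have hne : ∀ τ : ℝ, z - τ * I ≠ 0 := fun τ h => hz (by simpa using congrArg Complex.re h)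
    rw [limRow, densityFunctional, ← intervalIntegral.integral_add]
    · congr 1
      refine intervalIntegral.integral_congr fun x _ => ?_
      simp only [hf, hf']
      push_cast
      ring
    · refine ContinuousOn.intervalIntegrable ?_
      rw [uIcc_of_le h.lt.le]
      exact hfc.mul (Continuous.continuousOn (Continuous.inv₀ (by fun_prop) fun x => hne x))
    · refine ContinuousOn.intervalIntegrable ?_
      rw [uIcc_of_le h.lt.le]
      refine hfc'.mul (ContinuousOn.inv₀ ?_ fun x _ => hne _)
      refine continuousOn_const.sub (ContinuousOn.mul ?_ continuousOn_const)
      exact continuous_ofReal.comp_continuousOn (ContinuousOn.div continuousOn_const continuousOn_id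
        fun x hx => (h.a_pos.trans_le hx.1).ne')
  have hcont : ContinuousAt (fun z : ℂ => ∫ x in a..b, f' x * (z - (1 / x : ℝ) * I)⁻¹)
      (σ * I) := by
    obtain ⟨W', hW'⟩ := isCompact_Icc.exists_bound_of_continuousOn hfc'
    have hd : 0 < σ - 1 := by linarith [hσ.1, h.one_lt]
    have hfar : ∀ᶠ z : ℂ in 𝓝 (σ * I), ∀ x ∈ Icc a b,
        (σ - 1) / 2 ≤ ‖z - (1 / x : ℝ) * I‖ := by
      have him : ∀ᶠ z : ℂ in 𝓝 (σ * I), (σ + 1) / 2 < z.im := by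
        refine continuous_im.continuousAt.eventually (lt_mem_nhds ?_)
        simp
        linarith
      filter_upwards [him] with z hz x hx
      have h1 : 1 / x ≤ 1 := by
        rw [div_le_one (h.a_pos.trans_le hx.1)]
        linarith [hx.1, h.one_lt]
      have h2 := (le_abs_self _).trans (Complex.abs_im_le_norm (z - (1 / x : ℝ) * I))
      have h3 : (z - (1 / x : ℝ) * I).im = z.im - 1 / x := by simp
      rw [h3] at h2
      linarith
    have hmeas : ∀ᶠ z : ℂ in 𝓝 (σ * I), AEStronglyMeasurable
        (fun x : ℝ => f' x * (z - (1 / x : ℝ) * I)⁻¹) (volume.restrict (uIoc a b)) := by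
      refine .of_forall fun z => ?_
      rw [uIoc_of_le h.lt.le]
      refine AEStronglyMeasurable.mul ?_ (Measurable.aestronglyMeasurable (by fun_prop))
      exact (hfc'.mono Ioc_subset_Icc_self).aestronglyMeasurable measurableSet_Ioc
    refine intervalIntegral.continuousAt_of_dominated_interval
      (bound := fun _ => W' * ((σ - 1) / 2)⁻¹) hmeas ?_ intervalIntegrable_const ?_
    · filter_upwards [hfar] with z hz
      refine .of_forall fun x hx => ?_
      rw [uIoc_of_le h.lt.le] at hx
      have hx' := Ioc_subset_Icc_self hx
      refine norm_mul_le_mul (hW' x hx') ?_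
      rw [norm_inv]
      exact inv_anti₀ (half_pos hd) (hz x hx')
    · refine .of_forall fun x hx => ?_
      rw [uIoc_of_le h.lt.le] at hx
      have := hfar.self_of_nhds x (Ioc_subset_Icc_self hx)
      refine continuousAt_const.mul (ContinuousAt.inv₀ (by fun_prop) ?_)
      exact norm_pos_iff.1 ((half_pos hd).trans_le this)
  have hc' := hcont.tendsto
  have hfσ : f σ = ((ρ σ * η σ : ℝ) : ℂ) * h.limRow (-(σ * I)) := by
    rw [h.limRow_neg_mul_I (h.one_div_b_le (Ioo_subset_Icc_self hσ))]
  refine ⟨_, _, ((tendsto_const_nhds (x := (1 : ℂ))).add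
    (hm.add (hc'.mono_left nhdsWithin_le_nhds))).congr' ?_,
    ((tendsto_const_nhds (x := (1 : ℂ))).add
    (hp.add (hc'.mono_left nhdsWithin_le_nhds))).congr' ?_, ?_⟩
  · filter_upwards [self_mem_nhdsWithin] with z hz using (hsplit z (ne_of_lt hz)).symm
  · filter_upwards [self_mem_nhdsWithin] with z hz using (hsplit z (ne_of_gt hz)).symm
  · rw [hfσ]
    push_cast
    ring

theorem limRow_eq_star {z : ℂ} (hz0 : z ≠ 0) (hz : z ∉ upperContour a b) :
    h.limRow z = star (reflConj h.limRow 0 * h.limRow (1 / star z)) := by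
  have := h.reflConj_limRow (z := -star z) (by simpa using hz0)
    fun h' => hz (neg_star_mem_upperContour.1 h')
  rw [reflConj, star_neg, neg_neg, star_star, div_neg, neg_neg] at this
  rw [← this, star_star]

theorem hasJump_inv {σ v : ℝ} (hσ : σ ∈ Ioo a b) (hj : HasJump h.limRow σ v) :
    HasJump h.limRow (1 / σ) v := by
  obtain ⟨P, Q, hP, hQ, e⟩ := hj
  have hσ0 : 0 < σ := h.a_pos.trans hσ.1
  have hlim : Tendsto (fun z : ℂ => 1 / star z) (𝓝 ((1 / σ : ℝ) * I)) (𝓝 (σ * I)) := by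
    have : ContinuousAt (fun z : ℂ => 1 / star z) ((1 / σ : ℝ) * I) := by
      refine continuousAt_const.div continuous_star.continuousAt ?_
      rw [star_ne_zero]
      exact mul_ne_zero (by exact_mod_cast one_div_ne_zero hσ0.ne') I_ne_zero
    have h1 := this.tendsto
    rwa [one_div_star_mul_I, one_div_one_div] at h1
  have hre : ∀ z : ℂ, z.re ≠ 0 → z ≠ 0 ∧ z ∉ upperContour a b := fun z hz =>
    ⟨fun h0 => hz (by simp [h0]), fun h0 => hz (by rcases h0 with h0 | h0 <;> exact h0.1)⟩
  have hpos : ∀ z : ℂ, z.re ≠ 0 → 0 < normSq z := fun z hz => normSq_pos.2 (hre z hz).1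
  have hl : Tendsto (fun z : ℂ => 1 / star z) (𝓝[{w | w.re < 0}] ((1 / σ : ℝ) * I))
      (𝓝[{w | w.re < 0}] (σ * I)) := by
    refine tendsto_nhdsWithin_iff.2 ⟨hlim.mono_left nhdsWithin_le_nhds, ?_⟩
    filter_upwards [self_mem_nhdsWithin] with z hz
    rw [one_div_star_re]
    exact div_neg_of_neg_of_pos hz (hpos z (ne_of_lt hz))
  have hr : Tendsto (fun z : ℂ => 1 / star z) (𝓝[{w | 0 < w.re}] ((1 / σ : ℝ) * I))
      (𝓝[{w | 0 < w.re}] (σ * I)) := by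
    refine tendsto_nhdsWithin_iff.2 ⟨hlim.mono_left nhdsWithin_le_nhds, ?_⟩
    filter_upwards [self_mem_nhdsWithin] with z hz
    rw [one_div_star_re]
    exact div_pos hz (hpos z (ne_of_gt hz))
  refine ⟨star (reflConj h.limRow 0 * P), star (reflConj h.limRow 0 * Q), ?_, ?_, ?_⟩
  · refine ((continuous_star.tendsto _).comp ((hP.comp hl).const_mul _)).congr' ?_
    filter_upwards [self_mem_nhdsWithin] with z hz
    exact (h.limRow_eq_star (hre z (ne_of_lt hz)).1 (hre z (ne_of_lt hz)).2).symm
  · refine ((continuous_star.tendsto _).comp ((hQ.comp hr).const_mul _)).congr' ?_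
    filter_upwards [self_mem_nhdsWithin] with z hz
    exact (h.limRow_eq_star (hre z (ne_of_gt hz)).1 (hre z (ne_of_gt hz)).2).symm
  · have hσ1 : 0 < 1 / σ := one_div_pos.2 hσ0
    rw [h.limRow_eq_star (z := -((1 / σ : ℝ) * I))
      (neg_ne_zero.2 (mul_ne_zero (by exact_mod_cast hσ1.ne') I_ne_zero))
      (notMem_upperContour_of_im_nonpos h.a_pos h.lt.le (by simpa using hσ0.le)), star_neg, div_neg,
      one_div_star_mul_I, one_div_one_div, e]
    simp only [star_mul', star_add, RCLike.star_def, conj_ofReal]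
    ring

theorem continuousAt_limRow_neg {x : ℝ} (hx : 0 < x) : ContinuousAt h.limRow (-(x * I)) :=
  (h.differentiableAt_limRow (notMem_upperContour_of_im_nonpos h.a_pos h.lt.le
    (by simpa using hx.le))).continuousAt

/-- Boundary values of the limiting matrix on the four segments. -/
theorem exists_boundary_values {R : ℂ → ℝ} {y t : ℝ}
    (hH : ∀ σ ∈ Ioo a b, HolderNear a b (fun x => ρ x * η x) σ)
    (hη : ∀ σ ∈ Ioo a b, Real.pi * (ρ σ * η σ) = R (σ * I) * phaseWeight y t σ)
    (hR : ∀ σ ∈ Ioo a b, R ((1 / σ : ℝ) * I) = R (σ * I) ∧ R (-(σ * I)) = R (σ * I) ∧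
      R (-((1 / σ : ℝ) * I)) = R (σ * I)) {z : ℂ} (hz : z ∈ openContour a b) :
    ∃ P Q : Mat2, Tendsto (symMatrix h.limRow) (𝓝[{w | w.re < 0}] z) (𝓝 P) ∧
      Tendsto (symMatrix h.limRow) (𝓝[{w | 0 < w.re}] z) (𝓝 Q) ∧ P = Q * jump R y t z := by
  have key : ∀ σ ∈ Ioo a b, HasJump h.limRow σ (-(2 * R (σ * I) * phaseWeight y t σ)) :=
    fun σ hσ => by
      have := h.hasJump_limRow hσ (hH σ hσ)
      rwa [mul_assoc 2, hη σ hσ, ← mul_assoc] at this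
  have hinv : ∀ τ ∈ Ioo (1 / b) (1 / a), ∃ σ ∈ Ioo a b, τ = 1 / σ := fun τ hτ => by
    have hτ0 : 0 < τ := (one_div_pos.2 h.b_pos).trans hτ.1
    refine ⟨1 / τ, ⟨?_, ?_⟩, (one_div_one_div τ).symm⟩
    · rw [lt_one_div h.a_pos hτ0]
      exact hτ.2
    · rw [one_div_lt hτ0 h.b_pos]
      exact hτ.1
  have hz0 := eq_im_mul_I (re_eq_zero_of_mem_openContour hz)
  rcases hz with ((hz | hz) | hz) | hz
  · have hσ : z.im ∈ Ioo a b := hz.2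
    have hpos : 0 < z.im := h.a_pos.trans hσ.1
    obtain ⟨P, Q, hP, hQ, e⟩ := (key _ hσ).symMatrix_upper (h.continuousAt_limRow_neg hpos)
    rw [← hz0] at hP hQ
    refine ⟨P, Q, hP, hQ, ?_⟩
    have e1 : exp (-2 * I * theta y t z) = phaseWeight y t z.im := by
      conv_lhs => rw [hz0]
      exact exp_theta_mul_I y t hpos.ne'
    rw [e, jump, if_pos hpos, e1, ← hz0]
    push_cast
    rfl
  · obtain ⟨σ, hσ, hτ⟩ := hinv _ hz.2
    have hσ0 : 0 < σ := h.a_pos.trans hσ.1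
    rw [hτ] at hz0
    obtain ⟨P, Q, hP, hQ, e⟩ := (h.hasJump_inv hσ (key _ hσ)).symMatrix_upper
      (h.continuousAt_limRow_neg (one_div_pos.2 hσ0))
    rw [← hz0] at hP hQ
    refine ⟨P, Q, hP, hQ, ?_⟩
    rw [e, jump, if_pos (by rw [hτ]; exact one_div_pos.2 hσ0), hz0, (hR σ hσ).1,
      exp_theta_inv_mul_I y t hσ0.ne']
    push_cast
    rfl
  · have hσ : -z.im ∈ Ioo a b := ⟨by linarith [hz.2.2], by linarith [hz.2.1]⟩
    have hpos : 0 < -z.im := h.a_pos.trans hσ.1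
    have hz1 : z = -((-z.im : ℝ) * I) := by
      push_cast
      rw [neg_mul, neg_neg]
      exact hz0
    obtain ⟨P, Q, hP, hQ, e⟩ := (key _ hσ).symMatrix_lower (h.continuousAt_limRow_neg hpos)
    rw [← hz1] at hP hQ
    refine ⟨P, Q, hP, hQ, ?_⟩
    have e1 : exp (2 * I * theta y t z) = phaseWeight y t (-z.im) := by
      conv_lhs => rw [hz1]
      exact exp_theta_neg_mul_I y t hpos.ne'
    have e2 : R z = R ((-z.im : ℝ) * I) := by
      conv_lhs => rw [hz1]
      exact (hR _ hσ).2.1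
    rw [e, jump, if_neg (by linarith), e1, e2]
    push_cast
    rw [neg_neg]
  · obtain ⟨σ, hσ, hτ⟩ := hinv (-z.im) ⟨by linarith [hz.2.2], by linarith [hz.2.1]⟩
    have hσ0 : 0 < σ := h.a_pos.trans hσ.1
    have hz1 : z = -((1 / σ : ℝ) * I) := by
      rw [← hτ]
      push_cast
      rw [neg_mul, neg_neg]
      exact hz0
    obtain ⟨P, Q, hP, hQ, e⟩ := (h.hasJump_inv hσ (key _ hσ)).symMatrix_lower
      (h.continuousAt_limRow_neg (one_div_pos.2 hσ0))
    rw [← hz1] at hP hQ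
    refine ⟨P, Q, hP, hQ, ?_⟩
    have hneg : ¬ 0 < z.im := by
      have := one_div_pos.2 hσ0
      linarith
    rw [e, jump, if_neg hneg, hz1, (hR σ hσ).2.2, exp_theta_neg_inv_mul_I y t hσ0.ne']
    push_cast
    rw [neg_neg]

theorem differentiableOn_symMatrix (i j : Fin 2) :
    DifferentiableOn ℂ (fun z => symMatrix h.limRow z i j) (closedContour a b)ᶜ := by
  intro z hz
  obtain ⟨h1, h2⟩ := notMem_of_notMem_closedContour hz
  have d1 := h.differentiableAt_limRow h1
  have d2 := differentiableAt_reflConj (h.differentiableAt_limRow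
    fun h' => h1 (neg_star_mem_upperContour.1 h'))
  have hn : DifferentiableAt ℂ (fun w : ℂ => -w) z := differentiableAt_id.neg
  have d3 : DifferentiableAt ℂ (fun w => h.limRow (-w)) z :=
    DifferentiableAt.comp (g := h.limRow) z (h.differentiableAt_limRow h2) hn
  have d4 : DifferentiableAt ℂ (fun w => reflConj h.limRow (-w)) z :=
    DifferentiableAt.comp (g := reflConj h.limRow) z (differentiableAt_reflConj (h.differentiableAt_limRow
      fun h' => h2 (neg_star_mem_upperContour.1 h'))) hn
  refine DifferentiableAt.differentiableWithinAt ?_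
  fin_cases i <;> fin_cases j
  · exact (d1.add d2).div_const 2
  · exact (d3.sub d4).div_const 2
  · exact (d1.sub d2).div_const 2
  · exact (d3.add d4).div_const 2

theorem solvesLimitRHP {R : ℂ → ℝ} {y t : ℝ}
    (hH : ∀ σ ∈ Ioo a b, HolderNear a b (fun x => ρ x * η x) σ)
    (hη : ∀ σ ∈ Ioo a b, Real.pi * (ρ σ * η σ) = R (σ * I) * phaseWeight y t σ)
    (hR : ∀ σ ∈ Ioo a b, R ((1 / σ : ℝ) * I) = R (σ * I) ∧ R (-(σ * I)) = R (σ * I) ∧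
      R (-((1 / σ : ℝ) * I)) = R (σ * I)) :
    SolvesLimitRHP a b R y t (symMatrix h.limRow) :=
  ⟨h.differentiableOn_symMatrix,
    exists_continuous_boundary_values fun _ hz => h.exists_boundary_values hH hη hR hz,
    h.normalizedAtInfinity_limRow, h.rowSymmetric_limRow.normalizedAtI⟩

end SamplingData

/-! ### Data on the line domain -/

/-- The weight `(b - a) r(is) e^{-2iθ(is)} / π`. -/
noncomputable def scalarWeight (a b : ℝ) (r : ℂ → ℝ) (y t x : ℝ) : ℝ :=
  (b - a) / Real.pi * (r (x * I) * phaseWeight y t x)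

theorem contDiffOn_phaseWeight {a b : ℝ} (ha : 1 < a) (y t : ℝ) :
    ContDiffOn ℝ ∞ (phaseWeight y t) (Icc a b) := by
  have h0 : ∀ x ∈ Icc a b, x ≠ 0 := fun x hx => by linarith [hx.1]
  have h1 : ∀ x ∈ Icc a b, (x - 1 / x) ^ 2 ≠ 0 := fun x hx => by
    have hx1 : 1 < x := ha.trans_le hx.1
    have : 1 / x < 1 := by
      rw [div_lt_one (by linarith)]
      exact hx1
    have : 0 < x - 1 / x := by linarith
    positivity
  have hinv : ContDiffOn ℝ ∞ (fun x : ℝ => 1 / x) (Icc a b) := contDiffOn_const.div contDiffOn_id h0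
  refine ContDiffOn.exp (((contDiffOn_const.mul (contDiffOn_id.add hinv)).mul
    (contDiffOn_const.add (ContDiffOn.div contDiffOn_const ?_ h1))))
  exact (contDiffOn_id.sub hinv).pow 2

theorem IsWeight.continuousOn_real {a b : ℝ} {r : ℂ → ℝ} (hr : IsWeight a b r) :
    ContinuousOn (fun x : ℝ => r (x * I)) (Icc a b) :=
  hr.continuousOn.comp (by fun_prop) fun _ hx => mul_I_mem_cseg.2 hx

/-- The weight does not change sign. -/
theorem IsWeight.sign {a b : ℝ} (hab : a < b) {r : ℂ → ℝ} (hr : IsWeight a b r) :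
    (∀ x ∈ Icc a b, 0 ≤ r (x * I)) ∨ ∀ x ∈ Icc a b, r (x * I) ≤ 0 := by
  have hc := hr.continuousOn_real
  have hne : ∀ x ∈ Ioo a b, r ((x : ℝ) * I) ≠ 0 := fun x hx => hr.ne_zero _ (mul_I_mem_oseg.2 hx)
  have hiv : ∀ x ∈ Ioo a b, ∀ x' ∈ Ioo a b, r ((x : ℝ) * I) ≤ 0 → 0 ≤ r ((x' : ℝ) * I) → False :=
    fun x hx x' hx' h1 h2 => by
      obtain ⟨u, hu, hu0⟩ := isPreconnected_Ioo.intermediate_value hx hx'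
        (hc.mono Ioo_subset_Icc_self) ⟨h1, h2⟩
      exact hne u hu hu0
  have hm : (a + b) / 2 ∈ Ioo a b := ⟨by linarith, by linarith⟩
  rw [← closure_Ioo hab.ne] at hc ⊢
  rcases le_total 0 (r (((a + b) / 2 : ℝ) * I)) with h0 | h0
  · exact Or.inl (le_on_closure (f := fun _ => 0)
      (fun x hx => (lt_or_ge 0 (r (x * I))).elim le_of_lt
        fun h => (hiv x hx _ hm h h0).elim) continuousOn_const hc)
  · exact Or.inr (le_on_closure (g := fun _ => 0)
      (fun x hx => (lt_or_ge (r (x * I)) 0).elim le_of_lt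
        fun h => (hiv _ hm x hx h0 h).elim) hc continuousOn_const)

theorem IsSampled.eq_mul_I {a b : ℝ} {ρ : ℝ → ℝ} {N : ℕ} {z : Fin N → ℂ}
    (hz : IsSampled a b ρ z) (j : Fin N) : z j = (z j).im * I :=
  eq_im_mul_I (hz j).1.1

theorem samplingData {a b : ℝ} (ha : 1 < a) (hab : a < b) {ρ : ℝ → ℝ} (hρ : IsSmoothDensity a b ρ)
    {r : ℂ → ℝ} (hr : IsWeight a b r) {z : (N : ℕ) → Fin N → ℂ}
    (hz : ∀ N, IsSampled a b ρ (z N)) (y t : ℝ) :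
    SamplingData a b ρ (scalarWeight a b r y t) fun N j => (z N j).im where
  one_lt := ha
  lt := hab
  density_cont := hρ.smooth.continuousOn
  density_nonneg := hρ.nonneg
  density_integral := hρ.integral_eq
  weight_cont := continuousOn_const.mul
    (hr.continuousOn_real.mul (contDiffOn_phaseWeight ha y t).continuousOn)
  weight_sign := by
    have h0 : 0 ≤ (b - a) / Real.pi := div_nonneg (sub_nonneg.2 hab.le) Real.pi_pos.le
    refine (hr.sign hab).imp (fun h x hx => ?_) fun h x hx => ?_
    · exact mul_nonneg h0 (mul_nonneg (h x hx) (phaseWeight_pos _ _ _).le)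
    · exact mul_nonpos_of_nonneg_of_nonpos h0
        (mul_nonpos_of_nonpos_of_nonneg (h x hx) (phaseWeight_pos _ _ _).le)
  mem N j := (hz N j).1.2
  quantile N j := by
    have := (hz N j).2
    rwa [show (-I * z N j).re = (z N j).im by simp] at this

theorem exists_lipschitzOnWith_Icc {a b : ℝ} {f : ℝ → ℝ} (hf : ContDiffOn ℝ ∞ f (Icc a b)) :
    ∃ K, LipschitzOnWith K f (Icc a b) := by
  refine LocallyLipschitzOn.exists_lipschitzOnWith_of_compact isCompact_Icc fun x hx => ?_
  exact ((hf x hx).of_le (by simp)).exists_lipschitzOnWith (convex_Icc a b)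

theorem holderNear_scalarWeight {a b : ℝ} (ha : 1 < a) {ρ : ℝ → ℝ}
    (hρ : IsSmoothDensity a b ρ) {r : ℂ → ℝ} (hr : IsWeight a b r) (y t : ℝ) {σ : ℝ}
    (hσ : σ ∈ Ioo a b) : HolderNear a b (fun x => ρ x * scalarWeight a b r y t x) σ := by
  set φ : ℝ → ℝ := fun x => (b - a) / Real.pi * (ρ x * phaseWeight y t x) with hφ
  have hφs : ContDiffOn ℝ ∞ φ (Icc a b) :=
    contDiffOn_const.mul (hρ.smooth.mul (contDiffOn_phaseWeight ha y t))
  obtain ⟨K, hK⟩ := exists_lipschitzOnWith_Icc hφs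
  obtain ⟨B, hB⟩ := isCompact_Icc.exists_bound_of_continuousOn hφs.continuousOn
  obtain ⟨W, hW⟩ := isCompact_Icc.exists_bound_of_continuousOn hr.continuousOn_real
  have hσ' := Ioo_subset_Icc_self hσ
  have hB0 : 0 ≤ B := (norm_nonneg _).trans (hB σ hσ')
  have hW0 : 0 ≤ W := (norm_nonneg _).trans (hW σ hσ')
  set δ := min (σ - a) (b - σ) / 4 with hδ
  have hδ0 : 0 < δ := div_pos (lt_min (sub_pos.2 hσ.1) (sub_pos.2 hσ.2)) (by norm_num)
  have hδa : 4 * δ ≤ σ - a := by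
    have := min_le_left (σ - a) (b - σ)
    rw [hδ]
    linarith
  have hδb : 4 * δ ≤ b - σ := by
    have := min_le_right (σ - a) (b - σ)
    rw [hδ]
    linarith
  obtain ⟨C, α, hα, hC⟩ := hr.holder (σ - 2 * δ) (σ + 2 * δ) (by linarith) (by linarith)
  have hsub : Icc (σ - 2 * δ) (σ + 2 * δ) ⊆ Icc a b :=
    Icc_subset_Icc (by linarith) (by linarith)
  refine ⟨C * B + W * K, α, δ, by exact_mod_cast hα, by positivity, hδ0, hsub,
    fun τ τ' h1 h2 => ?_⟩
  have m1 : τ ∈ Icc (σ - 2 * δ) (σ + 2 * δ) := by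
    rw [abs_le] at h1
    exact ⟨by linarith [h1.1], by linarith [h1.2]⟩
  have m2 : τ' ∈ Icc (σ - 2 * δ) (σ + 2 * δ) := by
    rw [abs_le] at h2
    exact ⟨by linarith [h2.1], by linarith [h2.2]⟩
  have e : ρ τ * scalarWeight a b r y t τ - ρ τ' * scalarWeight a b r y t τ'
      = (r (τ * I) - r (τ' * I)) * φ τ + r (τ' * I) * (φ τ - φ τ') := by
    simp only [scalarWeight, hφ]
    ring
  have e1 : |(r (τ * I) - r (τ' * I)) * φ τ| ≤ C * |τ - τ'| ^ (α : ℝ) * B := by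
    rw [abs_mul]
    have h3 := hC.dist_le m1 m2
    rw [Real.dist_eq, Real.dist_eq] at h3
    exact mul_le_mul h3 (hB τ (hsub m1)) (abs_nonneg _) (by positivity)
  have e2 : |r (τ' * I) * (φ τ - φ τ')| ≤ W * (K * |τ - τ'|) := by
    rw [abs_mul]
    have h3 := hK.dist_le_mul τ (hsub m1) τ' (hsub m2)
    rw [Real.dist_eq, Real.dist_eq] at h3
    exact mul_le_mul (hW τ' (hsub m2)) h3 (abs_nonneg _) hW0
  have e3 : 0 ≤ W * K * |τ - τ'| ^ (α : ℝ) := by positivity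
  have e4 : 0 ≤ C * B * |τ - τ'| := by positivity
  rw [e]
  linarith [abs_add_le ((r (τ * I) - r (τ' * I)) * φ τ) (r (τ' * I) * (φ τ - φ τ'))]

section Symmetry

variable {a b : ℝ} {r : ℂ → ℝ} (hr : IsWeight a b r) {x : ℝ} (hx : x ∈ Icc a b)
include hr hx

theorem IsWeight.apply_inv : r ((1 / x : ℝ) * I) = r (x * I) := by
  rw [← neg_one_div_mul_I, hr.symm_inv _ (mul_I_mem_cseg.2 hx)]

theorem IsWeight.apply_neg : r (-(x * I)) = r (x * I) := by
  rw [← star_mul_I, hr.symm_star _ (mul_I_mem_cseg.2 hx)]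

theorem IsWeight.apply_neg_inv : r (-((1 / x : ℝ) * I)) = r (x * I) := by
  rw [← neg_one_div_star_mul_I, hr.symm_inv_star _ (mul_I_mem_cseg.2 hx)]

end Symmetry

theorem max_norm_mul_I {x : ℝ} (hx : 1 ≤ x) : max ‖(x * I : ℂ)‖ ‖(x * I : ℂ)‖⁻¹ = x := by
  rw [norm_mul, norm_I, mul_one, Complex.norm_real, Real.norm_of_nonneg (by linarith)]
  exact max_eq_left ((inv_le_one_of_one_le₀ hx).trans hx)

theorem max_norm_inv_mul_I {x : ℝ} (hx : 1 ≤ x) :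
    max ‖((1 / x : ℝ) * I : ℂ)‖ ‖((1 / x : ℝ) * I : ℂ)‖⁻¹ = x := by
  rw [norm_mul, norm_I, mul_one, Complex.norm_real, Real.norm_of_nonneg (by positivity), one_div,
    inv_inv]
  exact max_eq_right ((inv_le_one_of_one_le₀ hx).trans hx)

section LimitWeight

variable {a b : ℝ} (ha : 1 < a) {r : ℂ → ℝ} (hr : IsWeight a b r) (ρ : ℝ → ℝ) {x : ℝ}
  (hx : x ∈ Icc a b)
include ha hx

theorem limitWeight_apply :
    limitWeight a b ρ r (x * I) = (b - a) * ρ x * r (x * I) := by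
  rw [limitWeight, max_norm_mul_I (ha.le.trans hx.1)]

include hr

theorem limitWeight_apply_inv :
    limitWeight a b ρ r ((1 / x : ℝ) * I) = (b - a) * ρ x * r (x * I) := by
  rw [limitWeight, max_norm_inv_mul_I (ha.le.trans hx.1), hr.apply_inv hx]

theorem limitWeight_apply_neg :
    limitWeight a b ρ r (-(x * I)) = (b - a) * ρ x * r (x * I) := by
  rw [limitWeight, norm_neg, max_norm_mul_I (ha.le.trans hx.1), hr.apply_neg hx]

theorem limitWeight_apply_neg_inv :
    limitWeight a b ρ r (-((1 / x : ℝ) * I)) = (b - a) * ρ x * r (x * I) := by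
  rw [limitWeight, norm_neg, max_norm_inv_mul_I (ha.le.trans hx.1), hr.apply_neg_inv hx]

end LimitWeight

/-! ### Riemann sums of Cauchy integrals -/

theorem integral_one_div {a b : ℝ} (ha : 0 < a) (hab : a ≤ b) (F : ℝ → ℂ) :
    ∫ τ in (1 / b)..(1 / a), F τ = ∫ x in a..b, F (1 / x) / (x : ℂ) ^ 2 := by
  have himg : (fun x : ℝ => 1 / x) '' Icc a b = Icc (1 / b) (1 / a) := by
    ext τ
    constructor
    · rintro ⟨x, hx, rfl⟩
      exact one_div_mem_Icc ha hx
    · intro hτ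
      have := one_div_mem_Icc (one_div_pos.2 (ha.trans_le hab)) hτ
      rw [one_div_one_div, one_div_one_div] at this
      exact ⟨1 / τ, this, one_div_one_div τ⟩
  rw [intervalIntegral.integral_of_le (one_div_le_one_div_of_le ha hab),
    intervalIntegral.integral_of_le hab, ← integral_Icc_eq_integral_Ioc,
    ← integral_Icc_eq_integral_Ioc, ← himg,
    integral_image_eq_integral_abs_deriv_smul (f' := fun x => -(x ^ 2)⁻¹) measurableSet_Icc
      (fun x hx => ?_) (fun x hx x' hx' h => ?_)]
  · refine setIntegral_congr_fun measurableSet_Icc fun x hx => ?_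
    simp only [abs_neg, abs_inv, abs_pow, sq_abs, real_smul]
    push_cast
    rw [div_eq_inv_mul _ ((x : ℂ) ^ 2)]
  · have := hasDerivAt_inv (ha.trans_le hx.1).ne'
    simpa only [one_div] using this.hasDerivWithinAt
  · simpa using h

theorem SamplingData.tendstoUniformlyOn_cauchySum {a b : ℝ} {ρ η : ℝ → ℝ}
    {s : (N : ℕ) → Fin N → ℝ} (h : SamplingData a b ρ η s) {χ : ℝ → ℂ}
    (hχ : ContinuousOn χ (Icc a b)) {κ : ℝ → ℂ}
    (hκ : ∀ x ∈ Icc a b, ∀ x' ∈ Icc a b, ‖κ x - κ x'‖ ≤ |x - x'|) {A : Set ℂ} (hA : IsOpen A)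
    (hκA : ∀ x ∈ Icc a b, κ x ∈ A) :
    TendstoUniformlyOn (fun N w => (∑ j, χ (s N j) * (w - κ (s N j))⁻¹) / N)
      (fun w => ∫ x in a..b, (ρ x : ℂ) * (χ x * (w - κ x)⁻¹)) atTop Aᶜ := by
  have hκc : ContinuousOn κ (Icc a b) := by
    refine LipschitzOnWith.continuousOn (K := 1) (LipschitzOnWith.of_dist_le_mul fun x hx x' hx' => ?_)
    rw [dist_eq_norm, Real.dist_eq, NNReal.coe_one, one_mul]
    exact hκ x hx x' hx'
  obtain ⟨d, hd, hdA⟩ := (isCompact_Icc.image_of_continuousOn hκc).exists_thickening_subset_open hA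
    (image_subset_iff.2 hκA)
  rw [Metric.tendstoUniformlyOn_iff]
  intro ε hε
  filter_upwards [eventually_quantile_sum_approx h.lt.le h.density_cont h.density_nonneg
    h.density_integral h.mem h.quantile hχ d⁻¹ (d⁻¹ * d⁻¹) (half_pos hε)] with N hN w hw
  have hdist : ∀ x ∈ Icc a b, d ≤ ‖w - κ x‖ := fun x hx => by
    by_contra! hlt
    refine hw (hdA (Metric.mem_thickening_iff.2 ⟨κ x, mem_image_of_mem κ hx, ?_⟩))
    rwa [dist_eq_norm]
  rw [dist_comm, dist_eq_norm]
  refine (hN (fun x => (w - κ x)⁻¹) (fun x hx => ?_) fun x hx x' hx' => ?_).trans_lt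
    (half_lt_self hε)
  · rw [norm_inv]
    exact inv_anti₀ hd (hdist x hx)
  · refine (norm_inv_sub_inv_le hd (hdist x hx) (hdist x' hx')).trans ?_
    rw [sub_sub_sub_cancel_left, norm_sub_rev]
    exact mul_le_mul_of_nonneg_left (hκ x hx x' hx') (by positivity)

theorem norming_mul_phaseWeight {a b : ℝ} {ρ : ℝ → ℝ} (r : ℂ → ℝ) (y t : ℝ) {N : ℕ}
    {z : Fin N → ℂ} (hz : IsSampled a b ρ z) (j : Fin N) :
    norming a b r z j * phaseWeight y t (z j).im
      = (scalarWeight a b r y t (z j).im : ℂ) / N := by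
  rw [norming, scalarWeight, ← hz.eq_mul_I j]
  push_cast
  ring

section RiemannSums

variable {a b : ℝ} (ha : 1 < a) (hab : a < b) {ρ : ℝ → ℝ} (hρ : IsSmoothDensity a b ρ)
  {r : ℂ → ℝ} (hr : IsWeight a b r) {z : (N : ℕ) → Fin N → ℂ}
  (hz : ∀ N, IsSampled a b ρ (z N)) (y t : ℝ) {A : Set ℂ} (hA : IsOpen A)
include ha hab hρ hr hz hA

theorem tendstoUniformlyOn_sum1p (hAs : cseg a b ⊆ A) :
    TendstoUniformlyOn (fun N w => sum1p (z N) (norming a b r (z N)) y t w)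
      (fun w => -cauchyMinus a b (limitWeight a b ρ r) y t w) atTop Aᶜ := by
  have h := samplingData ha hab hρ hr hz y t
  have hpos : ∀ x ∈ Icc a b, x ≠ 0 := fun x hx => by linarith [hx.1]
  have key := h.tendstoUniformlyOn_cauchySum (χ := fun x => (scalarWeight a b r y t x : ℂ))
    (κ := fun x => x * I) (continuous_ofReal.comp_continuousOn h.weight_cont)
    (fun x _ x' _ => by
      rw [← sub_mul, norm_mul, norm_I, mul_one, ← ofReal_sub, Complex.norm_real, Real.norm_eq_abs])
    hA fun x hx => hAs (mul_I_mem_cseg.2 hx)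
  refine (key.congr (.of_forall fun N w _ => ?_)).congr_right fun w _ => ?_
  · simp only [sum1p]
    rw [Finset.sum_div]
    refine Finset.sum_congr rfl fun j _ => ?_
    have e := norming_mul_phaseWeight r y t (hz N) j
    have e2 := exp_theta_mul_I y t (hpos _ (h.mem N j))
    rw [← (hz N).eq_mul_I j] at e2
    rw [e2, e, ← (hz N).eq_mul_I j]
    ring
  · simp only [cauchyMinus, segInt]
    rw [← intervalIntegral.integral_neg]
    refine intervalIntegral.integral_congr fun x hx => ?_
    rw [uIcc_of_le hab.le] at hx
    simp only [limitWeight_apply ha ρ hx, exp_theta_mul_I y t (hpos x hx), scalarWeight]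
    push_cast
    rw [div_eq_mul_inv, div_eq_mul_inv, mul_inv]
    linear_combination (ρ x * (b - a) * r (x * I) * phaseWeight y t x * (Real.pi : ℂ)⁻¹ *
      (w - x * I)⁻¹) * I_mul_I

theorem tendstoUniformlyOn_sum2p (hAs : cseg (1 / b) (1 / a) ⊆ A) :
    TendstoUniformlyOn (fun N w => sum2p (z N) (norming a b r (z N)) y t w)
      (fun w => cauchyMinus (1 / b) (1 / a) (limitWeight a b ρ r) y t w) atTop Aᶜ := by
  have h := samplingData ha hab hρ hr hz y t
  have hpos : ∀ x ∈ Icc a b, x ≠ 0 := fun x hx => by linarith [hx.1]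
  have key := h.tendstoUniformlyOn_cauchySum
    (χ := fun x => -((scalarWeight a b r y t x : ℂ) / (x : ℂ) ^ 2))
    (κ := fun x => (1 / x : ℝ) * I) ((continuous_ofReal.comp_continuousOn h.weight_cont).div
      (by fun_prop) fun x hx => by exact_mod_cast pow_ne_zero 2 (hpos x hx)).neg
    (fun x hx x' hx' => by
      rw [← sub_mul, norm_mul, norm_I, mul_one, ← ofReal_sub, Complex.norm_real, Real.norm_eq_abs]
      exact abs_inv_sub_inv_le (ha.le.trans hx.1) (ha.le.trans hx'.1))
    hA fun x hx => hAs (mul_I_mem_cseg.2 (one_div_mem_Icc h.a_pos hx))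
  refine (key.congr (.of_forall fun N w _ => ?_)).congr_right fun w _ => ?_
  · simp only [sum2p]
    rw [Finset.sum_div]
    refine Finset.sum_congr rfl fun j _ => ?_
    have e := norming_mul_phaseWeight r y t (hz N) j
    have e2 := exp_theta_inv_mul_I y t (hpos _ (h.mem N j))
    have e3 := neg_one_div_mul_I (z N j).im
    rw [← (hz N).eq_mul_I j] at e3
    rw [← e3] at e2 ⊢
    have e4 : z N j ^ 2 = -((z N j).im : ℂ) ^ 2 := by
      rw [(hz N).eq_mul_I j, mul_pow, I_sq]
      simp
    rw [e2, div_mul_eq_mul_div, e, e4, sub_neg_eq_add]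
    rw [div_neg, div_eq_mul_inv _ (w + 1 / z N j)]
    ring
  · simp only [cauchyMinus, segInt]
    rw [integral_one_div h.a_pos hab.le]
    refine intervalIntegral.integral_congr fun x hx => ?_
    rw [uIcc_of_le hab.le] at hx
    simp only [limitWeight_apply_inv ha hr ρ hx, exp_theta_inv_mul_I y t (hpos x hx), scalarWeight]
    push_cast
    rw [div_eq_mul_inv (I * _ * _), mul_inv, div_eq_mul_inv _ ((x : ℂ) ^ 2),
      div_eq_mul_inv _ ((x : ℂ) ^ 2)]
    linear_combination (-(ρ x * (b - a) * r (x * I) * phaseWeight y t x * (Real.pi : ℂ)⁻¹ *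
      (w - 1 / x * I)⁻¹ * ((x : ℂ) ^ 2)⁻¹)) * I_mul_I

theorem tendstoUniformlyOn_sum1m (hAs : cseg (-b) (-a) ⊆ A) :
    TendstoUniformlyOn (fun N w => sum1m (z N) (norming a b r (z N)) y t w)
      (fun w => -cauchyPlus (-b) (-a) (limitWeight a b ρ r) y t w) atTop Aᶜ := by
  have h := samplingData ha hab hρ hr hz y t
  have hpos : ∀ x ∈ Icc a b, x ≠ 0 := fun x hx => by linarith [hx.1]
  have key := h.tendstoUniformlyOn_cauchySum (χ := fun x => (scalarWeight a b r y t x : ℂ))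
    (κ := fun x => -(x * I)) (continuous_ofReal.comp_continuousOn h.weight_cont)
    (fun x _ x' _ => by
      rw [neg_sub_neg, ← sub_mul, norm_mul, norm_I, mul_one, ← ofReal_sub, Complex.norm_real,
        Real.norm_eq_abs, abs_sub_comm])
    hA fun x hx => hAs (by
      rw [← neg_mul, ← ofReal_neg]
      exact mul_I_mem_cseg.2 ⟨neg_le_neg hx.2, neg_le_neg hx.1⟩)
  refine (key.congr (.of_forall fun N w _ => ?_)).congr_right fun w _ => ?_
  · simp only [sum1m]
    rw [Finset.sum_div]
    refine Finset.sum_congr rfl fun j _ => ?_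
    have e := norming_mul_phaseWeight r y t (hz N) j
    have e2 := exp_theta_neg_mul_I y t (hpos _ (h.mem N j))
    have e3 := star_mul_I (z N j).im
    rw [← (hz N).eq_mul_I j] at e2 e3 ⊢
    rw [e3]
    have e4 : star (norming a b r (z N) j) = norming a b r (z N) j := by
      rw [norming, RCLike.star_def, conj_ofReal]
    rw [e2, e4, e]
    ring
  · simp only [cauchyPlus, segInt]
    rw [← intervalIntegral.integral_neg, ← intervalIntegral.integral_comp_neg]
    refine intervalIntegral.integral_congr fun x hx => ?_
    rw [uIcc_of_le hab.le] at hx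
    simp only [ofReal_neg, neg_mul, limitWeight_apply_neg ha hr ρ hx]
    rw [exp_theta_neg_mul_I y t (hpos x hx)]
    simp only [scalarWeight]
    push_cast
    rw [div_eq_mul_inv, div_eq_mul_inv, mul_inv]
    linear_combination (ρ x * (b - a) * r (x * I) * phaseWeight y t x * (Real.pi : ℂ)⁻¹ *
      (w - -(x * I))⁻¹) * I_mul_I

theorem tendstoUniformlyOn_sum2m (hAs : cseg (-(1 / a)) (-(1 / b)) ⊆ A) :
    TendstoUniformlyOn (fun N w => sum2m (z N) (norming a b r (z N)) y t w)
      (fun w => cauchyPlus (-(1 / a)) (-(1 / b)) (limitWeight a b ρ r) y t w) atTop Aᶜ := by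
  have h := samplingData ha hab hρ hr hz y t
  have hpos : ∀ x ∈ Icc a b, x ≠ 0 := fun x hx => by linarith [hx.1]
  have key := h.tendstoUniformlyOn_cauchySum
    (χ := fun x => -((scalarWeight a b r y t x : ℂ) / (x : ℂ) ^ 2))
    (κ := fun x => -((1 / x : ℝ) * I)) ((continuous_ofReal.comp_continuousOn h.weight_cont).div
      (by fun_prop) fun x hx => by exact_mod_cast pow_ne_zero 2 (hpos x hx)).neg
    (fun x hx x' hx' => by
      rw [neg_sub_neg, ← sub_mul, norm_mul, norm_I, mul_one, ← ofReal_sub, Complex.norm_real,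
        Real.norm_eq_abs, abs_sub_comm]
      exact abs_inv_sub_inv_le (ha.le.trans hx.1) (ha.le.trans hx'.1))
    hA fun x hx => hAs (by
      rw [← neg_mul, ← ofReal_neg]
      have := one_div_mem_Icc h.a_pos hx
      exact mul_I_mem_cseg.2 ⟨neg_le_neg this.2, neg_le_neg this.1⟩)
  refine (key.congr (.of_forall fun N w _ => ?_)).congr_right fun w _ => ?_
  · simp only [sum2m]
    rw [Finset.sum_div]
    refine Finset.sum_congr rfl fun j _ => ?_
    have e := norming_mul_phaseWeight r y t (hz N) j
    have e2 := exp_theta_neg_inv_mul_I y t (hpos _ (h.mem N j))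
    have e3 := one_div_mul_I (z N j).im
    rw [← (hz N).eq_mul_I j] at e3
    rw [← e3] at e2 ⊢
    have e4 : z N j ^ 2 = -((z N j).im : ℂ) ^ 2 := by
      rw [(hz N).eq_mul_I j, mul_pow, I_sq]
      simp
    rw [e2, div_mul_eq_mul_div, e, e4]
    rw [div_neg, div_eq_mul_inv _ (w - 1 / z N j)]
    ring
  · simp only [cauchyPlus, segInt]
    rw [← intervalIntegral.integral_comp_neg, integral_one_div h.a_pos hab.le]
    refine intervalIntegral.integral_congr fun x hx => ?_
    rw [uIcc_of_le hab.le] at hx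
    simp only [ofReal_neg, neg_mul, limitWeight_apply_neg_inv ha hr ρ hx]
    rw [exp_theta_neg_inv_mul_I y t (hpos x hx)]
    simp only [scalarWeight]
    push_cast
    rw [div_eq_mul_inv (I * _ * _), mul_inv, div_eq_mul_inv _ ((x : ℂ) ^ 2),
      div_eq_mul_inv _ ((x : ℂ) ^ 2)]
    linear_combination (-(ρ x * (b - a) * r (x * I) * phaseWeight y t x * (Real.pi : ℂ)⁻¹ *
      (w - -(1 / x * I))⁻¹ * ((x : ℂ) ^ 2)⁻¹)) * I_mul_I

end RiemannSums

/-! ### Locally uniform convergence -/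

theorem _root_.TendstoLocallyUniformlyOn.tendsto_prod {α β ι : Type*} [TopologicalSpace α]
    [UniformSpace β] {F : ι → α → β} {f : α → β} {l : Filter ι} {s : Set α}
    (h : TendstoLocallyUniformlyOn F f l s) (hs : IsOpen s) (hf : ContinuousOn f s) {x : α}
    (hx : x ∈ s) : Tendsto (fun q : ι × α => F q.1 q.2) (l ×ˢ 𝓝 x) (𝓝 (f x)) := by
  have h1 := tendstoLocallyUniformlyOn_iff_forall_tendsto.1 h x hx
  rw [hs.nhdsWithin_eq hx] at h1
  exact ((hf.continuousAt (hs.mem_nhds hx)).tendsto.comp tendsto_snd).congr_uniformity h1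

theorem tendstoLocallyUniformlyOn_of_tendsto_prod {α β ι : Type*} [TopologicalSpace α]
    [UniformSpace β] {F : ι → α → β} {f : α → β} {l : Filter ι} {s : Set α} (hs : IsOpen s)
    (hf : ContinuousOn f s)
    (h : ∀ x ∈ s, Tendsto (fun q : ι × α => F q.1 q.2) (l ×ˢ 𝓝 x) (𝓝 (f x))) :
    TendstoLocallyUniformlyOn F f l s := by
  refine tendstoLocallyUniformlyOn_iff_forall_tendsto.2 fun x hx => ?_
  rw [hs.nhdsWithin_eq hx]
  exact (((hf.continuousAt (hs.mem_nhds hx)).tendsto.comp tendsto_snd).prodMk_nhds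
    (h x hx)).mono_right (nhds_le_uniformity _)

open Classical in
theorem _root_.TendstoLocallyUniformlyOn.ite {α β ι : Type*} [TopologicalSpace α]
    [UniformSpace β] {F F' : ι → α → β} {f f' : α → β} {l : Filter ι} {s : Set α}
    (h : TendstoLocallyUniformlyOn F f l s) (h' : TendstoLocallyUniformlyOn F' f' l s)
    (D : Set α) :
    TendstoLocallyUniformlyOn (fun n x => if x ∈ D then F n x else F' n x)
      (fun x => if x ∈ D then f x else f' x) l s := by
  intro u hu x hx
  obtain ⟨t, ht, h1⟩ := h u hu x hx
  obtain ⟨t', ht', h1'⟩ := h' u hu x hx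
  refine ⟨t ∩ t', inter_mem ht ht', ?_⟩
  filter_upwards [h1, h1'] with n hn hn' y hy
  split_ifs
  · exact hn y hy.1
  · exact hn' y hy.2

theorem tendstoLocallyUniformlyOn_compl {ι : Type*} {F : ι → ℂ → ℂ} {f : ℂ → ℂ}
    {l : Filter ι} {K : Set ℂ} (hK : IsClosed K)
    (h : ∀ A, IsOpen A → K ⊆ A → TendstoUniformlyOn F f l Aᶜ) :
    TendstoLocallyUniformlyOn F f l Kᶜ := by
  intro u hu x hx
  obtain ⟨C, hC, hCc, hCK⟩ := exists_mem_nhds_isClosed_subset (hK.isOpen_compl.mem_nhds hx)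
  have h1 := h Cᶜ hCc.isOpen_compl (subset_compl_comm.1 hCK)
  rw [compl_compl] at h1
  exact ⟨C, mem_nhdsWithin_of_mem_nhds hC, h1 u hu⟩

theorem continuous_low : Continuous low := by
  refine continuous_iff_continuousAt.2 fun v => tendsto_mat2_iff.2 fun i j => ?_
  fin_cases i <;> fin_cases j
  · exact tendsto_const_nhds
  · exact tendsto_const_nhds
  · exact tendsto_id
  · exact tendsto_const_nhds

theorem continuous_up : Continuous up := by
  refine continuous_iff_continuousAt.2 fun v => tendsto_mat2_iff.2 fun i j => ?_
  fin_cases i <;> fin_cases j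
  · exact tendsto_const_nhds
  · exact tendsto_id
  · exact tendsto_const_nhds
  · exact tendsto_const_nhds

theorem low_mul_low_neg (v : ℂ) : low v * low (-v) = 1 := by
  rw [low, low, Matrix.mul_fin_two, Matrix.one_fin_two]
  simp

theorem up_mul_up_neg (v : ℂ) : up v * up (-v) = 1 := by
  rw [up, up, Matrix.mul_fin_two, Matrix.one_fin_two]
  simp

theorem isClosed_cseg (p q : ℝ) : IsClosed (cseg p q) := (isCompact_cseg p q).isClosed

theorem isOpen_compl_closedContour (a b : ℝ) : IsOpen (closedContour a b)ᶜ :=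
  ((((isClosed_cseg _ _).union (isClosed_cseg _ _)).union (isClosed_cseg _ _)).union
    (isClosed_cseg _ _)).isOpen_compl

theorem I_notMem_closedContour {a b : ℝ} (ha : 1 < a) (hb : 0 < b) : I ∉ closedContour a b := by
  rintro (((h | h) | h) | h)
  · exact I_notMem_upperContour (b := b) ha (Or.inl h)
  · exact I_notMem_upperContour (b := b) ha (Or.inr h)
  · have := h.2.2
    rw [I_im] at this
    linarith
  · have := h.2.2
    have h0 := one_div_pos.2 hb
    rw [I_im] at this
    linarith

open Classical in
/-- The limit of the matrices without poles, in terms of the solution of the limiting problem. -/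
noncomputable def fromSegments {a b : ℝ} (D : Regions a b) (R : ℂ → ℝ) (y t : ℝ)
    (M : ℂ → Mat2) (w : ℂ) : Mat2 :=
  if w ∈ D.D1p then M w * low (- -cauchyMinus a b R y t w)
  else if w ∈ D.D2p then M w * low (cauchyMinus (1 / b) (1 / a) R y t w)
  else if w ∈ D.D1m then M w * up (-cauchyPlus (-b) (-a) R y t w)
  else if w ∈ D.D2m then M w * up (-cauchyPlus (-(1 / a)) (-(1 / b)) R y t w)
  else M w

theorem toSegments_fromSegments {a b : ℝ} (D : Regions a b) (R : ℂ → ℝ) (y t : ℝ)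
    (M : ℂ → Mat2) : toSegments D R y t (fromSegments D R y t M) = M := by
  funext w
  have hup : ∀ v, up (-v) * up v = 1 := fun v => by
    have := up_mul_up_neg (-v)
    rwa [neg_neg] at this
  simp only [toSegments, fromSegments]
  split_ifs
  · rw [neg_neg, Matrix.mul_assoc, low_mul_low_neg, Matrix.mul_one]
  · rw [Matrix.mul_assoc, low_mul_low_neg, Matrix.mul_one]
  · rw [Matrix.mul_assoc, hup, Matrix.mul_one]
  · rw [Matrix.mul_assoc, hup, Matrix.mul_one]
  · rfl

/-- The removal of the poles does not change the matrix near `z = i`. -/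
theorem removePoles_eventuallyEq {a b : ℝ} (D : Regions a b) {N : ℕ} (z c : Fin N → ℂ) (y t : ℝ)
    (M : ℂ → Mat2) : removePoles D z c y t M =ᶠ[𝓝 I] M := by
  have h1 : ∀ᶠ w in 𝓝 I, w ∉ D.D1p := by
    filter_upwards [isClosed_closure.isOpen_compl.mem_nhds D.I_notMem1] with w hw h
    exact hw (subset_closure h)
  have h2 : ∀ᶠ w in 𝓝 I, w ∉ D.D2p := by
    filter_upwards [isClosed_closure.isOpen_compl.mem_nhds D.I_notMem2] with w hw h
    exact hw (subset_closure h)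
  have h3 : ∀ᶠ w : ℂ in 𝓝 I, 0 < w.im :=
    continuous_im.continuousAt.eventually (lt_mem_nhds (by simp))
  filter_upwards [h1, h2, h3] with w hw1 hw2 hw3
  have hw4 : w ∉ D.D1m := fun h => lt_asymm hw3 (D.lower1 h)
  have hw5 : w ∉ D.D2m := fun h => lt_asymm hw3 (D.lower2 h)
  rw [removePoles, if_neg hw1, if_neg hw2, if_neg hw4, if_neg hw5]

theorem tendsto_symMatrix_prod {ι : Type*} {l : Filter ι} {a b : ℝ} {G : ι → ℂ → ℂ} {g : ℂ → ℂ}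
    (h : ∀ u ∉ upperContour a b, Tendsto (fun q : ι × ℂ => G q.1 q.2) (l ×ˢ 𝓝 u) (𝓝 (g u))) {x : ℂ}
    (hx : x ∉ closedContour a b) :
    Tendsto (fun q : ι × ℂ => symMatrix (G q.1) q.2) (l ×ˢ 𝓝 x) (𝓝 (symMatrix g x)) := by
  obtain ⟨h1, h2⟩ := notMem_of_notMem_closedContour hx
  have hrow : ∀ f : ℂ → ℂ, Continuous f → f x ∉ upperContour a b →
      Tendsto (fun q : ι × ℂ => G q.1 (f q.2)) (l ×ˢ 𝓝 x) (𝓝 (g (f x))) :=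
    fun f hf hfx => (h _ hfx).comp (Tendsto.prodMap tendsto_id (hf.tendsto x))
  have hrefl : ∀ f : ℂ → ℂ, Continuous f → f x ∉ upperContour a b →
      Tendsto (fun q : ι × ℂ => reflConj (G q.1) (f q.2)) (l ×ˢ 𝓝 x)
        (𝓝 (reflConj g (f x))) := fun f hf hfx =>
    (continuous_star.tendsto _).comp (hrow (fun w => -star (f w)) (by fun_prop)
      fun h' => hfx (neg_star_mem_upperContour.1 h'))
  exact tendsto_symMatrix (hrow (fun w => w) continuous_id h1) (hrefl (fun w => w) continuous_id h1)
    (hrow (fun w => -w) continuous_neg h2) (hrefl (fun w => -w) continuous_neg h2)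

namespace SamplingData

variable {a b : ℝ} {ρ η : ℝ → ℝ} {s : (N : ℕ) → Fin N → ℝ} (h : SamplingData a b ρ η s)
include h

theorem tendsto_row_prod {x : ℂ} (hx : x ∉ upperContour a b) :
    Tendsto (fun q : ℕ × ℂ => h.row q.1 q.2) (atTop ×ˢ 𝓝 x) (𝓝 (h.limRow x)) :=
  h.tendstoLocallyUniformlyOn_row.tendsto_prod (isOpen_compl_upperContour a b)
    h.differentiableOn_limRow.continuousOn hx

theorem tendsto_symMatrix_row {x : ℂ} (hx : x ∉ closedContour a b) :
    Tendsto (fun q : ℕ × ℂ => symMatrix (h.row q.1) q.2) (atTop ×ˢ 𝓝 x)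
      (𝓝 (symMatrix h.limRow x)) :=
  tendsto_symMatrix_prod (fun _ hu => h.tendsto_row_prod hu) hx

theorem continuousOn_symMatrix : ContinuousOn (symMatrix h.limRow) (closedContour a b)ᶜ :=
  fun z hz => tendsto_mat2_iff.2 fun i j => (h.differentiableOn_symMatrix i j).continuousOn z hz

end SamplingData

section Main

variable {a b : ℝ} (ha : 1 < a) (hab : a < b) {ρ : ℝ → ℝ} (hρ : IsSmoothDensity a b ρ)
  {r : ℂ → ℝ} (hr : IsWeight a b r) {z : (N : ℕ) → Fin N → ℂ}
  (hz : ∀ N, IsSampled a b ρ (z N)) (y t : ℝ)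
include ha hab hρ hr hz

theorem solvesSolitonRHP_row (N : ℕ) : SolvesSolitonRHP (z N) (norming a b r (z N)) y t
    (symMatrix ((samplingData ha hab hρ hr hz y t).row N)) := by
  have h := samplingData ha hab hρ hr hz y t
  refine solvesSolitonRHP_symMatrix (γ := fun j => (b - a) * r (z N j) / (N * Real.pi))
    (h.one_lt_point N) (fun j => (h.mem N j).2) h.b_pos (h.injective N) (hz N).eq_mul_I
    (fun j => rfl) (fun j => ?_) (h.coeff_sign N) (h.sol_eq N)
  have := norming_mul_phaseWeight r y t (hz N) j
  rw [norming] at this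
  exact_mod_cast this.symm

theorem notMem_spectrumSet {N : ℕ} {w : ℂ} (hw : w ∉ closedContour a b) :
    w ∉ spectrumSet (z N) := by
  have h := samplingData ha hab hρ hr hz 0 0
  rw [mem_spectrumSet_iff (hz N).eq_mul_I]
  obtain ⟨h1, h2⟩ := notMem_of_notMem_closedContour hw
  rintro ⟨l, hl | hl⟩
  · exact h1 (hl ▸ h.poleHeight_mem N l)
  · refine h2 ?_
    rw [hl, neg_neg]
    exact h.poleHeight_mem N l

theorem SolvesSolitonRHP.eq_row {N : ℕ} {M : ℂ → Mat2}
    (hM : SolvesSolitonRHP (z N) (norming a b r (z N)) y t M) {w : ℂ}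
    (hw : w ∉ closedContour a b) :
    M w = symMatrix ((samplingData ha hab hρ hr hz y t).row N) w := by
  have h := samplingData ha hab hρ hr hz y t
  refine hM.eq_symMatrix (γ := fun j => (b - a) * r (z N j) / (N * Real.pi))
    (h.one_lt_point N) (fun j => (h.mem N j).2) h.b_pos (h.injective N) (hz N).eq_mul_I
    (fun j => rfl) (fun j => ?_) (h.coeff_sign N) (h.sol_eq N)
    (notMem_spectrumSet ha hab hρ hr hz hw)
  have := norming_mul_phaseWeight r y t (hz N) j
  rw [norming] at this
  exact_mod_cast this.symm

theorem tendsto_sum1p_prod {x : ℂ} (hx : x ∉ cseg a b) :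
    Tendsto (fun q : ℕ × ℂ => sum1p (z q.1) (norming a b r (z q.1)) y t q.2) (atTop ×ˢ 𝓝 x)
        (𝓝 (-cauchyMinus a b (limitWeight a b ρ r) y t x)) ∧
      ContinuousAt (fun w => -cauchyMinus a b (limitWeight a b ρ r) y t w) x := by
  have hl := tendstoLocallyUniformlyOn_compl (isClosed_cseg a b) fun A hA hs =>
    tendstoUniformlyOn_sum1p ha hab hρ hr hz y t hA hs
  have hc := hl.continuousOn (.of_forall fun N => ?_)
  · have ho := (isClosed_cseg a b).isOpen_compl
    exact ⟨hl.tendsto_prod ho hc hx, hc.continuousAt (ho.mem_nhds hx)⟩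
  · refine continuousOn_finsetSum _ fun j _ => ?_
    refine continuousOn_const.div (by fun_prop) fun w hw h0 => hw ?_
    rw [sub_eq_zero.1 h0]
    exact (hz N j).1

theorem tendsto_sum2p_prod {x : ℂ} (hx : x ∉ cseg (1 / b) (1 / a)) :
    Tendsto (fun q : ℕ × ℂ => sum2p (z q.1) (norming a b r (z q.1)) y t q.2) (atTop ×ˢ 𝓝 x)
        (𝓝 (cauchyMinus (1 / b) (1 / a) (limitWeight a b ρ r) y t x)) ∧
      ContinuousAt (fun w => cauchyMinus (1 / b) (1 / a) (limitWeight a b ρ r) y t w) x := by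
  have hl := tendstoLocallyUniformlyOn_compl (isClosed_cseg (1 / b) (1 / a)) fun A hA hs =>
    tendstoUniformlyOn_sum2p ha hab hρ hr hz y t hA hs
  have hc := hl.continuousOn (.of_forall fun N => ?_)
  · have ho := (isClosed_cseg (1 / b) (1 / a)).isOpen_compl
    exact ⟨hl.tendsto_prod ho hc hx, hc.continuousAt (ho.mem_nhds hx)⟩
  · refine continuousOn_finsetSum _ fun j _ => ?_
    refine continuousOn_const.div (by fun_prop) fun w hw h0 => hw ?_
    rw [eq_neg_of_add_eq_zero_left h0, (hz N).eq_mul_I j, neg_one_div_mul_I]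
    exact mul_I_mem_cseg.2 (one_div_mem_Icc (by linarith) (hz N j).1.2)

theorem tendsto_sum1m_prod {x : ℂ} (hx : x ∉ cseg (-b) (-a)) :
    Tendsto (fun q : ℕ × ℂ => sum1m (z q.1) (norming a b r (z q.1)) y t q.2) (atTop ×ˢ 𝓝 x)
        (𝓝 (-cauchyPlus (-b) (-a) (limitWeight a b ρ r) y t x)) ∧
      ContinuousAt (fun w => -cauchyPlus (-b) (-a) (limitWeight a b ρ r) y t w) x := by
  have hl := tendstoLocallyUniformlyOn_compl (isClosed_cseg (-b) (-a)) fun A hA hs =>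
    tendstoUniformlyOn_sum1m ha hab hρ hr hz y t hA hs
  have hc := hl.continuousOn (.of_forall fun N => ?_)
  · have ho := (isClosed_cseg (-b) (-a)).isOpen_compl
    exact ⟨hl.tendsto_prod ho hc hx, hc.continuousAt (ho.mem_nhds hx)⟩
  · refine continuousOn_finsetSum _ fun j _ => ?_
    refine continuousOn_const.div (by fun_prop) fun w hw h0 => hw ?_
    have h1 := (hz N j).1.2
    rw [sub_eq_zero.1 h0, (hz N).eq_mul_I j, star_mul_I, ← neg_mul, ← ofReal_neg]
    exact mul_I_mem_cseg.2 ⟨neg_le_neg h1.2, neg_le_neg h1.1⟩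

theorem tendsto_sum2m_prod {x : ℂ} (hx : x ∉ cseg (-(1 / a)) (-(1 / b))) :
    Tendsto (fun q : ℕ × ℂ => sum2m (z q.1) (norming a b r (z q.1)) y t q.2) (atTop ×ˢ 𝓝 x)
        (𝓝 (cauchyPlus (-(1 / a)) (-(1 / b)) (limitWeight a b ρ r) y t x)) ∧
      ContinuousAt (fun w => cauchyPlus (-(1 / a)) (-(1 / b)) (limitWeight a b ρ r) y t w) x := by
  have hl := tendstoLocallyUniformlyOn_compl (isClosed_cseg (-(1 / a)) (-(1 / b))) fun A hA hs =>
    tendstoUniformlyOn_sum2m ha hab hρ hr hz y t hA hs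
  have hc := hl.continuousOn (.of_forall fun N => ?_)
  · have ho := (isClosed_cseg (-(1 / a)) (-(1 / b))).isOpen_compl
    exact ⟨hl.tendsto_prod ho hc hx, hc.continuousAt (ho.mem_nhds hx)⟩
  · refine continuousOn_finsetSum _ fun j _ => ?_
    refine continuousOn_const.div (by fun_prop) fun w hw h0 => hw ?_
    have h1 := one_div_mem_Icc (by linarith) (hz N j).1.2
    rw [sub_eq_zero.1 h0, (hz N).eq_mul_I j, one_div_mul_I, ← neg_mul, ← ofReal_neg]
    exact mul_I_mem_cseg.2 ⟨neg_le_neg h1.2, neg_le_neg h1.1⟩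

/-- Locally uniform convergence of the matrices without poles. -/
theorem tendstoLocallyUniformlyOn_removePoles (D : Regions a b) {M : ℕ → ℂ → Mat2}
    (hM : ∀ N, SolvesSolitonRHP (z N) (norming a b r (z N)) y t (M N)) :
    TendstoLocallyUniformlyOn
      (fun N => removePoles D (z N) (norming a b r (z N)) y t (M N))
      (fromSegments D (limitWeight a b ρ r) y t
        (symMatrix (samplingData ha hab hρ hr hz y t).limRow)) atTop (closedContour a b)ᶜ := by
  have h := samplingData ha hab hρ hr hz y t
  have ho := isOpen_compl_closedContour a b
  have hM0 : ∀ x ∈ (closedContour a b)ᶜ, Tendsto (fun q : ℕ × ℂ => M q.1 q.2) (atTop ×ˢ 𝓝 x)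
      (𝓝 (symMatrix h.limRow x)) := fun x hx => by
    refine (h.tendsto_symMatrix_row hx).congr' ?_
    filter_upwards [tendsto_snd.eventually (ho.mem_nhds hx)] with q hq
    exact ((hM q.1).eq_row ha hab hρ hr hz y t hq).symm
  have hcM : ∀ x ∈ (closedContour a b)ᶜ, ContinuousAt (symMatrix h.limRow) x := fun x hx =>
    h.continuousOn_symMatrix.continuousAt (ho.mem_nhds hx)
  have key : ∀ (J : ℂ → Mat2) (F : ℕ → ℂ → ℂ) (f : ℂ → ℂ), Continuous J →
      (∀ x ∈ (closedContour a b)ᶜ, Tendsto (fun q : ℕ × ℂ => F q.1 q.2) (atTop ×ˢ 𝓝 x) (𝓝 (f x)) ∧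
        ContinuousAt f x) →
      TendstoLocallyUniformlyOn (fun N w => M N w * J (F N w))
        (fun w => symMatrix h.limRow w * J (f w)) atTop (closedContour a b)ᶜ :=
    fun J F f hJ hF => by
      refine tendstoLocallyUniformlyOn_of_tendsto_prod ho (fun x hx => ?_) fun x hx => ?_
      · exact ((hcM x hx).mul (hJ.continuousAt.comp (hF x hx).2)).continuousWithinAt
      · exact (hM0 x hx).mul ((hJ.tendsto _).comp (hF x hx).1)
  have k0 : TendstoLocallyUniformlyOn M (symMatrix h.limRow) atTop (closedContour a b)ᶜ :=
    tendstoLocallyUniformlyOn_of_tendsto_prod ho h.continuousOn_symMatrix hM0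
  have k1 := key (fun v => low (-v))
    (fun N w => sum1p (z N) (norming a b r (z N)) y t w)
    (fun w => -cauchyMinus a b (limitWeight a b ρ r) y t w) (continuous_low.comp continuous_neg) fun x hx =>
    tendsto_sum1p_prod ha hab hρ hr hz y t fun hx' => hx (Or.inl (Or.inl (Or.inl hx')))
  have k2 := key low
    (fun N w => sum2p (z N) (norming a b r (z N)) y t w)
    (fun w => cauchyMinus (1 / b) (1 / a) (limitWeight a b ρ r) y t w) continuous_low fun x hx =>
    tendsto_sum2p_prod ha hab hρ hr hz y t fun hx' => hx (Or.inl (Or.inl (Or.inr hx')))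
  have k3 := key up
    (fun N w => sum1m (z N) (norming a b r (z N)) y t w)
    (fun w => -cauchyPlus (-b) (-a) (limitWeight a b ρ r) y t w) continuous_up fun x hx =>
    tendsto_sum1m_prod ha hab hρ hr hz y t fun hx' => hx (Or.inl (Or.inr hx'))
  have k4 := key (fun v => up (-v))
    (fun N w => sum2m (z N) (norming a b r (z N)) y t w)
    (fun w => cauchyPlus (-(1 / a)) (-(1 / b)) (limitWeight a b ρ r) y t w) (continuous_up.comp continuous_neg) fun x hx =>
    tendsto_sum2m_prod ha hab hρ hr hz y t fun hx' => hx (Or.inr hx')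
  exact k1.ite (k2.ite (k3.ite (k4.ite k0 D.D2m) D.D1m) D.D2p) D.D1p

theorem solvesLimitRHP_limRow {R : ℂ → ℝ}
    (hR : ∀ x ∈ Icc a b, R (x * I) = (b - a) * ρ x * r (x * I))
    (hR' : ∀ x ∈ Icc a b, R ((1 / x : ℝ) * I) = R (x * I) ∧ R (-(x * I)) = R (x * I) ∧
      R (-((1 / x : ℝ) * I)) = R (x * I)) :
    SolvesLimitRHP a b R y t (symMatrix (samplingData ha hab hρ hr hz y t).limRow) := by
  refine (samplingData ha hab hρ hr hz y t).solvesLimitRHP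
    (fun σ hσ => holderNear_scalarWeight ha hρ hr y t hσ) (fun σ hσ => ?_)
    fun σ hσ => hR' σ (Ioo_subset_Icc_self hσ)
  rw [hR σ (Ioo_subset_Icc_self hσ), scalarWeight]
  field_simp

end Main

end MCH

theorem mainTheorem3 (a b : ℝ) (ha : 1 < a) (hab : a < b)
    (ρ : ℝ → ℝ) (hρ : MCH.IsSmoothDensity a b ρ)
    (r : ℂ → ℝ) (hr : MCH.IsWeight a b r)
    (z : (N : ℕ) → Fin N → ℂ) (hz : ∀ N, MCH.IsSampled a b ρ (z N))
    (D : MCH.Regions a b) (y t : ℝ) :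
    -- Riemann sums: uniform convergence away from the segments
    (∀ A : Set ℂ, IsOpen A → MCH.cseg a b ⊆ A →
      TendstoUniformlyOn (fun N w => MCH.sum1p (z N) (MCH.norming a b r (z N)) y t w)
        (fun w => -MCH.cauchyMinus a b (MCH.limitWeight a b ρ r) y t w) atTop Aᶜ) ∧
    (∀ A : Set ℂ, IsOpen A → MCH.cseg (1 / b) (1 / a) ⊆ A →
      TendstoUniformlyOn (fun N w => MCH.sum2p (z N) (MCH.norming a b r (z N)) y t w)
        (fun w => MCH.cauchyMinus (1 / b) (1 / a) (MCH.limitWeight a b ρ r) y t w) atTop Aᶜ) ∧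
    (∀ A : Set ℂ, IsOpen A → MCH.cseg (-b) (-a) ⊆ A →
      TendstoUniformlyOn (fun N w => MCH.sum1m (z N) (MCH.norming a b r (z N)) y t w)
        (fun w => -MCH.cauchyPlus (-b) (-a) (MCH.limitWeight a b ρ r) y t w) atTop Aᶜ) ∧
    (∀ A : Set ℂ, IsOpen A → MCH.cseg (-(1 / a)) (-(1 / b)) ⊆ A →
      TendstoUniformlyOn (fun N w => MCH.sum2m (z N) (MCH.norming a b r (z N)) y t w)
        (fun w => MCH.cauchyPlus (-(1 / a)) (-(1 / b)) (MCH.limitWeight a b ρ r) y t w)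
        atTop Aᶜ) ∧
    -- the `N`-soliton problems are solvable
    (∀ N, ∃ M : ℂ → MCH.Mat2,
      MCH.SolvesSolitonRHP (z N) (MCH.norming a b r (z N)) y t M) ∧
    -- the limit, the limiting Riemann-Hilbert problem and the reconstruction
    (∀ M0 : ℕ → ℂ → MCH.Mat2,
      (∀ N, MCH.SolvesSolitonRHP (z N) (MCH.norming a b r (z N)) y t (M0 N)) →
      ∃ (Mlim M3 : ℂ → MCH.Mat2) (x u : ℝ) (xN uN : ℕ → ℝ),
        TendstoLocallyUniformlyOn
          (fun N => MCH.removePoles D (z N) (MCH.norming a b r (z N)) y t (M0 N))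
          Mlim atTop (MCH.closedContour a b)ᶜ ∧
        M3 = MCH.toSegments D (MCH.limitWeight a b ρ r) y t Mlim ∧
        MCH.SolvesLimitRHP a b (MCH.limitWeight a b ρ r) y t M3 ∧
        ((∀ s ∈ Set.Icc a b, ρ s = 1 / (b - a)) → MCH.SolvesLimitRHP a b r y t M3) ∧
        (∀ N, MCH.Recovers y (M0 N) (xN N) (uN N)) ∧
        (∀ N, MCH.Recovers y (MCH.removePoles D (z N) (MCH.norming a b r (z N)) y t (M0 N))
          (xN N) (uN N)) ∧
        Tendsto xN atTop (𝓝 x) ∧ Tendsto uN atTop (𝓝 u) ∧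
        MCH.Recovers y M3 x u) := by
  have h := MCH.samplingData ha hab hρ hr hz y t
  refine ⟨fun A hA hs => MCH.tendstoUniformlyOn_sum1p ha hab hρ hr hz y t hA hs,
    fun A hA hs => MCH.tendstoUniformlyOn_sum2p ha hab hρ hr hz y t hA hs,
    fun A hA hs => MCH.tendstoUniformlyOn_sum1m ha hab hρ hr hz y t hA hs,
    fun A hA hs => MCH.tendstoUniformlyOn_sum2m ha hab hρ hr hz y t hA hs,
    fun N => ⟨_, MCH.solvesSolitonRHP_row ha hab hρ hr hz y t N⟩, fun M0 hM0 => ?_⟩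
  have hrec : ∀ N, MCH.Recovers y (M0 N) _ _ := fun N =>
    ((h.rowSymmetric_row N).recovers y).congr <| by
      filter_upwards [(MCH.isOpen_compl_closedContour a b).mem_nhds
        (MCH.I_notMem_closedContour ha h.b_pos)] with w hw
      exact (hM0 N).eq_row ha hab hρ hr hz y t hw
  refine ⟨MCH.fromSegments D (MCH.limitWeight a b ρ r) y t (MCH.symMatrix h.limRow),
    MCH.symMatrix h.limRow, _, _, _, _,
    MCH.tendstoLocallyUniformlyOn_removePoles ha hab hρ hr hz y t D hM0,
    (MCH.toSegments_fromSegments D _ y t _).symm,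
    MCH.solvesLimitRHP_limRow ha hab hρ hr hz y t (fun x hx => MCH.limitWeight_apply ha ρ hx)
      fun x hx => ?_,
    fun hu => MCH.solvesLimitRHP_limRow ha hab hρ hr hz y t (fun x hx => ?_) fun x hx =>
      ⟨hr.apply_inv hx, hr.apply_neg hx, hr.apply_neg_inv hx⟩,
    hrec, fun N => (hrec N).congr (MCH.removePoles_eventuallyEq D _ _ y t _),
    h.tendsto_x y, h.tendsto_u, h.rowSymmetric_limRow.recovers y⟩
  · rw [MCH.limitWeight_apply ha ρ hx, MCH.limitWeight_apply_inv ha hr ρ hx,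
      MCH.limitWeight_apply_neg ha hr ρ hx, MCH.limitWeight_apply_neg_inv ha hr ρ hx]
    exact ⟨rfl, rfl, rfl⟩
  · rw [hu x hx, mul_one_div_cancel (sub_ne_zero.2 hab.ne'), one_mul]
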